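/- Let $M$ be a compact smooth oriented Riemannian manifold without boundary, of dimension $m\ge 4$, with volume form $\nu_M$, and let $E$ be a smooth Hermitian vector bundle over $M$. For a smooth Hermitian connection $D_A$ on $E$ let $F_A\in\Omega^2(M,\mathrm{ad}(E))$ be its curvature, where $\mathrm{ad}(E)=\mathfrak u(E)$ is the bundle of skew-Hermitian endomorphisms of $E$ with the inner product $\langle S,T\rangle=-\mathrm{tr}(ST)$, and let $$|F_A|^2=\sum_{i<j}\langle F_A(e_i,e_j),F_A(e_i,e_j)\rangle\quad(e_1,\dots,e_m\text{ an orthonormal frame}),\qquad YM(D_A)=\int_M|F_A|^2\,\nu_M .$$ For $\Phi\in\Omega^{m-4}(M)$ let $q_\Phi(\varphi)=(\varphi\wedge\varphi\wedge\Phi)/\nu_M$ for real two-forms $\varphi$, and extend $q_\Phi$ to $\mathrm{ad}(E)$-valued two-forms by means of the inner product on $\mathrm{ad}(E)$, so that $q_\Phi(F_A)=-\mathrm{tr}(F_A\wedge F_A)\wedge\Phi/\nu_M$. A smooth form $\Phi\in\Omega^{m-4}(M)$ is a Yang–Mills calibrating form if $d\Phi=0$ and $q_\Phi(\varphi)\le|\varphi|^2$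 for all $\varphi\in\Omega^2(M)$, where $|\varphi|^2=\sum_{i<j}\varphi(e_i,e_j)^2$. A Hermitian connection $D_A$ is $\Phi$-calibrated if $q_\Phi(F_A)=|F_A|^2$ at every point of $M$. Lemma. Let $\Phi$ be a Yang–Mills calibrating form on $M$ and let $D_A$ be a $\Phi$-calibrated Hermitian connection on $E$. Then every Hermitian connection $D_{A'}$ on $E$ satisfies $YM(D_{A'})\ge YM(D_A)$. Moreover, if $YM(D_{A'})=YM(D_A)$, then $D_{A'}$ is also $\Phi$-calibrated. -/

import Mathlib

open Bundle Set MeasureTheory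
open scoped Manifold ContDiff Topology

set_option linter.unusedSectionVars false

attribute [local instance] InnerProductSpace.complexToReal

noncomputable section

namespace YMCalib

/-! ### Linear algebra: wedge products, the quadratic form of a top-minus-four form -/

section LinearAlgebra

variable {V : Type*} [AddCommGroup V] [Module ℝ V]
  {W₁ W₂ W : Type*} [AddCommGroup W₁] [Module ℝ W₁] [AddCommGroup W₂] [Module ℝ W₂]
  [AddCommGroup W] [Module ℝ W]

/-- The wedge product of two vector-valued forms, with values multiplied through the bilinear map
`β` (sum over shuffles, so that `(e¹ ∧ e²)(e₁, e₂) = 1`). -/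
def wedge {p q : ℕ} (β : W₁ →ₗ[ℝ] W₂ →ₗ[ℝ] W)
    (a : V [⋀^Fin p]→ₗ[ℝ] W₁) (b : V [⋀^Fin q]→ₗ[ℝ] W₂) : V [⋀^Fin (p + q)]→ₗ[ℝ] W :=
  ((TensorProduct.lift β).compAlternatingMap (a.domCoprod b)).domDomCongr finSumFinEquiv

/-- The quotient `η / ν` of two top-degree forms (`ν ≠ 0`): the number `c` with `η = c ν`. -/
def topQuotient {n : ℕ} [hn : Fact (Module.finrank ℝ V = n)] [Module.Finite ℝ V]
    (η ν : V [⋀^Fin n]→ₗ[ℝ] ℝ) : ℝ :=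
  η (Module.finBasisOfFinrankEq ℝ V hn.out) / ν (Module.finBasisOfFinrankEq ℝ V hn.out)

/-- The quadratic form `q_Φ(φ) = φ ∧ φ ∧ Φ / ν` on two-forms with values in a space `W` with the
symmetric bilinear form `β`, which multiplies the values in `φ ∧ φ`. -/
def qForm {k : ℕ} [Fact (Module.finrank ℝ V = k + 4)] [Module.Finite ℝ V]
    (β : W →ₗ[ℝ] W →ₗ[ℝ] ℝ) (ν : V [⋀^Fin (k + 4)]→ₗ[ℝ] ℝ) (Φ : V [⋀^Fin k]→ₗ[ℝ] ℝ)
    (φ : V [⋀^Fin 2]→ₗ[ℝ] W) : ℝ :=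
  topQuotient ((wedge (LinearMap.mul ℝ ℝ) (wedge β φ φ) Φ).domDomCongr
    (finCongr (by omega : 2 + 2 + k = k + 4))) ν

end LinearAlgebra

/-- The squared norm `|φ|² = ∑_{i < j} |φ(eᵢ, eⱼ)|²` (`e` an orthonormal basis) of a two-form on a
Euclidean space with values in a space `W` with the symmetric bilinear form `β`. -/
def normSqForm {V : Type*} [NormedAddCommGroup V] [InnerProductSpace ℝ V] [Module.Finite ℝ V]
    {W : Type*} [AddCommGroup W] [Module ℝ W]
    (β : W →ₗ[ℝ] W →ₗ[ℝ] ℝ) (φ : V [⋀^Fin 2]→ₗ[ℝ] W) : ℝ :=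
  ∑ i, ∑ j ∈ Finset.Ioi i,
    β (φ ![stdOrthonormalBasis ℝ V i, stdOrthonormalBasis ℝ V j])
      (φ ![stdOrthonormalBasis ℝ V i, stdOrthonormalBasis ℝ V j])

/-- The bilinear form `⟨A, B⟩ = -Re tr(AB)` on endomorphisms of a complex vector space. On the
skew-Hermitian endomorphisms of a Hermitian space, `tr(AB)` is real and this is the usual positive
definite invariant inner product `tr(A* B)`. -/
def tracePairing (V : Type*) [AddCommGroup V] [Module ℂ V] :
    (V →ₗ[ℂ] V) →ₗ[ℝ] (V →ₗ[ℂ] V) →ₗ[ℝ] ℝ :=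
  LinearMap.mk₂ ℝ (fun A B ↦ -(LinearMap.trace ℂ V (A ∘ₗ B)).re)
    (fun A A' B ↦ by simp [LinearMap.add_comp]; ring)
    (fun c A B ↦ by
      have : (c • A) ∘ₗ B = (c : ℂ) • (A ∘ₗ B) := by ext; simp
      rw [this]; simp)
    (fun A B B' ↦ by simp [LinearMap.comp_add]; ring)
    (fun c A B ↦ by
      have : A ∘ₗ (c • B) = (c : ℂ) • (A ∘ₗ B) := by ext; simp
      rw [this]; simp)

/-! ### Differential forms, orientations and volume on a manifold -/

section Manifold

variable {n : ℕ} {M : Type*} [TopologicalSpace M] [ChartedSpace (EuclideanSpace ℝ (Fin n)) M]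

instance (x : M) : Fact (Module.finrank ℝ (TangentSpace (𝓡 n) x) = n) :=
  ⟨finrank_euclideanSpace_fin (𝕜 := ℝ) (n := n)⟩

instance (x : M) : Module.Finite ℝ (TangentSpace (𝓡 n) x) :=
  inferInstanceAs (Module.Finite ℝ (EuclideanSpace ℝ (Fin n)))

variable (n M) in
/-- Differential `k`-forms on `M`, without regularity. -/
abbrev DForm (k : ℕ) : Type _ := ∀ x : M, TangentSpace (𝓡 n) x [⋀^Fin k]→L[ℝ] ℝ

/-- The differential of the inverse of the chart at `x₀`, at the point with coordinates `y`: it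
sends the standard basis vectors to the coordinate vector fields. -/
def coordTangent (x₀ : M) (y : EuclideanSpace ℝ (Fin n)) :
    EuclideanSpace ℝ (Fin n) →L[ℝ] TangentSpace (𝓡 n) ((extChartAt (𝓡 n) x₀).symm y) :=
  mfderiv (𝓡 n) (𝓡 n) (extChartAt (𝓡 n) x₀).symm y

/-- A differential form read in the chart at `x₀` (its pull-back by the inverse of the chart). -/
def DForm.inChart {k : ℕ} (η : DForm n M k) (x₀ : M) (y : EuclideanSpace ℝ (Fin n)) :
    EuclideanSpace ℝ (Fin n) [⋀^Fin k]→L[ℝ] ℝ :=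
  (η ((extChartAt (𝓡 n) x₀).symm y)).compContinuousLinearMap (coordTangent x₀ y)

/-- A differential form is smooth if it is so in charts. -/
def DForm.IsSmooth {k : ℕ} (η : DForm n M k) : Prop :=
  ∀ x₀ : M, ContDiffOn ℝ ∞ (η.inChart x₀) (extChartAt (𝓡 n) x₀).target

/-- A differential form is closed if its exterior derivative, computed in charts, vanishes. -/
def DForm.IsClosed {k : ℕ} (η : DForm n M k) : Prop :=
  ∀ x₀ : M, ∀ y ∈ (extChartAt (𝓡 n) x₀).target, extDeriv (η.inChart x₀) y = 0

variable (n M) in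
/-- An orientation of `M`: an orientation of each tangent space, locally constant in the local
trivializations of the tangent bundle. -/
structure ManifoldOrientation [IsManifold (𝓡 n) ∞ M] where
  /-- The orientation of each tangent space. -/
  at' : ∀ x : M, Orientation ℝ (TangentSpace (𝓡 n) x) (Fin n)
  locallyConstant : ∀ x₀ : M, ∃ o₀ : Orientation ℝ (EuclideanSpace ℝ (Fin n)) (Fin n),
    ∀ᶠ x in 𝓝 x₀,
      ∀ hx : x ∈ (trivializationAt (EuclideanSpace ℝ (Fin n)) (TangentSpace (𝓡 n)) x₀).baseSet,
        Orientation.map (Fin n)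
          ((trivializationAt (EuclideanSpace ℝ (Fin n)) (TangentSpace (𝓡 n)) x₀).linearEquivAt
            ℝ x hx) (at' x) = o₀

variable [RiemannianBundle (fun x : M ↦ TangentSpace (𝓡 n) x)]

/-- The volume density `√det(gᵢⱼ)` of the metric in the chart at `x₀`. -/
def chartDensity (x₀ : M) (y : EuclideanSpace ℝ (Fin n)) : ℝ :=
  Real.sqrt (Matrix.det (Matrix.of fun i j : Fin n ↦
    inner ℝ (coordTangent x₀ y (EuclideanSpace.single i 1))
      (coordTangent x₀ y (EuclideanSpace.single j 1))))

/-- The Riemannian volume of the domain of the chart at `x₀`: the image of `√det(gᵢⱼ) dy`. -/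
def chartVolume [MeasurableSpace M] (x₀ : M) : Measure M :=
  Measure.map (extChartAt (𝓡 n) x₀).symm
    ((volume.restrict (extChartAt (𝓡 n) x₀).target).withDensity
      fun y ↦ ENNReal.ofReal (chartDensity x₀ y))

variable (n M) in
/-- The Riemannian volume measure: the least measure which dominates the volume of each chart
domain. As the latter agree on overlaps, it restricts to each of them. -/
def riemannianVolume [MeasurableSpace M] : Measure M := ⨆ x₀ : M, chartVolume (n := n) x₀

/-- The Riemannian volume form `ν_M` of an oriented Riemannian manifold. -/
def ManifoldOrientation.volumeForm [IsManifold (𝓡 n) ∞ M] (o : ManifoldOrientation n M) (x : M) :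
    TangentSpace (𝓡 n) x [⋀^Fin n]→ₗ[ℝ] ℝ :=
  (o.at' x).volumeForm

end Manifold

/-! ### Hermitian connections and curvature -/

section Connection

variable {n : ℕ} {M : Type*} [TopologicalSpace M] [ChartedSpace (EuclideanSpace ℝ (Fin n)) M]
  [IsManifold (𝓡 n) ∞ M]
  (F : Type*) [NormedAddCommGroup F] [NormedSpace ℂ F] [FiniteDimensional ℂ F]
  (E : M → Type*) [TopologicalSpace (TotalSpace F E)]
  [∀ x, NormedAddCommGroup (E x)] [∀ x, InnerProductSpace ℂ (E x)]
  [FiberBundle F E] [VectorBundle ℂ F E] [VectorBundle ℝ F E]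
  [ContMDiffVectorBundle ∞ F E (𝓡 n)] [IsContMDiffRiemannianBundle (𝓡 n) ∞ F E]

variable (n) in
/-- A Hermitian connection on a Hermitian vector bundle `E`: a smooth covariant derivative on
sections of `E` which is complex linear and compatible with the metric. (A complex linear
connection is compatible with the Hermitian metric iff it is so with its real part.)
As in `CovariantDerivative`, `D σ x v` is `∇_v σ` at `x`. -/
structure HermitianConnection extends CovariantDerivative (𝓡 n) F E where
  smooth : toCovariantDerivative.ContMDiffCovariantDerivative ∞
  complexLinear : ∀ (c : ℂ) (σ : ∀ x, E x) (x : M),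
    MDifferentiableAt (𝓡 n) ((𝓡 n).prod 𝓘(ℝ, F)) (fun y ↦ TotalSpace.mk' F y (σ y)) x →
    ∀ v : TangentSpace (𝓡 n) x, toFun (fun y ↦ c • σ y) x v = c • toFun σ x v
  metric : toCovariantDerivative.IsMetricCompatible

variable {F E}

namespace HermitianConnection

variable (D : HermitianConnection n F E)

/-- `∇_X ∇_Y σ - ∇_Y ∇_X σ - ∇_[X, Y] σ` at the point `x`. -/
def curvatureOp (X Y : ∀ x : M, TangentSpace (𝓡 n) x) (σ : ∀ x, E x) (x : M) : E x :=
  D.toFun (fun y ↦ D.toFun σ y (Y y)) x (X x) - D.toFun (fun y ↦ D.toFun σ y (X y)) x (Y x)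
    - D.toFun σ x (VectorField.mlieBracket (𝓡 n) X Y x)

/-- The derivative of the local extension of a vector `e` is differentiable. -/
lemma mdifferentiableAt_cov_extend [T2Space M] {x : M} (e : E x) :
    MDifferentiableAt (𝓡 n) ((𝓡 n).prod 𝓘(ℝ, EuclideanSpace ℝ (Fin n) →L[ℝ] F))
      (fun y ↦ TotalSpace.mk' (EuclideanSpace ℝ (Fin n) →L[ℝ] F)
        (E := fun y ↦ TangentSpace (𝓡 n) y →L[ℝ] E y) y (D.toFun (FiberBundle.extend F e) y)) x := by
  obtain ⟨s, hs, hσ⟩ := FiberBundle.exists_contMDiffOn_extend (k := ∞) (𝓡 n) F e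
  obtain ⟨u, hus, hu, hxu⟩ := mem_nhds_iff.1 hs
  obtain ⟨f, hf, -⟩ := (SmoothBumpFunction.nhds_basis_support (I := 𝓡 n)
    (hu.mem_nhds hxu)).mem_iff.1 (hu.mem_nhds hxu)
  have hσu := hσ.mono hus
  have hglob := ContMDiffOn.smul_section_of_tsupport (n := ∞) (ψ := f)
    f.contMDiff.contMDiffOn hu hf hσu
  have hD := D.smooth.contMDiff.contMDiff (σ := (f : M → ℝ) • FiberBundle.extend F e)
    (by simpa using hglob.contMDiffOn)
  have hDx := (hD.contMDiffAt Filter.univ_mem).mdifferentiableAt (x := x) (by simp)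
  refine hDx.congr_of_eventuallyEq ?_
  have h1 : ∀ᶠ y in 𝓝 x, f =ᶠ[𝓝 y] 1 := eventually_eventually_nhds.2 f.eventuallyEq_one
  filter_upwards [hu.mem_nhds hxu, h1] with y hy hfy
  congr 1
  refine D.isCovariantDerivativeOnUniv.congr_of_eventuallyEq (s := univ)
    ((hσu.contMDiffAt (hu.mem_nhds hy)).mdifferentiableAt (by simp))
    (hglob.contMDiffAt.mdifferentiableAt (by simp)) Filter.univ_mem ?_
  filter_upwards [hfy] with z hz
  simp [hz]

lemma curvatureOp_tensorial₁ [T2Space M] {x : M} (e : E x) {Y : ∀ x : M, TangentSpace (𝓡 n) x}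
    (hY : MDifferentiableAt (𝓡 n) ((𝓡 n).prod 𝓘(ℝ, EuclideanSpace ℝ (Fin n)))
      (fun y ↦ TotalSpace.mk' (EuclideanSpace ℝ (Fin n)) y (Y y)) x) :
    TensorialAt (𝓡 n) (EuclideanSpace ℝ (Fin n))
      (fun X ↦ D.curvatureOp X Y (FiberBundle.extend F e) x) x where
  smul {f X} hf hX := by
    have h := (D.mdifferentiableAt_cov_extend e).clm_bundle_apply hX
    have h2 := D.isCovariantDerivativeOnUniv.leibniz h hf
    have h3 : (fun y ↦ D.toFun (FiberBundle.extend F e) y ((f • X) y)) =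
      f • fun y ↦ D.toFun (FiberBundle.extend F e) y (X y) := by ext y; simp
    simp only [curvatureOp, h3, h2, VectorField.mlieBracket_smul_left hf hX]
    simp
    module
  add {X X'} hX hX' := by
    have h := (D.mdifferentiableAt_cov_extend e).clm_bundle_apply hX
    have h' := (D.mdifferentiableAt_cov_extend e).clm_bundle_apply hX'
    have h2 := D.isCovariantDerivativeOnUniv.add h h'
    have h3 : (fun y ↦ D.toFun (FiberBundle.extend F e) y ((X + X') y)) =
      (fun y ↦ D.toFun (FiberBundle.extend F e) y (X y)) + fun y ↦ D.toFun (FiberBundle.extend F e) y (X' y) := by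
        ext y; simp
    simp only [curvatureOp, h3, h2, VectorField.mlieBracket_add_left hX hX']
    simp
    abel

lemma curvatureOp_swap (X Y : ∀ x : M, TangentSpace (𝓡 n) x) (σ : ∀ x, E x) (x : M) :
    D.curvatureOp X Y σ x = -D.curvatureOp Y X σ x := by
  simp only [curvatureOp]
  rw [VectorField.mlieBracket_swap]
  simp
  abel

lemma curvatureOp_tensorial₂ [T2Space M] {x : M} (e : E x) {X : ∀ x : M, TangentSpace (𝓡 n) x}
    (hX : MDifferentiableAt (𝓡 n) ((𝓡 n).prod 𝓘(ℝ, EuclideanSpace ℝ (Fin n)))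
      (fun y ↦ TotalSpace.mk' (EuclideanSpace ℝ (Fin n)) y (X y)) x) :
    TensorialAt (𝓡 n) (EuclideanSpace ℝ (Fin n))
      (fun Y ↦ D.curvatureOp X Y (FiberBundle.extend F e) x) x where
  smul {f Y} hf hY := by
    have := (D.curvatureOp_tensorial₁ e hX).smul hf hY
    simp only [D.curvatureOp_swap X, this, smul_neg]
  add {Y Y'} hY hY' := by
    have := (D.curvatureOp_tensorial₁ e hX).add hY hY'
    simp only [D.curvatureOp_swap X, this, neg_add]

/-- `F(u, v) e` as a bilinear map in `u, v`. -/
def curvatureBilin [T2Space M] (x : M) (e : E x) :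
    TangentSpace (𝓡 n) x →L[ℝ] TangentSpace (𝓡 n) x →L[ℝ] E x :=
  TensorialAt.mkHom₂ (fun X Y ↦ D.curvatureOp X Y (FiberBundle.extend F e) x) x
    (fun _ hY ↦ D.curvatureOp_tensorial₁ e hY) (fun _ hX ↦ D.curvatureOp_tensorial₂ e hX)

/-- Multiplication by a complex constant preserves differentiability of sections. -/
lemma mdifferentiableAt_complex_smul {σ : ∀ x, E x} {x : M} (c : ℂ)
    (hσ : MDifferentiableAt (𝓡 n) ((𝓡 n).prod 𝓘(ℝ, F)) (fun y ↦ TotalSpace.mk' F y (σ y)) x) :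
    MDifferentiableAt (𝓡 n) ((𝓡 n).prod 𝓘(ℝ, F))
      (fun y ↦ TotalSpace.mk' F y ((c • σ) y)) x := by
  rw [mdifferentiableAt_section] at hσ ⊢
  have h : MDifferentiableAt (𝓡 n) 𝓘(ℝ, F)
      (fun y ↦ (c • ContinuousLinearMap.id ℝ F) (trivializationAt F E x ⟨y, σ y⟩).2) x :=
    (c • ContinuousLinearMap.id ℝ F).differentiableAt.mdifferentiableAt.comp x hσ
  refine h.congr_of_eventuallyEq ?_
  filter_upwards [(trivializationAt F E x).open_baseSet.mem_nhds
    (FiberBundle.mem_baseSet_trivializationAt' (F := F) (E := E) x)] with y hy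
  have := map_smul ((trivializationAt F E x).linearEquivAt ℂ y hy) c (σ y)
  simp only [Trivialization.linearEquivAt_apply] at this
  exact this

lemma toFun_linear {σ σ' τ : ∀ x, E x} {x : M} (a b : ℂ)
    (hσ : MDifferentiableAt (𝓡 n) ((𝓡 n).prod 𝓘(ℝ, F)) (fun y ↦ TotalSpace.mk' F y (σ y)) x)
    (hσ' : MDifferentiableAt (𝓡 n) ((𝓡 n).prod 𝓘(ℝ, F)) (fun y ↦ TotalSpace.mk' F y (σ' y)) x)
    (hτ : ∀ᶠ y in 𝓝 x, τ y = a • σ y + b • σ' y) (v : TangentSpace (𝓡 n) x) :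
    D.toFun τ x v = a • D.toFun σ x v + b • D.toFun σ' x v := by
  have h := mdifferentiableAt_complex_smul (n := n) a hσ
  have h' := mdifferentiableAt_complex_smul (n := n) b hσ'
  have hadd := mdifferentiableAt_add_section h h'
  have hτ' : MDifferentiableAt (𝓡 n) ((𝓡 n).prod 𝓘(ℝ, F)) (fun y ↦ TotalSpace.mk' F y (τ y)) x :=
    hadd.congr_of_eventuallyEq (by filter_upwards [hτ] with y hy; simp [hy])
  rw [D.isCovariantDerivativeOnUniv.congr_of_eventuallyEq hτ' hadd Filter.univ_mem hτ,
    D.isCovariantDerivativeOnUniv.add h h']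
  have h1 := D.complexLinear a σ x hσ v
  have h2 := D.complexLinear b σ' x hσ' v
  rw [← h1, ← h2]
  rfl

lemma extend_linear {x y : M} (hy : y ∈ (trivializationAt F E x).baseSet) (a b : ℂ) (e e' : E x) :
    FiberBundle.extend F (a • e + b • e') y =
      a • FiberBundle.extend F e y + b • FiberBundle.extend F e' y := by
  have hx := FiberBundle.mem_baseSet_trivializationAt' (F := F) (E := E) x
  simp only [FiberBundle.extend]
  simp only [← Trivialization.symmₗ_apply (R := ℂ) _ hy,
      ← Trivialization.linearEquivAt_apply (R := ℂ) _ x hx, map_add, map_smul]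

lemma curvatureOp_linear [T2Space M] (X Y : ∀ x : M, TangentSpace (𝓡 n) x) {x : M}
    (hX : MDifferentiableAt (𝓡 n) ((𝓡 n).prod 𝓘(ℝ, EuclideanSpace ℝ (Fin n)))
      (fun y ↦ TotalSpace.mk' (EuclideanSpace ℝ (Fin n)) y (X y)) x)
    (hY : MDifferentiableAt (𝓡 n) ((𝓡 n).prod 𝓘(ℝ, EuclideanSpace ℝ (Fin n)))
      (fun y ↦ TotalSpace.mk' (EuclideanSpace ℝ (Fin n)) y (Y y)) x) (a b : ℂ) (e e' : E x) :
    D.curvatureOp X Y (FiberBundle.extend F (a • e + b • e')) x =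
      a • D.curvatureOp X Y (FiberBundle.extend F e) x +
        b • D.curvatureOp X Y (FiberBundle.extend F e') x := by
  have hlin : ∀ᶠ y in 𝓝 x, FiberBundle.extend F (a • e + b • e') y =
      a • FiberBundle.extend F e y + b • FiberBundle.extend F e' y := by
    filter_upwards [(trivializationAt F E x).open_baseSet.mem_nhds
      (FiberBundle.mem_baseSet_trivializationAt' (F := F) (E := E) x)] with y hy
    exact extend_linear hy a b e e'
  have hd (e : E x) : ∀ᶠ y in 𝓝 x, MDifferentiableAt (𝓡 n) ((𝓡 n).prod 𝓘(ℝ, F))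
      (fun y ↦ TotalSpace.mk' F y (FiberBundle.extend F e y)) y := by
    obtain ⟨s, hs, h⟩ := FiberBundle.exists_mdifferentiableOn_extend (𝓡 n) F e
    filter_upwards [eventually_mem_nhds_iff.2 hs] with y hy using h.mdifferentiableAt hy
  have h1 : ∀ᶠ y in 𝓝 x, ∀ v, D.toFun (FiberBundle.extend F (a • e + b • e')) y v =
      a • D.toFun (FiberBundle.extend F e) y v + b • D.toFun (FiberBundle.extend F e') y v := by
    filter_upwards [eventually_eventually_nhds.2 hlin, hd e, hd e'] with y hy he he' v
    exact D.toFun_linear a b he he' hy v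
  have h2 {Z : ∀ x : M, TangentSpace (𝓡 n) x}
      (hZ : MDifferentiableAt (𝓡 n) ((𝓡 n).prod 𝓘(ℝ, EuclideanSpace ℝ (Fin n)))
        (fun y ↦ TotalSpace.mk' (EuclideanSpace ℝ (Fin n)) y (Z y)) x)
      (v : TangentSpace (𝓡 n) x) :=
    D.toFun_linear (τ := fun y ↦ D.toFun (FiberBundle.extend F (a • e + b • e')) y (Z y)) a b
      ((D.mdifferentiableAt_cov_extend e).clm_bundle_apply hZ)
      ((D.mdifferentiableAt_cov_extend e').clm_bundle_apply hZ)
      (h1.mono fun y hy ↦ hy (Z y)) v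
  simp only [curvatureOp, h2 hX, h2 hY, h1.self_of_nhds]
  module

/-- The curvature `F_A` of a Hermitian connection at `x`, as a two-form with values in the
endomorphisms of the fiber: `F_A(X, Y) σ = ∇_X ∇_Y σ - ∇_Y ∇_X σ - ∇_[X, Y] σ`, computed with any
extension of the vectors. -/
def curvature [T2Space M] (x : M) : TangentSpace (𝓡 n) x [⋀^Fin 2]→ₗ[ℝ] (E x →ₗ[ℂ] E x) where
  toFun v :=
    { toFun := fun e ↦ D.curvatureBilin x e (v 0) (v 1)
      map_add' := fun e e' ↦ by
        have := D.curvatureOp_linear _ _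
          (FiberBundle.mdifferentiableAt_extend (𝓡 n) (EuclideanSpace ℝ (Fin n)) (v 0))
          (FiberBundle.mdifferentiableAt_extend (𝓡 n) (EuclideanSpace ℝ (Fin n)) (v 1)) 1 1 e e'
        simpa [curvatureBilin, TensorialAt.mkHom₂_apply_eq_extend] using this
      map_smul' := fun c e ↦ by
        have := D.curvatureOp_linear _ _
          (FiberBundle.mdifferentiableAt_extend (𝓡 n) (EuclideanSpace ℝ (Fin n)) (v 0))
          (FiberBundle.mdifferentiableAt_extend (𝓡 n) (EuclideanSpace ℝ (Fin n)) (v 1)) c 0 e e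
        simpa [curvatureBilin, TensorialAt.mkHom₂_apply_eq_extend] using this }
  map_update_add' v i u w := by
    ext e
    fin_cases i <;> simp
  map_update_smul' v i c u := by
    ext e
    fin_cases i <;> simp
  map_eq_zero_of_eq' v i j hv hij := by
    ext e
    have h : v 0 = v 1 := by fin_cases i <;> fin_cases j <;> simp_all
    have h2 := D.curvatureOp_swap (FiberBundle.extend (EuclideanSpace ℝ (Fin n)) (v 0))
      (FiberBundle.extend (EuclideanSpace ℝ (Fin n)) (v 0)) (FiberBundle.extend F e) x
    have h3 := eq_neg_iff_add_eq_zero.1 h2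
    rw [← two_smul ℝ] at h3
    simpa [curvatureBilin, TensorialAt.mkHom₂_apply_eq_extend, h] using h3

variable [RiemannianBundle (fun x : M ↦ TangentSpace (𝓡 n) x)]

/-- The pointwise squared norm `|F_A|²` of the curvature. -/
def curvatureNormSq [T2Space M] (x : M) : ℝ := normSqForm (tracePairing (E x)) (D.curvature x)

/-- The Yang-Mills energy `∫_M |F_A|² ν_M`. -/
def yangMills [T2Space M] [MeasurableSpace M] : ℝ :=
  ∫ x, D.curvatureNormSq x ∂(riemannianVolume n M)

end HermitianConnection

end Connection

/-! ### Yang-Mills calibrations -/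

section Calibration

variable {k : ℕ} {M : Type*} [TopologicalSpace M]
  [ChartedSpace (EuclideanSpace ℝ (Fin (k + 4))) M] [IsManifold (𝓡 (k + 4)) ∞ M]
  [RiemannianBundle (fun x : M ↦ TangentSpace (𝓡 (k + 4)) x)]

/-- A form `Φ` of degree `m - 4` on an oriented Riemannian manifold of dimension `m = k + 4` is a
Yang-Mills calibrating form if it is (smooth and) closed and `q_Φ(φ) ≤ |φ|²` for all real
two-forms `φ`. -/
structure IsYangMillsCalibratingForm (o : ManifoldOrientation (k + 4) M) (Φ : DForm (k + 4) M k) :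
    Prop where
  smooth : Φ.IsSmooth
  closed : Φ.IsClosed
  le_normSq : ∀ (x : M) (φ : TangentSpace (𝓡 (k + 4)) x [⋀^Fin 2]→ₗ[ℝ] ℝ),
    qForm (LinearMap.mul ℝ ℝ) (o.volumeForm x) (Φ x).toAlternatingMap φ ≤
      normSqForm (LinearMap.mul ℝ ℝ) φ

variable
  {F : Type*} [NormedAddCommGroup F] [NormedSpace ℂ F] [FiniteDimensional ℂ F]
  {E : M → Type*} [TopologicalSpace (TotalSpace F E)]
  [∀ x, NormedAddCommGroup (E x)] [∀ x, InnerProductSpace ℂ (E x)]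
  [FiberBundle F E] [VectorBundle ℂ F E] [VectorBundle ℝ F E]
  [ContMDiffVectorBundle ∞ F E (𝓡 (k + 4))] [IsContMDiffRiemannianBundle (𝓡 (k + 4)) ∞ F E]

/-- A Hermitian connection is `Φ`-calibrated if its curvature satisfies `q_Φ(F_A) = |F_A|²`. -/
def HermitianConnection.IsCalibrated [T2Space M] (D : HermitianConnection (k + 4) F E)
    (o : ManifoldOrientation (k + 4) M) (Φ : DForm (k + 4) M k) : Prop :=
  ∀ x : M, qForm (tracePairing (E x)) (o.volumeForm x) (Φ x).toAlternatingMap (D.curvature x) =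
    D.curvatureNormSq x

end Calibration

end YMCalib

end

noncomputable section

namespace YMCalib

/-! The argument is the calibration argument. Pointwise, `q_Φ(F_A') ≤ |F_A'|²`, with equality
everywhere when the connection is calibrated. The integral of `q_Φ(F_A)` is the same for all
Hermitian connections, by Chern–Weil theory and `dΦ = 0`. Hence `YM(A) = ∫ q_Φ(F_A) = ∫ q_Φ(F_A') ≤
YM(A')`. In the case of equality the continuous nonnegative function `|F_A'|² - q_Φ(F_A')` has
integral zero, so it vanishes identically.

The pointwise inequality (`qForm_le_normSqForm_of_skew`) is assumed only for real two-forms. On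
skew-Hermitian endomorphisms the pairing is half the sum of products of matrix entries in a real
orthonormal basis of the fibre, so both sides split into sums over the entries, which are real
two-forms. Skewness of the curvature (`curvature_skew`) comes from metric compatibility and the
symmetry of second derivatives of `⟨σ, τ⟩`.

The invariance (`integral_calibDensity_eq`) rests on the transgression `T = tr(a ∧ (F + F')) -
tr(a³) / 3` with `a = A' - A`, for which `dT = tr(F' ∧ F') - tr(F ∧ F)`. It is proved locally by
comparing `T` with the difference of the Chern–Simons forms (`asymThree_transgression`,
`altSum_pd_chernSimons`). Stokes' theorem on `M` is replaced by integration by parts in charts: for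
a cut-off `ρ` in a chart, `∫ ρ dT ∧ Φ = -∫ dρ ∧ T ∧ Φ`. Since `T` is globally defined, summing over
a partition of unity gives `-∫ d(∑ ρ_j) ∧ T ∧ Φ = 0`.

Forms are handled through `altSum`, the signed sum over all permutations of the slots of a
four-tensor times a `k`-tensor. Calculus takes place in a chart and a trivialization, where the
connection is `d + A` with `A` valued in real endomorphisms of the model fibre. There `-Re tr`
becomes `halfTrace`, that is `-tr / 2` of the real trace. -/

lemma isManifold_one {n : ℕ} {M : Type*} [TopologicalSpace M]
    [ChartedSpace (EuclideanSpace ℝ (Fin n)) M] [IsManifold (𝓡 n) ∞ M] : IsManifold (𝓡 n) 1 M :=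
  IsManifold.of_le (n := ∞) (by simp)

attribute [local instance] isManifold_one

/-! ### Wedge products as signed sums over permutations. -/

section LinearAlgebra

variable {V : Type*} [AddCommGroup V] [Module ℝ V]
  {W₁ W₂ W : Type*} [AddCommGroup W₁] [Module ℝ W₁] [AddCommGroup W₂] [Module ℝ W₂]
  [AddCommGroup W] [Module ℝ W]

/-- The product of two multilinear maps, with values multiplied through `β`. -/
def mulTensor {p q : ℕ} (β : W₁ →ₗ[ℝ] W₂ →ₗ[ℝ] W)
    (a : MultilinearMap ℝ (fun _ : Fin p ↦ V) W₁) (b : MultilinearMap ℝ (fun _ : Fin q ↦ V) W₂) :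
    MultilinearMap ℝ (fun _ : Fin (p + q) ↦ V) W :=
  ((TensorProduct.lift β).compMultilinearMap (a.domCoprod b)).domDomCongr finSumFinEquiv

lemma mulTensor_apply {p q : ℕ} (β : W₁ →ₗ[ℝ] W₂ →ₗ[ℝ] W)
    (a : MultilinearMap ℝ (fun _ : Fin p ↦ V) W₁) (b : MultilinearMap ℝ (fun _ : Fin q ↦ V) W₂)
    (v : Fin (p + q) → V) :
    mulTensor β a b v = β (a fun i ↦ v (Fin.castAdd q i)) (b fun i ↦ v (Fin.natAdd p i)) := by
  simp [mulTensor]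

lemma alternatization_domDomCongr {ι ι' : Type*} [Fintype ι] [DecidableEq ι] [Fintype ι']
    [DecidableEq ι'] (e : ι ≃ ι') (m : MultilinearMap ℝ (fun _ : ι ↦ V) W) :
    MultilinearMap.alternatization (m.domDomCongr e) =
      (MultilinearMap.alternatization m).domDomCongr e := by
  ext v
  simp only [MultilinearMap.alternatization_apply, AlternatingMap.domDomCongr_apply,
    MultilinearMap.domDomCongr_apply]
  refine (Fintype.sum_equiv (Equiv.permCongr e) _ _ fun σ ↦ ?_).symm
  simp [Equiv.Perm.sign_permCongr]

/-- No factorials appear because `wedge` sums over shuffles, which represent the cosets of the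
permutations preserving the two blocks of arguments. -/
lemma wedge_alternatization {p q : ℕ} (β : W₁ →ₗ[ℝ] W₂ →ₗ[ℝ] W)
    (a : MultilinearMap ℝ (fun _ : Fin p ↦ V) W₁) (b : MultilinearMap ℝ (fun _ : Fin q ↦ V) W₂) :
    wedge β (MultilinearMap.alternatization a) (MultilinearMap.alternatization b) =
      MultilinearMap.alternatization (mulTensor β a b) := by
  rw [wedge, mulTensor, alternatization_domDomCongr,
    LinearMap.compMultilinearMap_alternatization, MultilinearMap.domCoprod_alternization]

lemma wedge_smul_smul {p q : ℕ} (β : W₁ →ₗ[ℝ] W₂ →ₗ[ℝ] W) (c d : ℝ)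
    (a : V [⋀^Fin p]→ₗ[ℝ] W₁) (b : V [⋀^Fin q]→ₗ[ℝ] W₂) :
    wedge β (c • a) (d • b) = (c * d) • wedge β a b := by
  rw [wedge, wedge, ← AlternatingMap.domCoprod'_apply, ← AlternatingMap.domCoprod'_apply,
    TensorProduct.smul_tmul_smul, map_smul]
  ext v
  simp

/-- Each of the `p!` permutations contributes the same term when the map is already alternating. -/
lemma alternatization_coe_eq_smul {p : ℕ} (a : V [⋀^Fin p]→ₗ[ℝ] W) :
    a = ((p.factorial : ℝ)⁻¹) • MultilinearMap.alternatization a.toMultilinearMap := by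
  have h := AlternatingMap.coe_alternatization a
  rw [show a.toMultilinearMap = (a : MultilinearMap ℝ (fun _ ↦ V) W) from rfl, h,
    Fintype.card_fin, ← Nat.cast_smul_eq_nsmul ℝ, smul_smul, inv_mul_cancel₀, one_smul]
  exact_mod_cast p.factorial_ne_zero

/-- The signed sum over all permutations of `k + 4` arguments of a four-tensor times a
`k`-tensor. -/
def altSum {ι : Type*} {k : ℕ} (v : Fin (k + 4) → ι) (g : ι → ι → ι → ι → ℝ)
    (f : (Fin k → ι) → ℝ) : ℝ :=
  ∑ σ : Equiv.Perm (Fin (k + 4)), ((Equiv.Perm.sign σ : ℤ) : ℝ) *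
    (g (v (σ 0)) (v (σ 1)) (v (σ 2)) (v (σ 3)) * f fun i ↦ v (σ (i.addNat 4)))

/-- The product of a four-tensor and a `k`-tensor, as a `(k + 4)`-tensor. -/
def mulTensorFour {k : ℕ} (g : MultilinearMap ℝ (fun _ : Fin 4 ↦ V) ℝ)
    (f : MultilinearMap ℝ (fun _ : Fin k ↦ V) ℝ) :
    MultilinearMap ℝ (fun _ : Fin (k + 4) ↦ V) ℝ :=
  (mulTensor (LinearMap.mul ℝ ℝ) g f).domDomCongr (finCongr (by omega : 4 + k = k + 4))

lemma alternatization_mulTensorFour {k : ℕ} (g : MultilinearMap ℝ (fun _ : Fin 4 ↦ V) ℝ)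
    (f : MultilinearMap ℝ (fun _ : Fin k ↦ V) ℝ) (v : Fin (k + 4) → V) :
    MultilinearMap.alternatization (mulTensorFour g f) v =
      altSum v (fun a b c d ↦ g ![a, b, c, d]) f := by
  rw [MultilinearMap.alternatization_apply, altSum]
  refine Finset.sum_congr rfl fun σ _ ↦ ?_
  rw [MultilinearMap.domDomCongr_apply, mulTensorFour, MultilinearMap.domDomCongr_apply,
    mulTensor_apply, LinearMap.mul_apply', Units.smul_def, zsmul_eq_mul]
  congr 3
  · ext i
    fin_cases i <;> rfl
  · ext i
    congr 2
    ext
    simp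

/-- A change of basis multiplies both top forms by the same determinant, which cancels. The quotient
can therefore be computed in coordinate frames. -/
lemma topQuotient_eq {n : ℕ} [hn : Fact (Module.finrank ℝ V = n)] [Module.Finite ℝ V]
    (η ν : V [⋀^Fin n]→ₗ[ℝ] ℝ) (v : Module.Basis (Fin n) ℝ V) :
    topQuotient η ν = η v / ν v := by
  set b := Module.finBasisOfFinrankEq ℝ V hn.out
  have h (ζ : V [⋀^Fin n]→ₗ[ℝ] ℝ) : ζ b = ζ v * v.det b := by
    conv_lhs => rw [AlternatingMap.eq_smul_basis_det v ζ]
    simp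
  have hd : v.det b ≠ 0 := (v.isUnit_det b).ne_zero
  rw [topQuotient, h η, h ν, mul_div_mul_right _ _ hd]

lemma altSum_congr_basis {k : ℕ} [hn : Fact (Module.finrank ℝ V = k + 4)] [Module.Finite ℝ V]
    (g : MultilinearMap ℝ (fun _ : Fin 4 ↦ V) ℝ)
    (f : MultilinearMap ℝ (fun _ : Fin k ↦ V) ℝ) (ν : V [⋀^Fin (k + 4)]→ₗ[ℝ] ℝ)
    (v : Module.Basis (Fin (k + 4)) ℝ V) :
    topQuotient (MultilinearMap.alternatization (mulTensorFour g f)) ν =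
      altSum v (fun a b c d ↦ g ![a, b, c, d]) f / ν v := by
  rw [topQuotient_eq _ _ v, alternatization_mulTensorFour]

/-- The quadratic form of a calibrating form, as a sum over permutations of a basis. -/
lemma qForm_eq_altSum {k : ℕ} [Fact (Module.finrank ℝ V = k + 4)] [Module.Finite ℝ V]
    (β : W →ₗ[ℝ] W →ₗ[ℝ] ℝ) (ν : V [⋀^Fin (k + 4)]→ₗ[ℝ] ℝ) (Φ : V [⋀^Fin k]→ₗ[ℝ] ℝ)
    (φ : V [⋀^Fin 2]→ₗ[ℝ] W) (v : Module.Basis (Fin (k + 4)) ℝ V) :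
    qForm β ν Φ φ = (4 * (k.factorial : ℝ))⁻¹ *
      (altSum v (fun a b c d ↦ β (φ ![a, b]) (φ ![c, d])) Φ / ν v) := by
  have h : ((wedge (LinearMap.mul ℝ ℝ) (wedge β φ φ) Φ).domDomCongr
      (finCongr (by omega : 2 + 2 + k = k + 4))) = (4 * (k.factorial : ℝ))⁻¹ •
      MultilinearMap.alternatization
        (mulTensorFour (mulTensor β φ.toMultilinearMap φ.toMultilinearMap) Φ.toMultilinearMap) := by
    -- The two copies of `φ` each contribute `1/2!` and `Φ` contributes `1/k!`.
    have key : wedge (LinearMap.mul ℝ ℝ) (wedge β φ φ) Φ = (4 * (k.factorial : ℝ))⁻¹ •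
        wedge (LinearMap.mul ℝ ℝ) (wedge β (MultilinearMap.alternatization φ.toMultilinearMap)
          (MultilinearMap.alternatization φ.toMultilinearMap))
          (MultilinearMap.alternatization Φ.toMultilinearMap) := by
      conv_lhs => rw [alternatization_coe_eq_smul φ, alternatization_coe_eq_smul Φ]
      rw [wedge_smul_smul, wedge_smul_smul]
      congr 1
      simp [Nat.factorial]
      ring
    rw [key, wedge_alternatization, wedge_alternatization, mulTensorFour,
      alternatization_domDomCongr]
    rfl
  rw [qForm, h, topQuotient_eq _ _ v, AlternatingMap.smul_apply, alternatization_mulTensorFour,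
    smul_eq_mul, mul_div_assoc]
  congr 4
  ext a b c d
  rw [mulTensor_apply]
  change β (φ _) (φ _) = _
  congr 3
  · ext i
    fin_cases i <;> rfl
  · ext i
    fin_cases i <;> rfl

end LinearAlgebra

/-! ### Two-forms as bilinear maps. -/

section TwoForm

variable {V W : Type*} [AddCommGroup V] [Module ℝ V] [AddCommGroup W] [Module ℝ W]

lemma alternatingMap_two_swap (φ : V [⋀^Fin 2]→ₗ[ℝ] W) (a b : V) : φ ![a, b] = -φ ![b, a] := by
  have h := φ.map_swap ![b, a] (show (0 : Fin 2) ≠ 1 by decide)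
  rw [← h]
  congr 1
  ext i
  fin_cases i <;> rfl

/-- The bilinear map `φ(a, b)` of a two-form. -/
def twoFormBilin (φ : V [⋀^Fin 2]→ₗ[ℝ] W) : V →ₗ[ℝ] V →ₗ[ℝ] W :=
  LinearMap.mk₂ ℝ (fun a b ↦ φ ![a, b])
    (fun a a' b ↦ by simpa using φ.map_vecCons_add ![b] a a')
    (fun c a b ↦ by simpa using φ.map_vecCons_smul ![b] c a)
    (fun a b b' ↦ by
      rw [alternatingMap_two_swap, alternatingMap_two_swap φ a b, alternatingMap_two_swap φ a b',
        φ.map_vecCons_add ![a] b b', neg_add])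
    (fun c a b ↦ by
      rw [alternatingMap_two_swap, alternatingMap_two_swap φ a b, φ.map_vecCons_smul ![a] c b,
        smul_neg])

end TwoForm

/-! ### Norms of two-forms in an arbitrary frame. -/

section Metric

variable {V : Type*} [NormedAddCommGroup V] [InnerProductSpace ℝ V]
  {W : Type*} [AddCommGroup W] [Module ℝ W]

/-- With `P` the matrix of `v` in the orthonormal basis, the Gram matrix is `PᵀP`, and the matrix of
`e` in the basis `v` is `P⁻¹`. -/
lemma gram_inv_eq {ι κ : Type*} [Fintype ι] [DecidableEq ι] [Fintype κ] [DecidableEq κ]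
    (e : OrthonormalBasis κ ℝ V) (v : Module.Basis ι ℝ V) :
    (Matrix.of fun i j ↦ inner ℝ (v i) (v j))⁻¹ =
      v.toMatrix e * (v.toMatrix e).transpose := by
  refine Matrix.inv_eq_right_inv ?_
  have h : (Matrix.of fun i j ↦ inner ℝ (v i) (v j)) =
      (e.toBasis.toMatrix v).transpose * e.toBasis.toMatrix v := by
    ext i j
    simp only [Matrix.of_apply, Matrix.mul_apply, Matrix.transpose_apply,
      Module.Basis.toMatrix_apply, OrthonormalBasis.coe_toBasis_repr_apply,
      OrthonormalBasis.repr_apply_apply]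
    rw [← e.sum_inner_mul_inner (v i) (v j)]
    simp only [real_inner_comm]
  have h1 : v.toMatrix e * e.toBasis.toMatrix v = 1 := by
    simpa using v.toMatrix_mul_toMatrix_flip e.toBasis
  have h2 : e.toBasis.toMatrix v * v.toMatrix e = 1 := by
    simpa using e.toBasis.toMatrix_mul_toMatrix_flip v
  rw [h, Matrix.mul_assoc, ← Matrix.mul_assoc _ (v.toMatrix e), h2, Matrix.one_mul,
    ← Matrix.transpose_mul, h1, Matrix.transpose_one]

/-- Expanding each `e a` in the basis `v` and summing over `a` produces the product of
`gram_inv_eq`: the trace with respect to the metric is contraction with the inverse Gram matrix. -/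
lemma sum_orthonormalBasis_eq {ι κ : Type*} [Fintype ι] [DecidableEq ι] [Fintype κ]
    [DecidableEq κ] (e : OrthonormalBasis κ ℝ V) (v : Module.Basis ι ℝ V) (B : V →ₗ[ℝ] V →ₗ[ℝ] ℝ) :
    ∑ a, B (e a) (e a) =
      ∑ i, ∑ j, (Matrix.of fun i j ↦ inner ℝ (v i) (v j))⁻¹ i j * B (v i) (v j) := by
  have h (a : κ) : e a = ∑ i, v.toMatrix e i a • v i := by
    simp only [Module.Basis.toMatrix_apply]
    exact (v.sum_repr (e a)).symm
  have h2 (a : κ) : B (e a) (e a) =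
      ∑ i, ∑ j, v.toMatrix e i a * v.toMatrix e j a * B (v i) (v j) := by
    conv_lhs => rw [h a]
    simp only [map_sum, LinearMap.sum_apply, map_smul, LinearMap.smul_apply, smul_eq_mul,
      Finset.mul_sum, mul_assoc]
    rw [Finset.sum_comm]
    refine Finset.sum_congr rfl fun i _ ↦ Finset.sum_congr rfl fun j _ ↦ by ring
  simp only [h2, gram_inv_eq e v, Matrix.mul_apply, Matrix.transpose_apply, Finset.sum_mul]
  rw [Finset.sum_comm]
  exact Finset.sum_congr rfl fun i _ ↦ Finset.sum_comm

lemma sum_Ioi_eq_half {ι : Type*} [Fintype ι] [LinearOrder ι] [LocallyFiniteOrderTop ι]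
    (f : ι → ι → ℝ) (hs : ∀ i j, f i j = f j i) (h0 : ∀ i, f i i = 0) :
    ∑ i, ∑ j ∈ Finset.Ioi i, f i j = (1 / 2) * ∑ i, ∑ j, f i j := by
  have h1 : ∑ i, ∑ j, f i j = ∑ i, ∑ j, ((if i < j then f i j else 0) +
      if j < i then f i j else 0) := by
    refine Finset.sum_congr rfl fun i _ ↦ Finset.sum_congr rfl fun j _ ↦ ?_
    rcases lt_trichotomy i j with h | h | h
    · simp [h, h.not_gt]
    · simp [h, h0]
    · simp [h, h.not_gt]
  have h2 : ∑ i, ∑ j ∈ Finset.Ioi i, f i j = ∑ i, ∑ j, if i < j then f i j else 0 := by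
    refine Finset.sum_congr rfl fun i _ ↦ ?_
    rw [← Finset.sum_filter]
    refine Finset.sum_congr ?_ fun _ _ ↦ rfl
    ext j
    simp
  have h3 : ∑ i, ∑ j, (if j < i then f i j else 0) = ∑ i, ∑ j, if i < j then f i j else 0 := by
    rw [Finset.sum_comm]
    simp only [hs]
  rw [h1, h2]
  simp only [Finset.sum_add_distrib, h3]
  ring

lemma normSqForm_eq_half [Module.Finite ℝ V] (β : W →ₗ[ℝ] W →ₗ[ℝ] ℝ) (φ : V [⋀^Fin 2]→ₗ[ℝ] W) :
    normSqForm β φ = (1 / 2) * ∑ i, ∑ j,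
      β (φ ![stdOrthonormalBasis ℝ V i, stdOrthonormalBasis ℝ V j])
        (φ ![stdOrthonormalBasis ℝ V i, stdOrthonormalBasis ℝ V j]) := by
  refine sum_Ioi_eq_half (fun i j ↦ _) (fun i j ↦ ?_) fun i ↦ ?_
  · rw [alternatingMap_two_swap]
    simp
  · have : φ ![stdOrthonormalBasis ℝ V i, stdOrthonormalBasis ℝ V i] = 0 :=
      φ.map_eq_zero_of_eq _ (i := 0) (j := 1) rfl (by decide)
    simp [this]

/-- The squared norm of a two-form in an arbitrary basis. -/
lemma normSqForm_eq_sum_basis [Module.Finite ℝ V] {ι : Type*} [Fintype ι] [DecidableEq ι]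
    (β : W →ₗ[ℝ] W →ₗ[ℝ] ℝ) (φ : V [⋀^Fin 2]→ₗ[ℝ] W) (v : Module.Basis ι ℝ V) :
    normSqForm β φ = (1 / 2) * ∑ i, ∑ j, ∑ p, ∑ q,
      (Matrix.of fun i j ↦ inner ℝ (v i) (v j))⁻¹ i j *
      ((Matrix.of fun i j ↦ inner ℝ (v i) (v j))⁻¹ p q *
        β (φ ![v i, v p]) (φ ![v j, v q])) := by
  rw [normSqForm_eq_half]
  congr 1
  set e := stdOrthonormalBasis ℝ V
  -- The two slots of `φ` are contracted one at a time, the other slot being frozen.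
  have h1 (i) : ∑ j, β (φ ![e i, e j]) (φ ![e i, e j]) = ∑ p, ∑ q,
      (Matrix.of fun i j ↦ inner ℝ (v i) (v j))⁻¹ p q * β (φ ![e i, v p]) (φ ![e i, v q]) :=
    sum_orthonormalBasis_eq e v
      (β.compl₁₂ (twoFormBilin φ (e i)) (twoFormBilin φ (e i)))
  have h2 (p q) : ∑ i, β (φ ![e i, v p]) (φ ![e i, v q]) = ∑ i, ∑ j,
      (Matrix.of fun i j ↦ inner ℝ (v i) (v j))⁻¹ i j * β (φ ![v i, v p]) (φ ![v j, v q]) :=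
    sum_orthonormalBasis_eq e v
      (β.compl₁₂ ((twoFormBilin φ).flip (v p)) ((twoFormBilin φ).flip (v q)))
  calc _ = ∑ p, ∑ q, (Matrix.of fun i j ↦ inner ℝ (v i) (v j))⁻¹ p q *
        ∑ i, β (φ ![e i, v p]) (φ ![e i, v q]) := by
        simp only [h1, Finset.mul_sum]
        rw [Finset.sum_comm]
        exact Finset.sum_congr rfl fun i _ ↦ Finset.sum_comm
    _ = ∑ p, ∑ q, ∑ i, ∑ j, (Matrix.of fun i j ↦ inner ℝ (v i) (v j))⁻¹ i j *
      ((Matrix.of fun i j ↦ inner ℝ (v i) (v j))⁻¹ p q *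
        β (φ ![v i, v p]) (φ ![v j, v q])) := by
        simp only [h2, Finset.mul_sum]
        refine Finset.sum_congr rfl fun p _ ↦ Finset.sum_congr rfl fun q _ ↦
          Finset.sum_congr rfl fun i _ ↦ Finset.sum_congr rfl fun j _ ↦ by ring
    _ = _ := by
        rw [Finset.sum_congr rfl fun p _ ↦ Finset.sum_comm, Finset.sum_comm]
        refine Finset.sum_congr rfl fun i _ ↦ ?_
        rw [Finset.sum_congr rfl fun p _ ↦ Finset.sum_comm, Finset.sum_comm]

end Metric

/-! ### The trace pairing in real matrix entries. -/

section Trace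

variable {U : Type*} [NormedAddCommGroup U] [InnerProductSpace ℂ U] [FiniteDimensional ℂ U]

/-- A complex diagonal entry `a + bi` acts on the real basis `1, i` with diagonal entries `a, a`. -/
lemma trace_restrictScalars_eq (T : U →ₗ[ℂ] U) :
    LinearMap.trace ℝ U (T.restrictScalars ℝ) = 2 * (LinearMap.trace ℂ U T).re := by
  classical
  let b := Module.finBasis ℂ U
  rw [LinearMap.trace_eq_matrix_trace ℂ b, LinearMap.trace_eq_matrix_trace ℝ
    (Complex.basisOneI.smulTower b), Matrix.trace, Matrix.trace, Fintype.sum_prod_type,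
    Fin.sum_univ_two]
  simp [LinearMap.toMatrix_apply, Module.Basis.smulTower_repr, Module.Basis.smulTower_apply]
  ring

lemma tracePairing_eq (A B : U →ₗ[ℂ] U) :
    tracePairing U A B =
      -(1 / 2) * LinearMap.trace ℝ U (A.restrictScalars ℝ ∘ₗ B.restrictScalars ℝ) := by
  have := trace_restrictScalars_eq (A ∘ₗ B)
  rw [show (A.restrictScalars ℝ ∘ₗ B.restrictScalars ℝ) = (A ∘ₗ B).restrictScalars ℝ from rfl,
    this]
  simp [tracePairing]

/-- On skew endomorphisms the trace pairing is half the sum of the products of the entries. -/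
lemma tracePairing_skew (A B : U →ₗ[ℂ] U)
    (hB : ∀ x y : U, inner ℝ (B x) y = -inner ℝ x (B y))
    {ι : Type*} [Fintype ι] (f : OrthonormalBasis ι ℝ U) :
    tracePairing U A B =
      ∑ s : ι × ι, (1 / 2) * (inner ℝ (f s.1) (A (f s.2)) * inner ℝ (f s.1) (B (f s.2))) := by
  rw [tracePairing_eq, LinearMap.trace_eq_sum_inner _ f, Fintype.sum_prod_type, Finset.mul_sum]
  refine Finset.sum_congr rfl fun i _ ↦ ?_
  have h : B (f i) = ∑ j, inner ℝ (f j) (B (f i)) • f j := (f.sum_repr' (B (f i))).symm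
  -- Skewness turns the transposed entry of `B` into minus the entry itself, which absorbs the sign
  -- in the pairing.
  have h2 (j : ι) : inner ℝ (f j) (B (f i)) = -inner ℝ (f i) (B (f j)) := by
    rw [← real_inner_comm (f i), hB, neg_neg]
  change -(1 / 2) * inner ℝ (f i) (A.restrictScalars ℝ (B (f i))) = _
  rw [h, map_sum, inner_sum,
    Finset.mul_sum]
  refine Finset.sum_congr rfl fun j _ ↦ ?_
  rw [map_smul, inner_smul_right, h2 j, LinearMap.restrictScalars_apply]
  ring

end Trace

/-! ### The calibration inequality for endomorphism-valued forms. -/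

section Inequality

variable {V : Type*} [NormedAddCommGroup V] [InnerProductSpace ℝ V] [Module.Finite ℝ V]
  {U : Type*} [NormedAddCommGroup U] [InnerProductSpace ℂ U] [FiniteDimensional ℂ U]

lemma altSum_sum {ι κ : Type*} [Fintype κ] {k : ℕ} (v : Fin (k + 4) → ι)
    (g : κ → ι → ι → ι → ι → ℝ) (f : (Fin k → ι) → ℝ) (c : ℝ) :
    altSum v (fun a b p q ↦ ∑ s, c * g s a b p q) f = ∑ s, c * altSum v (g s) f := by
  simp only [altSum, Finset.mul_sum, Finset.sum_mul]
  rw [Finset.sum_comm]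
  refine Finset.sum_congr rfl fun s _ ↦ Finset.sum_congr rfl fun σ _ ↦ by ring

/-- A calibration inequality for real two-forms passes to two-forms with skew values. -/
lemma qForm_le_normSqForm_of_skew {k : ℕ} [hn : Fact (Module.finrank ℝ V = k + 4)]
    (ν : V [⋀^Fin (k + 4)]→ₗ[ℝ] ℝ) (Φ : V [⋀^Fin k]→ₗ[ℝ] ℝ)
    (h : ∀ φ : V [⋀^Fin 2]→ₗ[ℝ] ℝ,
      qForm (LinearMap.mul ℝ ℝ) ν Φ φ ≤ normSqForm (LinearMap.mul ℝ ℝ) φ)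
    (φ : V [⋀^Fin 2]→ₗ[ℝ] (U →ₗ[ℂ] U))
    (hφ : ∀ v x y, inner ℝ (φ v x) y = -inner ℝ x (φ v y)) :
    qForm (tracePairing U) ν Φ φ ≤ normSqForm (tracePairing U) φ := by
  let f := stdOrthonormalBasis ℝ U
  -- The matrix entries of `φ` are real two-forms. Both `q_Φ` and the squared norm of `φ` are the
  -- sums of those of the entries with the positive weights `1/2`, so the hypothesis applies entry
  -- by entry.
  let ℓ (s : Fin (Module.finrank ℝ U) × Fin (Module.finrank ℝ U)) : (U →ₗ[ℂ] U) →ₗ[ℝ] ℝ :=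
    { toFun := fun A ↦ inner ℝ (f s.1) (A (f s.2))
      map_add' := fun A B ↦ by simp [inner_add_right]
      map_smul' := fun c A ↦ by simp [inner_smul_right] }
  have hβ (v w) : tracePairing U (φ v) (φ w) =
      ∑ s, (1 / 2) * (LinearMap.mul ℝ ℝ ((ℓ s).compAlternatingMap φ v)
        ((ℓ s).compAlternatingMap φ w)) := tracePairing_skew _ _ (hφ w) f
  have hq : qForm (tracePairing U) ν Φ φ =
      ∑ s, (1 / 2) * qForm (LinearMap.mul ℝ ℝ) ν Φ ((ℓ s).compAlternatingMap φ) := by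
    have v := Module.finBasisOfFinrankEq ℝ V hn.out
    simp only [qForm_eq_altSum _ _ _ _ v, hβ, altSum_sum, Finset.sum_div, Finset.mul_sum]
    exact Finset.sum_congr rfl fun s _ ↦ by ring
  have hs : normSqForm (tracePairing U) φ =
      ∑ s, (1 / 2) * normSqForm (LinearMap.mul ℝ ℝ) ((ℓ s).compAlternatingMap φ) := by
    simp only [normSqForm, hβ, Finset.mul_sum]
    rw [Finset.sum_comm]
    exact Finset.sum_congr rfl fun i _ ↦ Finset.sum_comm
  rw [hq, hs]
  exact Finset.sum_le_sum fun s _ ↦ by have := h ((ℓ s).compAlternatingMap φ); linarith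

end Inequality

/-! ### Sign rules for `altSum`. -/

section AltSum

set_option linter.unusedSimpArgs false

variable {ι : Type*} {k : ℕ} (v : Fin (k + 4) → ι) (g h : ι → ι → ι → ι → ℝ)
  (f : (Fin k → ι) → ℝ)

/-- Right multiplication by `p` permutes the slots, so reindexing the sum only costs the sign of
`p`. All antisymmetry used below comes from here. -/
lemma sum_perm_mul_right {n : ℕ} (p : Equiv.Perm (Fin n)) (H : Equiv.Perm (Fin n) → ℝ) :
    ∑ σ : Equiv.Perm (Fin n), ((Equiv.Perm.sign σ : ℤ) : ℝ) * H (σ * p) =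
      ((Equiv.Perm.sign p : ℤ) : ℝ) * ∑ σ : Equiv.Perm (Fin n), ((Equiv.Perm.sign σ : ℤ) : ℝ) * H σ := by
  rw [Finset.mul_sum]
  refine Fintype.sum_equiv (Equiv.mulRight p) _ _ fun σ ↦ ?_
  have h : ((Equiv.Perm.sign p : ℤ) : ℝ) * ((Equiv.Perm.sign p : ℤ) : ℝ) = 1 := by
    rw [← Int.cast_mul, Int.units_coe_mul_self, Int.cast_one]
  simp only [Equiv.coe_mulRight, Equiv.Perm.sign_mul, Units.val_mul, Int.cast_mul]
  linear_combination (-((Equiv.Perm.sign σ : ℤ) : ℝ) * H (σ * p)) * h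

/-- The numeral `2` in `Fin (k + 4)` has value `2 % (k + 4)`; this reduction is needed to tell slots
apart when `k` is a variable. -/
lemma two_mod_add_four (k : ℕ) : 2 % (k + 4) = 2 := Nat.mod_eq_of_lt (by omega)

lemma three_mod_add_four (k : ℕ) : 3 % (k + 4) = 3 := Nat.mod_eq_of_lt (by omega)

/-- The adjacent transpositions of the first four slots generate all rearrangements of the
four-tensor; longer permutations are composed from this lemma and its two successors. -/
lemma altSum_swap₀₁ : altSum v (fun a b c d ↦ g b a c d) f = -altSum v g f := by
  have := sum_perm_mul_right (Equiv.swap (0 : Fin (k + 4)) 1) fun σ ↦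
    g (v (σ 0)) (v (σ 1)) (v (σ 2)) (v (σ 3)) * f fun i ↦ v (σ (i.addNat 4))
  rw [Equiv.Perm.sign_swap (by simp [Fin.ext_iff, two_mod_add_four, three_mod_add_four])] at this
  have h2 : Equiv.swap (0 : Fin (k + 4)) 1 2 = 2 :=
    Equiv.swap_apply_of_ne_of_ne (by simp [Fin.ext_iff, two_mod_add_four, three_mod_add_four]) (by simp [Fin.ext_iff, two_mod_add_four, three_mod_add_four])
  have h3 : Equiv.swap (0 : Fin (k + 4)) 1 3 = 3 :=
    Equiv.swap_apply_of_ne_of_ne (by simp [Fin.ext_iff, two_mod_add_four, three_mod_add_four]) (by simp [Fin.ext_iff, two_mod_add_four, three_mod_add_four])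
  have h4 (i : Fin k) : Equiv.swap (0 : Fin (k + 4)) 1 (i.addNat 4) = i.addNat 4 :=
    Equiv.swap_apply_of_ne_of_ne (by simp [Fin.ext_iff, two_mod_add_four, three_mod_add_four]) (by simp [Fin.ext_iff, two_mod_add_four, three_mod_add_four])
  simpa [altSum, h2, h3, h4] using this

lemma altSum_swap₁₂ : altSum v (fun a b c d ↦ g a c b d) f = -altSum v g f := by
  have := sum_perm_mul_right (Equiv.swap (1 : Fin (k + 4)) 2) fun σ ↦
    g (v (σ 0)) (v (σ 1)) (v (σ 2)) (v (σ 3)) * f fun i ↦ v (σ (i.addNat 4))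
  rw [Equiv.Perm.sign_swap (by simp [Fin.ext_iff, two_mod_add_four, three_mod_add_four])] at this
  have h2 : Equiv.swap (1 : Fin (k + 4)) 2 0 = 0 :=
    Equiv.swap_apply_of_ne_of_ne (by simp [Fin.ext_iff, two_mod_add_four, three_mod_add_four]) (by simp [Fin.ext_iff, two_mod_add_four, three_mod_add_four])
  have h3 : Equiv.swap (1 : Fin (k + 4)) 2 3 = 3 :=
    Equiv.swap_apply_of_ne_of_ne (by simp [Fin.ext_iff, two_mod_add_four, three_mod_add_four]) (by simp [Fin.ext_iff, two_mod_add_four, three_mod_add_four])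
  have h4 (i : Fin k) : Equiv.swap (1 : Fin (k + 4)) 2 (i.addNat 4) = i.addNat 4 :=
    Equiv.swap_apply_of_ne_of_ne (by simp [Fin.ext_iff, two_mod_add_four, three_mod_add_four]) (by simp [Fin.ext_iff, two_mod_add_four, three_mod_add_four])
  simpa [altSum, h2, h3, h4] using this

lemma altSum_swap₂₃ : altSum v (fun a b c d ↦ g a b d c) f = -altSum v g f := by
  have := sum_perm_mul_right (Equiv.swap (2 : Fin (k + 4)) 3) fun σ ↦
    g (v (σ 0)) (v (σ 1)) (v (σ 2)) (v (σ 3)) * f fun i ↦ v (σ (i.addNat 4))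
  rw [Equiv.Perm.sign_swap (by simp [Fin.ext_iff, two_mod_add_four, three_mod_add_four])] at this
  have h2 : Equiv.swap (2 : Fin (k + 4)) 3 0 = 0 :=
    Equiv.swap_apply_of_ne_of_ne (by simp [Fin.ext_iff, two_mod_add_four, three_mod_add_four]) (by simp [Fin.ext_iff, two_mod_add_four, three_mod_add_four])
  have h3 : Equiv.swap (2 : Fin (k + 4)) 3 1 = 1 :=
    Equiv.swap_apply_of_ne_of_ne (by simp [Fin.ext_iff, two_mod_add_four, three_mod_add_four]) (by simp [Fin.ext_iff, two_mod_add_four, three_mod_add_four])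
  have h4 (i : Fin k) : Equiv.swap (2 : Fin (k + 4)) 3 (i.addNat 4) = i.addNat 4 :=
    Equiv.swap_apply_of_ne_of_ne (by simp [Fin.ext_iff, two_mod_add_four, three_mod_add_four]) (by simp [Fin.ext_iff, two_mod_add_four, three_mod_add_four])
  simpa [altSum, h2, h3, h4] using this

lemma altSum_add : altSum v (fun a b c d ↦ g a b c d + h a b c d) f =
    altSum v g f + altSum v h f := by
  simp only [altSum, ← Finset.sum_add_distrib]
  exact Finset.sum_congr rfl fun σ _ ↦ by ring

lemma altSum_mul (r : ℝ) : altSum v (fun a b c d ↦ r * g a b c d) f = r * altSum v g f := by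
  simp only [altSum, Finset.mul_sum]
  exact Finset.sum_congr rfl fun σ _ ↦ by ring

lemma altSum_sub : altSum v (fun a b c d ↦ g a b c d - h a b c d) f =
    altSum v g f - altSum v h f := by
  simp only [altSum, ← Finset.sum_sub_distrib]
  exact Finset.sum_congr rfl fun σ _ ↦ by ring

lemma altSum_congr {v : Fin (k + 4) → ι} {g h : ι → ι → ι → ι → ℝ} {f : (Fin k → ι) → ℝ}
    (H : ∀ a b c d, g a b c d = h a b c d) : altSum v g f = altSum v h f := by
  simp only [altSum, H]

end AltSum

/-! ### Chern–Simons forms and the transgression formula. -/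

section ChernSimons

variable {ι : Type*} {R : Type*} [NormedRing R] [NormedAlgebra ℝ R]
  {V : Type*} [NormedAddCommGroup V] [NormedSpace ℝ V]

/-- The antisymmetrization of a three-tensor. -/
def asymThree (g : ι → ι → ι → ℝ) (a b c : ι) : ℝ :=
  g a b c + g b c a + g c a b - g b a c - g a c b - g c b a

/-- The transgression three-tensor `tr(a ∧ (F + F')) - tr(a ∧ a ∧ a) / 3`. -/
def transgression (τ : R →L[ℝ] ℝ) (a : ι → R) (F F' : ι → ι → R) (i j l : ι) : ℝ :=
  (1 / 2) * τ (a i * (F j l + F' j l)) - (1 / 3) * τ (a i * a j * a l)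

/-- The components of the curvature of the connection `d + A`, where `dA i j` is `∂ᵢ Aⱼ`. -/
def curvComp (A : ι → R) (dA : ι → ι → R) (i j : ι) : R :=
  dA i j - dA j i + (A i * A j - A j * A i)

/-- The components of the Chern-Simons form. -/
def chernSimons (τ : R →L[ℝ] ℝ) (A : ι → R) (dA : ι → ι → R) (i j l : ι) : ℝ :=
  τ (A i * dA j l) + (2 / 3) * τ (A i * A j * A l)

/-- This is `T = CS(A + a) - CS(A) + d tr(A ∧ a)`. The derivatives `dA` and `da` are free variables
here, so the identity is algebraic and uses only the cyclicity of `τ`. -/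
lemma asymThree_transgression (τ : R →L[ℝ] ℝ) (hτ : ∀ x y, τ (x * y) = τ (y * x))
    (A a : ι → R) (dA da : ι → ι → R) (i j l : ι) :
    asymThree (transgression τ a (curvComp A dA) (curvComp (A + a) (dA + da))) i j l =
      asymThree (fun i j l ↦ chernSimons τ (A + a) (dA + da) i j l - chernSimons τ A dA i j l +
        (τ (dA i j * a l) + τ (A j * da i l))) i j l := by
  -- The rules rotate every mixed cubic trace to the form `aAA` or `Aaa`, so that equal traces
  -- become equal atoms for `ring`.
  have c1 (i j l) : τ (A i * A j * a l) = τ (a l * A i * A j) := by rw [hτ, mul_assoc]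
  have c2 (i j l) : τ (A i * a j * A l) = τ (a j * A l * A i) := by rw [mul_assoc, hτ]
  have c3 (i j l) : τ (a i * A j * a l) = τ (A j * a l * a i) := by rw [mul_assoc, hτ]
  have c4 (i j l) : τ (a i * a j * A l) = τ (A l * a i * a j) := by rw [hτ, mul_assoc]
  have c5 (i j l) : τ (dA i j * a l) = τ (a l * dA i j) := hτ _ _
  simp only [asymThree, transgression, curvComp, chernSimons, Pi.add_apply, mul_add, add_mul,
    mul_sub, map_add, map_sub, ← mul_assoc, c1, c2, c3, c4, c5]
  ring

/-- The derivative of `g` in the direction `e i`. -/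
def pd (e : ι → V) {W : Type*} [NormedAddCommGroup W] [NormedSpace ℝ W] (i : ι) (g : V → W)
    (y : V) : W := fderiv ℝ g y (e i)

variable {e : ι → V} {y : V}

lemma pd_trace_mul (τ : R →L[ℝ] ℝ) {g h : V → R} (hg : DifferentiableAt ℝ g y)
    (hh : DifferentiableAt ℝ h y) (i : ι) :
    pd e i (fun y ↦ τ (g y * h y)) y = τ (pd e i g y * h y) + τ (g y * pd e i h y) := by
  have := (τ.hasFDerivAt.comp y (hg.hasFDerivAt.mul' hh.hasFDerivAt)).fderiv
  rw [pd, show (fun y ↦ τ (g y * h y)) = τ ∘ (g * h) from rfl, this]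
  simp [pd, add_comm]

lemma pd_mul {g h : V → R} (hg : DifferentiableAt ℝ g y)
    (hh : DifferentiableAt ℝ h y) (i : ι) :
    pd e i (fun y ↦ g y * h y) y = pd e i g y * h y + g y * pd e i h y := by
  have := (hg.hasFDerivAt.mul' hh.hasFDerivAt).fderiv
  rw [pd, show (fun y ↦ g y * h y) = g * h from rfl, this]
  simp [pd, add_comm]

variable {W : Type*} [NormedAddCommGroup W] [NormedSpace ℝ W]

lemma pd_add {g h : V → W} (hg : DifferentiableAt ℝ g y) (hh : DifferentiableAt ℝ h y) (i : ι) :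
    pd e i (fun y ↦ g y + h y) y = pd e i g y + pd e i h y := by
  rw [pd, fderiv_fun_add hg hh]
  rfl

lemma pd_sub {g h : V → W} (hg : DifferentiableAt ℝ g y) (hh : DifferentiableAt ℝ h y) (i : ι) :
    pd e i (fun y ↦ g y - h y) y = pd e i g y - pd e i h y := by
  rw [pd, fderiv_fun_sub hg hh]
  rfl

lemma pd_const_mul {g : V → ℝ} (hg : DifferentiableAt ℝ g y) (c : ℝ) (i : ι) :
    pd e i (fun y ↦ c * g y) y = c * pd e i g y := by
  rw [pd, fderiv_const_mul hg]
  rfl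

lemma differentiableAt_pd {g : V → W} (hg : ContDiffAt ℝ 2 g y) (i : ι) :
    DifferentiableAt ℝ (pd e i g) y :=
  (((hg.fderiv_right (m := 1) (by norm_num)).differentiableAt (by norm_num)).clm_apply
    (differentiableAt_const _))

lemma pd_pd_comm {g : V → W} (hg : ContDiffAt ℝ 2 g y) (i j : ι) :
    pd e i (pd e j g) y = pd e j (pd e i g) y := by
  have h := ((hg.fderiv_right (m := 1) (by norm_num)).differentiableAt (by norm_num))
  have h2 (i j) : pd e i (pd e j g) y = fderiv ℝ (fderiv ℝ g) y (e i) (e j) := by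
    rw [pd, show pd e j g = fun y ↦ fderiv ℝ g y (e j) from rfl,
      fderiv_clm_apply h (differentiableAt_const _)]
    simp
  rw [h2, h2]
  exact (hg.isSymmSndFDerivAt (by simp)) (e i) (e j)

/-- All six signed rearrangements of the last three slots have the same signed sum. The comparison
of three-tensors holds only after antisymmetrization, and this lemma allows passing to it under the
derivative. -/
lemma altSum_pd_eq_asymThree {k : ℕ} (v : Fin (k + 4) → ι) (f : (Fin k → ι) → ℝ)
    (g : ι → ι → ι → V → ℝ) (hg : ∀ a b c, DifferentiableAt ℝ (g a b c) y) :
    6 * altSum v (fun i a b c ↦ pd e i (g a b c) y) f =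
      altSum v (fun i a b c ↦ pd e i (fun y ↦ asymThree (fun a b c ↦ g a b c y) a b c) y) f := by
  set G : ι → ι → ι → ι → ℝ := fun i a b c ↦ pd e i (g a b c) y
  have h (i a b c) : pd e i (fun y ↦ asymThree (fun a b c ↦ g a b c y) a b c) y =
      G i a b c + G i b c a + G i c a b - G i b a c - G i a c b - G i c b a := by
    simp only [asymThree, G]
    rw [pd_sub (by fun_prop) (by fun_prop), pd_sub (by fun_prop) (by fun_prop),
      pd_sub (by fun_prop) (by fun_prop), pd_add (by fun_prop) (by fun_prop),
      pd_add (by fun_prop) (by fun_prop)]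
  simp only [h, altSum_sub, altSum_add]
  have h1 : altSum v (fun i a b c ↦ G i b a c) f = -altSum v G f := altSum_swap₁₂ v G f
  have h2 : altSum v (fun i a b c ↦ G i a c b) f = -altSum v G f := altSum_swap₂₃ v G f
  have h3 : altSum v (fun i a b c ↦ G i c a b) f = -altSum v (fun i a b c ↦ G i b a c) f :=
    altSum_swap₂₃ v (fun i a b c ↦ G i b a c) f
  have h4 : altSum v (fun i a b c ↦ G i b c a) f = -altSum v (fun i a b c ↦ G i a c b) f :=
    altSum_swap₁₂ v (fun i a b c ↦ G i a c b) f
  have h5 : altSum v (fun i a b c ↦ G i c b a) f = -altSum v (fun i a b c ↦ G i c a b) f :=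
    altSum_swap₁₂ v (fun i a b c ↦ G i c a b) f
  rw [h5, h4, h3, h2, h1]
  ring

/-- The exterior derivative of the Chern-Simons form is `tr(F ∧ F)`. -/
lemma altSum_pd_chernSimons {k : ℕ} (v : Fin (k + 4) → ι) (f : (Fin k → ι) → ℝ)
    (τ : R →L[ℝ] ℝ) (hτ : ∀ x y, τ (x * y) = τ (y * x)) (A : ι → V → R)
    (hA : ∀ i, ContDiffAt ℝ 2 (A i) y) :
    altSum v (fun i a b c ↦
        pd e i (fun y ↦ chernSimons τ (fun i ↦ A i y) (fun i j ↦ pd e i (A j) y) a b c) y) f =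
      (1 / 4) * altSum v (fun a b c d ↦
        τ (curvComp (fun i ↦ A i y) (fun i j ↦ pd e i (A j) y) a b *
          curvComp (fun i ↦ A i y) (fun i j ↦ pd e i (A j) y) c d)) f := by
  have hd (i) : DifferentiableAt ℝ (A i) y := (hA i).differentiableAt (by norm_num)
  have hdd (i j) : DifferentiableAt ℝ (pd e i (A j)) y := differentiableAt_pd (hA j) i
  set B : ι → R := fun i ↦ A i y
  set dB : ι → ι → R := fun i j ↦ pd e i (A j) y
  set M : ι → ι → ι → ι → ℝ := fun i j p q ↦ τ (dB i j * B p * B q)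
  set N : ι → ι → ι → ι → ℝ := fun i j p q ↦ τ (dB i j * dB p q)
  have hcyc (x y z : R) : τ (x * y * z) = τ (y * z * x) := by rw [mul_assoc, hτ]
  -- Cyclic rotations of three slots are even; they identify the three terms in the derivative of
  -- the cubic trace, so that `2/3` becomes `2`.
  have swap (g : ι → ι → ι → ι → ℝ) : (altSum v (fun i a b c ↦ g i b c a) f = altSum v g f) ∧
      (altSum v (fun i a b c ↦ g i c a b) f = altSum v g f) := by
    constructor
    · have h3 : altSum v (fun i a b c ↦ g i b c a) f = -altSum v (fun i a b c ↦ g i a c b) f :=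
        altSum_swap₁₂ v (fun i a b c ↦ g i a c b) f
      rw [h3, altSum_swap₂₃ v g f, neg_neg]
    · have h3 : altSum v (fun i a b c ↦ g i c a b) f = -altSum v (fun i a b c ↦ g i b a c) f :=
        altSum_swap₂₃ v (fun i a b c ↦ g i b a c) f
      rw [h3, altSum_swap₁₂ v g f, neg_neg]
  have hL (i a b c) : pd e i (fun y ↦ chernSimons τ (fun i ↦ A i y)
      (fun i j ↦ pd e i (A j) y) a b c) y =
      N i a b c + τ (B a * pd e i (pd e b (A c)) y) +
        (2 / 3) * (M i a b c + M i b c a + M i c a b) := by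
    simp only [chernSimons]
    have d1 : DifferentiableAt ℝ (fun y ↦ τ (A a y * pd e b (A c) y)) y :=
      τ.differentiableAt.comp y ((hd a).mul (hdd b c))
    have d2 : DifferentiableAt ℝ (fun y ↦ τ (A a y * A b y * A c y)) y :=
      τ.differentiableAt.comp y (((hd a).mul (hd b)).mul (hd c))
    rw [pd_add d1 (d2.const_mul _), pd_const_mul d2, pd_trace_mul τ (hd a) (hdd b c),
      pd_trace_mul τ ((hd a).fun_mul (hd b)) (hd c), pd_mul (hd a) (hd b), add_mul, map_add]
    simp only [M, N, B, dB]
    rw [hcyc (A a y) (pd e i (A b) y) (A c y), ← hcyc (pd e i (A c) y) (A a y) (A b y)]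
  -- The second derivative is symmetric in `i` and `b`, while the signed sum is antisymmetric. This
  -- is `d² = 0`.
  have hS : altSum v (fun i a b c ↦ τ (B a * pd e i (pd e b (A c)) y)) f = 0 := by
    set S : ι → ι → ι → ι → ℝ := fun i a b c ↦ τ (B a * pd e i (pd e b (A c)) y)
    have h1 : altSum v (fun i a b c ↦ S a i b c) f = -altSum v S f := altSum_swap₀₁ v S f
    have h2 : altSum v (fun i a b c ↦ S b i a c) f = -altSum v (fun i a b c ↦ S a i b c) f :=
      altSum_swap₁₂ v (fun i a b c ↦ S a i b c) f
    have h3 : altSum v (fun i a b c ↦ S b a i c) f = -altSum v (fun i a b c ↦ S b i a c) f :=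
      altSum_swap₀₁ v (fun i a b c ↦ S b i a c) f
    have h4 : altSum v (fun i a b c ↦ S b a i c) f = altSum v S f :=
      altSum_congr fun i a b c ↦ by simp only [S]; rw [pd_pd_comm (hA c)]
    linarith
  simp only [hL, altSum_add, altSum_mul, hS, (swap M).1, (swap M).2]
  -- The curvature is `G a b - G b a`, so the product of two curvatures has four terms with equal
  -- signed sums. They cancel the factor `1/4`.
  set G : ι → ι → R := fun i j ↦ dB i j + B i * B j
  set Q : ι → ι → ι → ι → ℝ := fun a b c d ↦ τ (G a b * G c d)
  have hF (a b c d) : τ (curvComp B dB a b * curvComp B dB c d) =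
      Q a b c d - Q b a c d - Q a b d c + Q b a d c := by
    have hc (a b) : curvComp B dB a b = G a b - G b a := by simp only [curvComp, G]; abel
    rw [hc, hc]
    simp only [Q, mul_sub, sub_mul, map_sub]
    ring
  have q1 : altSum v (fun a b c d ↦ Q b a c d) f = -altSum v Q f := altSum_swap₀₁ v Q f
  have q2 : altSum v (fun a b c d ↦ Q a b d c) f = -altSum v Q f := altSum_swap₂₃ v Q f
  have q3 : altSum v (fun a b c d ↦ Q b a d c) f = -altSum v (fun a b c d ↦ Q b a c d) f :=
    altSum_swap₂₃ v (fun a b c d ↦ Q b a c d) f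
  simp only [hF, altSum_sub, altSum_add, q1, q2, q3]
  have hQ (a b c d) : Q a b c d = N a b c d + M a b c d + M c d a b +
      τ (B a * B b * B c * B d) := by
    simp only [Q, G, N, M, mul_add, add_mul, map_add, ← mul_assoc]
    rw [mul_assoc (dB c d), hτ (dB c d) (B a * B b)]
    ring
  -- Exchanging the pairs `(a, b)` and `(c, d)` is an even permutation.
  have hM : altSum v (fun a b c d ↦ M c d a b) f = altSum v M f := by
    have h1 : altSum v (fun a b c d ↦ M a c b d) f = -altSum v M f := altSum_swap₁₂ v M f
    have h2 : altSum v (fun a b c d ↦ M b c a d) f = -altSum v (fun a b c d ↦ M a c b d) f :=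
      altSum_swap₀₁ v (fun a b c d ↦ M a c b d) f
    have h3 : altSum v (fun a b c d ↦ M b d a c) f = -altSum v (fun a b c d ↦ M b c a d) f :=
      altSum_swap₂₃ v (fun a b c d ↦ M b c a d) f
    have h4 : altSum v (fun a b c d ↦ M c d a b) f = -altSum v (fun a b c d ↦ M b d a c) f :=
      altSum_swap₁₂ v (fun a b c d ↦ M b d a c) f
    rw [h4, h3, h2, h1]
    ring
  -- Cyclicity of the trace makes the quartic term invariant under a four-cycle, which is an odd
  -- permutation.
  have hB : altSum v (fun a b c d ↦ τ (B a * B b * B c * B d)) f = 0 := by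
    set S : ι → ι → ι → ι → ℝ := fun a b c d ↦ τ (B a * B b * B c * B d)
    have h1 : altSum v (fun a b c d ↦ S b a c d) f = -altSum v S f := altSum_swap₀₁ v S f
    have h2 : altSum v (fun a b c d ↦ S c a b d) f = -altSum v (fun a b c d ↦ S b a c d) f :=
      altSum_swap₁₂ v (fun a b c d ↦ S b a c d) f
    have h3 : altSum v (fun a b c d ↦ S d a b c) f = -altSum v (fun a b c d ↦ S c a b d) f :=
      altSum_swap₂₃ v (fun a b c d ↦ S c a b d) f
    have h4 : altSum v (fun a b c d ↦ S d a b c) f = altSum v S f :=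
      altSum_congr fun a b c d ↦ by
        simp only [S]
        rw [hτ _ (B d)]
        simp only [mul_assoc]
    linarith
  have := altSum_congr (v := v) (f := f) hQ
  simp only [altSum_add, hM, hB] at this
  rw [this]
  ring

/-- The exterior derivative of the transgression form is `tr(F' ∧ F') - tr(F ∧ F)`. -/
lemma altSum_pd_transgression [Finite ι] {k : ℕ} (v : Fin (k + 4) → ι) (f : (Fin k → ι) → ℝ)
    (τ : R →L[ℝ] ℝ) (hτ : ∀ x y, τ (x * y) = τ (y * x)) (A A' : ι → V → R)
    (hA : ∀ i, ContDiffAt ℝ 2 (A i) y) (hA' : ∀ i, ContDiffAt ℝ 2 (A' i) y) :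
    altSum v (fun i a b c ↦ pd e i (fun y ↦ transgression τ (fun i ↦ A' i y - A i y)
        (curvComp (fun i ↦ A i y) (fun i j ↦ pd e i (A j) y))
        (curvComp (fun i ↦ A' i y) (fun i j ↦ pd e i (A' j) y)) a b c) y) f =
      (1 / 4) * (altSum v (fun a b c d ↦
        τ (curvComp (fun i ↦ A' i y) (fun i j ↦ pd e i (A' j) y) a b *
          curvComp (fun i ↦ A' i y) (fun i j ↦ pd e i (A' j) y) c d)) f -
        altSum v (fun a b c d ↦
        τ (curvComp (fun i ↦ A i y) (fun i j ↦ pd e i (A j) y) a b *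
          curvComp (fun i ↦ A i y) (fun i j ↦ pd e i (A j) y) c d)) f) := by
  -- The algebraic identity is going to be differentiated at `y`, so it must hold near `y`.
  have hev : ∀ᶠ z in 𝓝 y, ∀ i, ContDiffAt ℝ 2 (A i) z ∧ ContDiffAt ℝ 2 (A' i) z :=
    Filter.eventually_all.2 fun i ↦ ((hA i).eventually (by simp)).and ((hA' i).eventually (by simp))
  have hd (i) : DifferentiableAt ℝ (A i) y := (hA i).differentiableAt (by norm_num)
  have hdd (i j) : DifferentiableAt ℝ (pd e i (A j)) y := differentiableAt_pd (hA j) i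
  have hd' (i) : DifferentiableAt ℝ (A' i) y := (hA' i).differentiableAt (by norm_num)
  have hdd' (i j) : DifferentiableAt ℝ (pd e i (A' j)) y := differentiableAt_pd (hA' j) i
  have hτd {g : V → R} (hg : DifferentiableAt ℝ g y) : DifferentiableAt ℝ (fun y ↦ τ (g y)) y :=
    τ.differentiableAt.comp y hg
  have hcs (B : ι → V → R) (h1 : ∀ i, DifferentiableAt ℝ (B i) y)
      (h2 : ∀ i j, DifferentiableAt ℝ (pd e i (B j)) y) (a b c) : DifferentiableAt ℝ
        (fun y ↦ chernSimons τ (fun i ↦ B i y) (fun i j ↦ pd e i (B j) y) a b c) y :=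
    (hτd ((h1 a).mul (h2 b c))).add ((hτd (((h1 a).mul (h1 b)).mul (h1 c))).const_mul _)
  have hcurv (B : ι → V → R) (h1 : ∀ i, DifferentiableAt ℝ (B i) y)
      (h2 : ∀ i j, DifferentiableAt ℝ (pd e i (B j)) y) (a b) : DifferentiableAt ℝ
        (fun y ↦ curvComp (fun i ↦ B i y) (fun i j ↦ pd e i (B j) y) a b) y :=
    ((h2 a b).sub (h2 b a)).add (((h1 a).mul (h1 b)).sub ((h1 b).mul (h1 a)))
  have ha (i) : ContDiffAt ℝ 2 (fun y ↦ A' i y - A i y) y := (hA' i).sub (hA i)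
  have hprod (b c) : ContDiffAt ℝ 2 (fun y ↦ τ (A b y * (A' c y - A c y))) y :=
    τ.contDiff.contDiffAt.comp y ((hA b).mul (ha c))
  set T : ι → ι → ι → V → ℝ := fun a b c y ↦ transgression τ (fun i ↦ A' i y - A i y)
        (curvComp (fun i ↦ A i y) (fun i j ↦ pd e i (A j) y))
        (curvComp (fun i ↦ A' i y) (fun i j ↦ pd e i (A' j) y)) a b c with hT
  set C : ι → ι → ι → V → ℝ := fun a b c y ↦
    chernSimons τ (fun i ↦ A i y) (fun i j ↦ pd e i (A j) y) a b c
  set C' : ι → ι → ι → V → ℝ := fun a b c y ↦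
    chernSimons τ (fun i ↦ A' i y) (fun i j ↦ pd e i (A' j) y) a b c
  -- The components of the exact correction `d tr(A ∧ (A' - A))`.
  set P : ι → ι → ι → V → ℝ := fun a b c ↦ pd e a (fun y ↦ τ (A b y * (A' c y - A c y)))
  have hTd (a b c) : DifferentiableAt ℝ (T a b c) y := by
    refine ((hτd ?_).const_mul _).sub ((hτd ?_).const_mul _)
    · exact ((hd' a).sub (hd a)).mul ((hcurv A hd hdd b c).add (hcurv A' hd' hdd' b c))
    · exact (((hd' a).sub (hd a)).mul ((hd' b).sub (hd b))).mul ((hd' c).sub (hd c))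
  have hCd : ∀ a b c, DifferentiableAt ℝ (C a b c) y := hcs A hd hdd
  have hCd' : ∀ a b c, DifferentiableAt ℝ (C' a b c) y := hcs A' hd' hdd'
  have hPd (a b c) : DifferentiableAt ℝ (P a b c) y := differentiableAt_pd (hprod b c) a
  have h1 := altSum_pd_eq_asymThree (e := e) v f T hTd
  have h2 := altSum_pd_eq_asymThree (e := e) v f (fun a b c y ↦ C' a b c y - C a b c y + P a b c y)
    fun a b c ↦ (((hCd' a b c).sub (hCd a b c)).add (hPd a b c))
  have h3 : altSum v (fun i a b c ↦
        pd e i (fun y ↦ asymThree (fun a b c ↦ T a b c y) a b c) y) f =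
      altSum v (fun i a b c ↦ pd e i (fun y ↦
        asymThree (fun a b c ↦ C' a b c y - C a b c y + P a b c y) a b c) y) f := by
    refine altSum_congr fun i a b c ↦ ?_
    refine congrArg (fun L : V →L[ℝ] ℝ ↦ L (e i)) (Filter.EventuallyEq.fderiv_eq ?_)
    filter_upwards [hev] with z hz
    have hdz (i) : DifferentiableAt ℝ (A i) z := (hz i).1.differentiableAt (by norm_num)
    have hdz' (i) : DifferentiableAt ℝ (A' i) z := (hz i).2.differentiableAt (by norm_num)
    have key := asymThree_transgression τ hτ (fun i ↦ A i z) (fun i ↦ A' i z - A i z)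
      (fun i j ↦ pd e i (A j) z) (fun i j ↦ pd e i (A' j) z - pd e i (A j) z) a b c
    have e1 : ((fun i ↦ A i z) + fun i ↦ A' i z - A i z) = fun i ↦ A' i z := by
      ext i; simp
    have e2 : ((fun i j ↦ pd e i (A j) z) + fun i j ↦ pd e i (A' j) z - pd e i (A j) z) =
        fun i j ↦ pd e i (A' j) z := by
      ext i; simp
    rw [e1, e2] at key
    have e3 (a b c) : P a b c z = τ (pd e a (A b) z * (A' c z - A c z)) +
        τ (A b z * (pd e a (A' c) z - pd e a (A c) z)) := by
      simp only [P]
      rw [pd_trace_mul τ (hdz b) ((hdz' c).fun_sub (hdz c)), pd_sub (hdz' c) (hdz c)]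
    simp only [e3]
    exact key
  have h4 (i a b c) : pd e i (fun y ↦ C' a b c y - C a b c y + P a b c y) y =
      pd e i (C' a b c) y - pd e i (C a b c) y + pd e i (P a b c) y := by
    rw [pd_add ((hCd' a b c).fun_sub (hCd a b c)) (hPd a b c), pd_sub (hCd' a b c) (hCd a b c)]
  -- The exact correction is closed: its derivative is a symmetric second derivative.
  have h5 : altSum v (fun i a b c ↦ pd e i (P a b c) y) f = 0 := by
    have s1 := altSum_swap₀₁ v (fun i a b c ↦ pd e i (P a b c) y) f
    have s2 : altSum v (fun i a b c ↦ pd e a (P i b c) y) f =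
        altSum v (fun i a b c ↦ pd e i (P a b c) y) f :=
      altSum_congr fun i a b c ↦ pd_pd_comm (hprod b c) _ _
    linarith
  have h6 := altSum_pd_chernSimons (e := e) v f τ hτ A hA
  have h7 := altSum_pd_chernSimons (e := e) v f τ hτ A' hA'
  simp only [h4, altSum_add, altSum_sub, h5] at h2
  have : altSum v (fun i a b c ↦ pd e i (T a b c) y) f =
      altSum v (fun i a b c ↦ pd e i (C' a b c) y) f -
        altSum v (fun i a b c ↦ pd e i (C a b c) y) f := by linarith
  rw [this, h6, h7]
  ring

end ChernSimons

/-! ### Integration by parts against a closed form in a vector space. -/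

section Stokes

variable {V : Type*} [NormedAddCommGroup V] [NormedSpace ℝ V]

/-- The indices `0, 4, 5, …, k + 3`. -/
def zeroTail (k : ℕ) : Fin (k + 1) ↪ Fin (k + 4) where
  toFun := Fin.cons 0 fun i ↦ i.addNat 4
  inj' := by
    rw [Fin.cons_injective_iff]
    refine ⟨?_, fun i j h ↦ by simpa using h⟩
    rintro ⟨i, hi⟩
    simp [Fin.ext_iff] at hi

@[simp] lemma zeroTail_zero (k : ℕ) : zeroTail k 0 = 0 := rfl

@[simp] lemma zeroTail_succ {k : ℕ} (i : Fin k) : zeroTail k i.succ = i.addNat 4 := rfl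

lemma notMem_range_zeroTail {k : ℕ} {j : Fin (k + 4)} (h0 : j.val ≠ 0) (h4 : j.val < 4) :
    j ∉ Set.range (zeroTail k) := by
  rintro ⟨i, rfl⟩
  induction i using Fin.cases with
  | zero => simp at h0
  | succ i => simp at h4

/-- The wedge product with a closed form: derivatives falling on the closed form cancel. -/
lemma sum_perm_extDeriv_eq_zero {ι : Type*} {k : ℕ} (v : Fin (k + 4) → ι) (e : ι → V)
    (T : ι → ι → ι → ℝ) {Ψ : V → V [⋀^Fin k]→L[ℝ] ℝ} {y : V} (hΨ : DifferentiableAt ℝ Ψ y)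
    (hd : extDeriv Ψ y = 0) :
    ∑ σ : Equiv.Perm (Fin (k + 4)), ((Equiv.Perm.sign σ : ℤ) : ℝ) *
      (T (v (σ 1)) (v (σ 2)) (v (σ 3)) *
        pd e (v (σ 0)) (fun y ↦ Ψ y fun i ↦ e (v (σ (i.addNat 4)))) y) = 0 := by
  set H : Equiv.Perm (Fin (k + 4)) → ℝ := fun σ ↦ T (v (σ 1)) (v (σ 2)) (v (σ 3)) *
        pd e (v (σ 0)) (fun y ↦ Ψ y fun i ↦ e (v (σ (i.addNat 4)))) y
  -- `p r` rearranges the slots `0, 4, …, k + 3` so that the `r`-th of them comes first and the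
  -- others keep their order; slots `1, 2, 3` stay fixed. Its sign `(-1)^r` is that of the `r`-th
  -- term of the exterior derivative.
  let p (r : Fin (k + 1)) : Equiv.Perm (Fin (k + 4)) :=
    Equiv.Perm.viaFintypeEmbedding r.cycleRange.symm (zeroTail k)
  have hp0 (r) : p r 0 = zeroTail k r := by
    have := Equiv.Perm.viaFintypeEmbedding_apply_image r.cycleRange.symm (zeroTail k) 0
    rwa [Fin.cycleRange_symm_zero] at this
  have hp4 (r) (i : Fin k) : p r (i.addNat 4) = zeroTail k (r.succAbove i) := by
    have := Equiv.Perm.viaFintypeEmbedding_apply_image r.cycleRange.symm (zeroTail k) i.succ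
    rwa [Fin.cycleRange_symm_succ] at this
  have hp (r) (j : Fin (k + 4)) (h0 : j.val ≠ 0) (h4 : j.val < 4) : p r j = j :=
    Equiv.Perm.viaFintypeEmbedding_apply_notMem_range _ _ (notMem_range_zeroTail h0 h4)
  have hsum (r) := sum_perm_mul_right (p r) H
  have hsign (r) : ((Equiv.Perm.sign (p r) : ℤ) : ℝ) = (-1) ^ (r : ℕ) := by
    simp [p, Equiv.Perm.viaFintypeEmbedding_sign, Fin.sign_cycleRange]
  have hzero (σ : Equiv.Perm (Fin (k + 4))) : ∑ r : Fin (k + 1), (-1) ^ (r : ℕ) * H (σ * p r) = 0 := by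
    have h := congrArg (fun L ↦ L fun r ↦ e (v (σ (zeroTail k r)))) hd
    simp only [extDeriv_apply hΨ] at h
    have h2 (r : Fin (k + 1)) : (-1) ^ (r : ℕ) * H (σ * p r) = T (v (σ 1)) (v (σ 2)) (v (σ 3)) *
        ((-1) ^ (r : ℕ) • fderiv ℝ
          (Ψ · (r.removeNth fun r ↦ e (v (σ (zeroTail k r))))) y (e (v (σ (zeroTail k r))))) := by
      simp only [H, Equiv.Perm.mul_apply, hp0, hp4, pd]
      rw [hp r 1 (by simp) (by simp), hp r 2 (by simp [two_mod_add_four]) (by simp [two_mod_add_four]),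
        hp r 3 (by simp [three_mod_add_four]) (by simp [three_mod_add_four])]
      rw [mul_left_comm, zsmul_eq_mul, Int.cast_pow, Int.cast_neg, Int.cast_one]
      rfl
    simp only [h2, ← Finset.mul_sum, h]
    simp
  -- Each right translation by `p r` reproduces the sum up to sign. Adding all `k + 1` of them
  -- assembles, for every fixed `σ`, the value of `extDeriv Ψ`, which is zero.
  have hk : ((k : ℝ) + 1) * ∑ σ, ((Equiv.Perm.sign σ : ℤ) : ℝ) * H σ = 0 := by
    have h1 : ∑ r : Fin (k + 1), (-1 : ℝ) ^ (r : ℕ) *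
        (((Equiv.Perm.sign (p r) : ℤ) : ℝ) * ∑ σ, ((Equiv.Perm.sign σ : ℤ) : ℝ) * H σ) =
        ((k : ℝ) + 1) * ∑ σ, ((Equiv.Perm.sign σ : ℤ) : ℝ) * H σ := by
      simp only [hsign, ← mul_assoc, ← mul_pow]
      simp
    rw [← h1]
    simp only [← hsum, Finset.mul_sum]
    rw [Finset.sum_comm]
    refine Finset.sum_eq_zero fun σ _ ↦ ?_
    rw [← mul_zero ((Equiv.Perm.sign σ : ℤ) : ℝ), ← hzero σ, Finset.mul_sum]
    exact Finset.sum_congr rfl fun r _ ↦ by ring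
  exact (mul_eq_zero.1 hk).resolve_left (by positivity)

variable [FiniteDimensional ℝ V] [MeasurableSpace V] [BorelSpace V] (μ : Measure V)
  [μ.IsAddHaarMeasure]

/-- Integration by parts against the constant function `1`. -/
lemma integral_fderiv_eq_zero {g : V → ℝ} (hg : ContDiff ℝ 1 g) (hc : HasCompactSupport g)
    (w : V) : ∫ y, fderiv ℝ g y w ∂μ = 0 := by
  have h := integral_mul_fderiv_eq_neg_fderiv_mul_of_integrable (μ := μ) (f := fun _ ↦ (1 : ℝ))
    (g := g) (v := w) (by simp)
    (by
      simp only [one_mul]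
      refine Continuous.integrable_of_hasCompactSupport
        ((hg.continuous_fderiv (by norm_num)).clm_apply continuous_const) ?_
      exact (hc.fderiv ℝ).comp_left (g := fun L : V →L[ℝ] ℝ ↦ L w) (by simp))
    (by simpa using hg.continuous.integrable_of_hasCompactSupport hc)
    (fun x _ ↦ differentiableAt_const _) (fun x _ ↦ hg.differentiable (by norm_num) x)
  simpa using h

/-- Extension by zero of a product with a compactly supported function. -/
lemma contDiff_mul_of_tsupport_subset {ρ g : V → ℝ} {Ω : Set V} (hΩ : IsOpen Ω) {n : ℕ∞}
    (hρ : ContDiff ℝ n ρ) (hs : tsupport ρ ⊆ Ω) (hg : ContDiffOn ℝ n g Ω) :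
    ContDiff ℝ n fun y ↦ ρ y * g y := by
  refine contDiff_iff_contDiffAt.2 fun y ↦ ?_
  by_cases hy : y ∈ tsupport ρ
  · exact hρ.contDiffAt.mul (hg.contDiffAt (hΩ.mem_nhds (hs hy)))
  · refine (contDiffAt_const (c := (0 : ℝ))).congr_of_eventuallyEq ?_
    filter_upwards [(isClosed_tsupport ρ).isOpen_compl.mem_nhds hy] with z hz
    rw [image_eq_zero_of_notMem_tsupport hz, zero_mul]

lemma pd_eq_zero_of_notMem_tsupport {ι : Type*} {e : ι → V} {ρ : V → ℝ} {y : V}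
    (hy : y ∉ tsupport ρ) (i : ι) : pd e i ρ y = 0 := by
  have : fderiv ℝ ρ y = 0 := by
    by_contra h
    exact hy (support_fderiv_subset ℝ h)
  simp [pd, this]

lemma integrable_of_eq_zero_off {ρ h : V → ℝ} {Ω : Set V}
    (hc : HasCompactSupport ρ) (hs : tsupport ρ ⊆ Ω) (hh : ContinuousOn h Ω)
    (h0 : ∀ y ∉ tsupport ρ, h y = 0) : Integrable h μ :=
  (hh.mono hs).integrableOn_compact hc |>.integrable_of_forall_notMem_eq_zero h0

/-- Integration by parts against a closed form. -/
lemma integral_altSum_pd {ι : Type*} {k : ℕ} (v : Fin (k + 4) → ι) (e : ι → V)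
    {T : ι → ι → ι → V → ℝ} {Ψ : V → V [⋀^Fin k]→L[ℝ] ℝ} {Ω : Set V} (hΩ : IsOpen Ω)
    {ρ : V → ℝ} (hρ : ContDiff ℝ 1 ρ) (hc : HasCompactSupport ρ) (hs : tsupport ρ ⊆ Ω)
    (hT : ∀ a b c, ContDiffOn ℝ 1 (T a b c) Ω) (hΨ : ContDiffOn ℝ 1 Ψ Ω)
    (hd : ∀ y ∈ Ω, extDeriv Ψ y = 0) :
    ∫ y, ρ y * altSum v (fun i a b c ↦ pd e i (T a b c) y) (fun t ↦ Ψ y fun j ↦ e (t j)) ∂μ =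
      -∫ y, altSum v (fun i a b c ↦ pd e i ρ y * T a b c y) (fun t ↦ Ψ y fun j ↦ e (t j)) ∂μ := by
  let g (σ : Equiv.Perm (Fin (k + 4))) (y : V) : ℝ :=
    T (v (σ 1)) (v (σ 2)) (v (σ 3)) y * Ψ y fun i ↦ e (v (σ (i.addNat 4)))
  have hΨv (w : Fin k → V) : ContDiffOn ℝ 1 (fun y ↦ Ψ y w) Ω :=
    (ContinuousAlternatingMap.apply ℝ V ℝ w).contDiff.comp_contDiffOn hΨ
  have hg (σ) : ContDiffOn ℝ 1 (g σ) Ω := (hT _ _ _).mul (hΨv _)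
  have hρg (σ) : ContDiff ℝ 1 fun y ↦ ρ y * g σ y :=
    contDiff_mul_of_tsupport_subset hΩ hρ hs (hg σ)
  have hρc (σ) : HasCompactSupport fun y ↦ ρ y * g σ y := hc.mul_right
  have hI (σ) (i : ι) := integral_fderiv_eq_zero μ (hρg σ) (hρc σ) (e i)
  have hint (σ) (i : ι) : Integrable (fun y ↦ fderiv ℝ (fun y ↦ ρ y * g σ y) y (e i)) μ :=
    Continuous.integrable_of_hasCompactSupport
      (((hρg σ).continuous_fderiv (by norm_num)).clm_apply continuous_const)
      (((hρc σ).fderiv ℝ).comp_left (g := fun L : V →L[ℝ] ℝ ↦ L (e i)) (by simp))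
  -- The total derivative of `ρ T ∧ Ψ` integrates to zero.
  have htot : ∫ y, ∑ σ : Equiv.Perm (Fin (k + 4)), ((Equiv.Perm.sign σ : ℤ) : ℝ) *
      fderiv ℝ (fun y ↦ ρ y * g σ y) y (e (v (σ 0))) ∂μ = 0 := by
    rw [integral_finsetSum _ fun σ _ ↦ (hint σ _).const_mul _]
    refine Finset.sum_eq_zero fun σ _ ↦ ?_
    rw [integral_const_mul, hI, mul_zero]
  have hpdT (i a b c) : ContinuousOn (pd e i (T a b c)) Ω :=
    ((hT a b c).continuousOn_fderiv_of_isOpen hΩ (by norm_num)).clm_apply continuousOn_const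
  have hpdρ (i) : Continuous (pd e i ρ) :=
    (hρ.continuous_fderiv (by norm_num)).clm_apply continuous_const
  have hi1 : Integrable (fun y ↦ ρ y * altSum v (fun i a b c ↦ pd e i (T a b c) y)
      (fun t ↦ Ψ y fun j ↦ e (t j))) μ := by
    refine integrable_of_eq_zero_off μ hc hs ?_ fun y hy ↦ ?_
    · refine hρ.continuous.continuousOn.mul (continuousOn_finsetSum _ fun σ _ ↦ ?_)
      exact continuousOn_const.mul ((hpdT _ _ _ _).mul (hΨv _).continuousOn)
    · rw [image_eq_zero_of_notMem_tsupport hy, zero_mul]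
  have hi2 : Integrable (fun y ↦ altSum v (fun i a b c ↦ pd e i ρ y * T a b c y)
      (fun t ↦ Ψ y fun j ↦ e (t j))) μ := by
    refine integrable_of_eq_zero_off μ hc hs ?_ fun y hy ↦ ?_
    · refine continuousOn_finsetSum _ fun σ _ ↦ ?_
      exact continuousOn_const.mul
        (((hpdρ _).continuousOn.mul (hT _ _ _).continuousOn).mul (hΨv _).continuousOn)
    · simp [altSum, pd_eq_zero_of_notMem_tsupport hy]
  rw [← add_eq_zero_iff_eq_neg, ← integral_add hi1 hi2, ← htot]
  refine integral_congr_ae (Filter.Eventually.of_forall fun y ↦ ?_)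
  by_cases hy : y ∈ Ω
  · have hn := hΩ.mem_nhds hy
    have hρy : DifferentiableAt ℝ ρ y := hρ.differentiable (by norm_num) y
    have hTy (a b c) : DifferentiableAt ℝ (T a b c) y :=
      ((hT a b c).contDiffAt hn).differentiableAt (by norm_num)
    have hΨy (w : Fin k → V) : DifferentiableAt ℝ (fun y ↦ Ψ y w) y :=
      ((hΨv w).contDiffAt hn).differentiableAt (by norm_num)
    -- Of the three terms in the product rule for `ρ T ∧ Ψ`, the one with `dΨ` has zero signed sum;
    -- adding it completes the sum to the total derivative.
    have hz := sum_perm_extDeriv_eq_zero v e (fun a b c ↦ ρ y * T a b c y)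
      ((hΨ.contDiffAt hn).differentiableAt (by norm_num)) (hd y hy)
    refine Eq.trans (add_zero _).symm (Eq.trans (congrArg (_ + ·) hz.symm) ?_)
    simp only [altSum, Finset.mul_sum, ← Finset.sum_add_distrib]
    refine Finset.sum_congr rfl fun σ _ ↦ ?_
    have e1 : fderiv ℝ (fun y ↦ ρ y * g σ y) y (e (v (σ 0))) =
        ρ y * (T (v (σ 1)) (v (σ 2)) (v (σ 3)) y *
          pd e (v (σ 0)) (fun y ↦ Ψ y fun i ↦ e (v (σ (i.addNat 4)))) y +
          (Ψ y fun i ↦ e (v (σ (i.addNat 4)))) *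
          pd e (v (σ 0)) (T (v (σ 1)) (v (σ 2)) (v (σ 3))) y) + g σ y * pd e (v (σ 0)) ρ y := by
      rw [fderiv_fun_mul hρy ((hTy _ _ _).fun_mul (hΨy _)), fderiv_fun_mul (hTy _ _ _) (hΨy _)]
      simp only [pd, g, FunLike.coe_add, FunLike.coe_smul, Pi.add_apply, Pi.smul_apply, smul_eq_mul]
    rw [e1]
    simp only [g]
    ring
  · have hy' : y ∉ tsupport ρ := fun h ↦ hy (hs h)
    have e1 (σ) (i : ι) : fderiv ℝ (fun y ↦ ρ y * g σ y) y (e i) = 0 :=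
      pd_eq_zero_of_notMem_tsupport (e := e) (fun h ↦ hy' (tsupport_mul_subset_left h)) i
    simp [altSum, pd_eq_zero_of_notMem_tsupport hy', image_eq_zero_of_notMem_tsupport hy', e1]

end Stokes

/-! ### Coordinate frames, transition maps and the Riemannian measure. -/

section CoordinateFrame

variable {n : ℕ} {M : Type*} [TopologicalSpace M] [ChartedSpace (EuclideanSpace ℝ (Fin n)) M]

section

variable [IsManifold (𝓡 n) ∞ M] {x₀ : M} {y : EuclideanSpace ℝ (Fin n)}

/-- This identifies coordinate vectors with the trivialization of the tangent bundle, from which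
their smoothness and linear independence are read off. -/
lemma coordTangent_eq_symmL (hy : y ∈ (extChartAt (𝓡 n) x₀).target) :
    coordTangent x₀ y =
      (trivializationAt (EuclideanSpace ℝ (Fin n)) (TangentSpace (𝓡 n)) x₀).symmL ℝ
        ((extChartAt (𝓡 n) x₀).symm y) := by
  have hx : (extChartAt (𝓡 n) x₀).symm y ∈ (chartAt (EuclideanSpace ℝ (Fin n)) x₀).source := by
    simpa using (extChartAt (𝓡 n) x₀).map_target hy
  rw [TangentBundle.symmL_trivializationAt hx]
  have h := (extChartAt (𝓡 n) x₀).right_inv hy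
  simp only [coordTangent, ModelWithCorners.range_eq_univ, mfderivWithin_univ]
  rw [h]

lemma symm_mem_baseSet (hy : y ∈ (extChartAt (𝓡 n) x₀).target) :
    (extChartAt (𝓡 n) x₀).symm y ∈
      (trivializationAt (EuclideanSpace ℝ (Fin n)) (TangentSpace (𝓡 n)) x₀).baseSet := by
  simpa using (extChartAt (𝓡 n) x₀).map_target hy

/-- The frame of coordinate vector fields, at a point of the chart. -/
def coordBasis (hy : y ∈ (extChartAt (𝓡 n) x₀).target) :
    Module.Basis (Fin n) ℝ (TangentSpace (𝓡 n) ((extChartAt (𝓡 n) x₀).symm y)) :=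
  (EuclideanSpace.basisFun (Fin n) ℝ).toBasis.map
    ((trivializationAt (EuclideanSpace ℝ (Fin n)) (TangentSpace (𝓡 n)) x₀).continuousLinearEquivAt
      ℝ _ (symm_mem_baseSet hy)).symm.toLinearEquiv

lemma coordBasis_apply (hy : y ∈ (extChartAt (𝓡 n) x₀).target) (i : Fin n) :
    coordBasis hy i = coordTangent x₀ y (EuclideanSpace.single i 1) := by
  rw [coordBasis, coordTangent_eq_symmL hy, Module.Basis.map_apply, OrthonormalBasis.coe_toBasis,
    EuclideanSpace.basisFun_apply, ← Trivialization.symm_continuousLinearEquivAt_eq _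
      (symm_mem_baseSet hy)]
  rfl

end

lemma contMDiffOn_coordTangent [IsManifold (𝓡 n) ∞ M] (x₀ : M) (v : EuclideanSpace ℝ (Fin n)) :
    ContMDiffOn (𝓡 n) ((𝓡 n).prod (𝓡 n)) ∞
      (fun y ↦ TotalSpace.mk' (EuclideanSpace ℝ (Fin n)) (E := TangentSpace (𝓡 n))
        ((extChartAt (𝓡 n) x₀).symm y) (coordTangent x₀ y v)) (extChartAt (𝓡 n) x₀).target := by
  rw [Trivialization.contMDiffOn_iff
    (e := trivializationAt (EuclideanSpace ℝ (Fin n)) (TangentSpace (𝓡 n)) x₀)]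
  · refine ⟨contMDiffOn_extChartAt_symm x₀, contMDiffOn_const (c := v) |>.congr fun y hy ↦ ?_⟩
    rw [coordTangent_eq_symmL hy]
    have := Trivialization.continuousLinearMapAt_symmL (R := ℝ) (trivializationAt
      (EuclideanSpace ℝ (Fin n)) (TangentSpace (𝓡 n)) x₀) (symm_mem_baseSet hy) v
    rwa [Trivialization.continuousLinearMapAt_apply, Trivialization.linearMapAt_apply,
      if_pos (symm_mem_baseSet hy)] at this
  · intro y hy
    rw [Trivialization.mem_source]
    exact symm_mem_baseSet hy

/-- The transition map between two charts. -/
def transition (x₀ x₁ : M) : EuclideanSpace ℝ (Fin n) → EuclideanSpace ℝ (Fin n) :=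
  extChartAt (𝓡 n) x₁ ∘ (extChartAt (𝓡 n) x₀).symm

lemma mdifferentiableAt_symm [IsManifold (𝓡 n) ∞ M] {x₀ : M} {y : EuclideanSpace ℝ (Fin n)}
    (hy : y ∈ (extChartAt (𝓡 n) x₀).target) :
    MDifferentiableAt (𝓡 n) (𝓡 n) (extChartAt (𝓡 n) x₀).symm y := by
  have := mdifferentiableWithinAt_extChartAt_symm (I := 𝓡 n) hy
  rwa [ModelWithCorners.range_eq_univ, mdifferentiableWithinAt_univ] at this

lemma differentiableAt_transition [IsManifold (𝓡 n) ∞ M] {x₀ x₁ : M} {y : EuclideanSpace ℝ (Fin n)}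
    (hy : y ∈ (extChartAt (𝓡 n) x₀).target)
    (hy' : (extChartAt (𝓡 n) x₀).symm y ∈ (extChartAt (𝓡 n) x₁).source) :
    DifferentiableAt ℝ (transition x₀ x₁) y := by
  rw [← mdifferentiableAt_iff_differentiableAt]
  exact MDifferentiableAt.comp (I' := 𝓡 n) y (mdifferentiableAt_extChartAt (by simpa using hy'))
    (mdifferentiableAt_symm hy)

/-- The coordinate tangent vectors, as vectors of the model space. -/
def coordVector (x₀ : M) (y : EuclideanSpace ℝ (Fin n)) :
    EuclideanSpace ℝ (Fin n) →L[ℝ] EuclideanSpace ℝ (Fin n) :=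
  mfderiv (𝓡 n) (𝓡 n) (extChartAt (𝓡 n) x₀).symm y

lemma isOpen_target_inter (x₀ x₁ : M) : IsOpen ((extChartAt (𝓡 n) x₀).target ∩
    (extChartAt (𝓡 n) x₀).symm ⁻¹' (extChartAt (𝓡 n) x₁).source) :=
  (continuousOn_extChartAt_symm x₀).isOpen_inter_preimage (isOpen_extChartAt_target x₀)
    (isOpen_extChartAt_source x₁)

lemma coordVector_transition [IsManifold (𝓡 n) ∞ M] {x₀ x₁ : M} {y : EuclideanSpace ℝ (Fin n)}
    (hy : y ∈ (extChartAt (𝓡 n) x₀).target)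
    (hy' : (extChartAt (𝓡 n) x₀).symm y ∈ (extChartAt (𝓡 n) x₁).source) :
    coordVector x₀ y =
      (coordVector x₁ (transition x₀ x₁ y)).comp (fderiv ℝ (transition x₀ x₁) y) := by
  have h1 : transition x₀ x₁ y ∈ (extChartAt (𝓡 n) x₁).target :=
    (extChartAt (𝓡 n) x₁).map_source hy'
  have h2 : (extChartAt (𝓡 n) x₀).symm =ᶠ[𝓝 y]
      (extChartAt (𝓡 n) x₁).symm ∘ transition x₀ x₁ := by
    filter_upwards [(isOpen_target_inter x₀ x₁).mem_nhds ⟨hy, hy'⟩] with z hz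
    exact ((extChartAt (𝓡 n) x₁).left_inv hz.2).symm
  have h3 := mfderiv_comp y (mdifferentiableAt_symm h1)
    (differentiableAt_transition hy hy').mdifferentiableAt
  rw [mfderiv_eq_fderiv] at h3
  exact h2.mfderiv_eq.trans h3

section Density

variable [RiemannianBundle (fun x : M ↦ TangentSpace (𝓡 n) x)]

lemma contDiffOn_gram [IsManifold (𝓡 n) ∞ M]
    [IsContMDiffRiemannianBundle (𝓡 n) ∞ (EuclideanSpace ℝ (Fin n))
      (fun x : M ↦ TangentSpace (𝓡 n) x)] (x₀ : M) (v w : EuclideanSpace ℝ (Fin n)) :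
    ContDiffOn ℝ ∞ (fun y ↦ (inner ℝ (coordTangent x₀ y v) (coordTangent x₀ y w) : ℝ))
      (extChartAt (𝓡 n) x₀).target := by
  rw [← contMDiffOn_iff_contDiffOn]
  exact (contMDiffOn_coordTangent x₀ v).inner_bundle (contMDiffOn_coordTangent x₀ w)

/-- The Gram matrix is `PᵀP` with `P` the matrix of `v` in an orthonormal basis, and `|det P|` is
the absolute value of the volume form. -/
lemma sqrt_det_gram_eq_abs_volumeForm {V : Type*} [NormedAddCommGroup V] [InnerProductSpace ℝ V]
    [Fact (Module.finrank ℝ V = n)] [Module.Finite ℝ V] (o : Orientation ℝ V (Fin n))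
    (v : Fin n → V) :
    Real.sqrt (Matrix.det (Matrix.of fun i j ↦ inner ℝ (v i) (v j))) = |o.volumeForm v| := by
  have e : OrthonormalBasis (Fin n) ℝ V :=
    (stdOrthonormalBasis ℝ V).reindex (finCongr Fact.out)
  have h : (Matrix.of fun i j ↦ inner ℝ (v i) (v j)) =
      (e.toBasis.toMatrix v).transpose * e.toBasis.toMatrix v := by
    ext i j
    simp only [Matrix.of_apply, Matrix.mul_apply, Matrix.transpose_apply,
      Module.Basis.toMatrix_apply, OrthonormalBasis.coe_toBasis_repr_apply,
      OrthonormalBasis.repr_apply_apply]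
    rw [← e.sum_inner_mul_inner (v i) (v j)]
    simp only [real_inner_comm]
  rw [o.volumeForm_robust' e, h, Matrix.det_mul, Matrix.det_transpose, Real.sqrt_mul_self_eq_abs,
    Module.Basis.det_apply]

lemma chartDensity_eq_abs [IsManifold (𝓡 n) ∞ M] (o : ManifoldOrientation n M) (x₀ : M)
    (y : EuclideanSpace ℝ (Fin n)) :
    chartDensity x₀ y = |o.volumeForm ((extChartAt (𝓡 n) x₀).symm y)
      fun i ↦ coordTangent x₀ y (EuclideanSpace.single i 1)| :=
  sqrt_det_gram_eq_abs_volumeForm _ _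

lemma chartDensity_pos [IsManifold (𝓡 n) ∞ M] (o : ManifoldOrientation n M) {x₀ : M}
    {y : EuclideanSpace ℝ (Fin n)} (hy : y ∈ (extChartAt (𝓡 n) x₀).target) :
    0 < chartDensity x₀ y := by
  rw [chartDensity_eq_abs o, abs_pos]
  simp only [← coordBasis_apply hy]
  refine (AlternatingMap.map_basis_ne_zero_iff _ _).2 fun h ↦ ?_
  have e := (stdOrthonormalBasis ℝ
    (TangentSpace (𝓡 n) ((extChartAt (𝓡 n) x₀).symm y))).reindex
      (finCongr (Fact.out (p := Module.finrank ℝ (TangentSpace (𝓡 n) _) = n)))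
  have h1 := Orientation.abs_volumeForm_apply_of_orthonormal
    (o.at' ((extChartAt (𝓡 n) x₀).symm y)) e
  rw [show (o.at' ((extChartAt (𝓡 n) x₀).symm y)).volumeForm = 0 from h] at h1
  exact one_ne_zero (h1.symm.trans abs_zero)

lemma continuousOn_chartDensity [IsManifold (𝓡 n) ∞ M]
    [IsContMDiffRiemannianBundle (𝓡 n) ∞ (EuclideanSpace ℝ (Fin n))
      (fun x : M ↦ TangentSpace (𝓡 n) x)] (x₀ : M) :
    ContinuousOn (chartDensity x₀) (extChartAt (𝓡 n) x₀).target := by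
  rw [continuousOn_iff_continuous_domRestrict]
  refine Real.continuous_sqrt.comp (Continuous.matrix_det (continuous_matrix fun i j ↦ ?_))
  exact continuousOn_iff_continuous_domRestrict.1 (contDiffOn_gram x₀ _ _).continuousOn

lemma chartDensity_eq_modelVolume [IsManifold (𝓡 n) ∞ M] (o : ManifoldOrientation n M) (x₀ : M)
    (y : EuclideanSpace ℝ (Fin n)) :
    chartDensity x₀ y = |(show EuclideanSpace ℝ (Fin n) [⋀^Fin n]→ₗ[ℝ] ℝ from
      o.volumeForm ((extChartAt (𝓡 n) x₀).symm y))
      fun i ↦ coordVector x₀ y (EuclideanSpace.single i 1)| :=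
  chartDensity_eq_abs o x₀ y

lemma abs_topForm_comp (η : EuclideanSpace ℝ (Fin n) [⋀^Fin n]→ₗ[ℝ] ℝ)
    (A L : EuclideanSpace ℝ (Fin n) →L[ℝ] EuclideanSpace ℝ (Fin n)) :
    (η fun i ↦ (A.comp L) (EuclideanSpace.single i 1)) =
      L.det * η fun i ↦ A (EuclideanSpace.single i 1) := by
  have h := (η.compLinearMap A.toLinearMap).eq_smul_basis_det
    (EuclideanSpace.basisFun (Fin n) ℝ).toBasis
  have h1 := congr($h (L.toLinearMap ∘ (EuclideanSpace.basisFun (Fin n) ℝ).toBasis))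
  rw [AlternatingMap.smul_apply, Module.Basis.det_comp_basis] at h1
  simpa [mul_comm, Function.comp_def] using h1

/-- The density is the absolute value of the volume form on the coordinate frame. By the chain rule
the two frames differ by the derivative of the transition map, so a determinant comes out. -/
lemma chartDensity_transition [IsManifold (𝓡 n) ∞ M] (o : ManifoldOrientation n M) {x₀ x₁ : M}
    {y : EuclideanSpace ℝ (Fin n)} (hy : y ∈ (extChartAt (𝓡 n) x₀).target)
    (hy' : (extChartAt (𝓡 n) x₀).symm y ∈ (extChartAt (𝓡 n) x₁).source) :
    chartDensity x₀ y =
      |(fderiv ℝ (transition x₀ x₁) y).det| * chartDensity x₁ (transition x₀ x₁ y) := by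
  rw [chartDensity_eq_modelVolume o, chartDensity_eq_modelVolume o, coordVector_transition hy hy',
    abs_topForm_comp, abs_mul]
  have : (extChartAt (𝓡 n) x₁).symm (transition x₀ x₁ y) = (extChartAt (𝓡 n) x₀).symm y :=
    (extChartAt (𝓡 n) x₁).left_inv hy'
  rw [this]

section Volume

variable [IsManifold (𝓡 n) ∞ M] [IsContMDiffRiemannianBundle (𝓡 n) ∞ (EuclideanSpace ℝ (Fin n))
      (fun x : M ↦ TangentSpace (𝓡 n) x)] [MeasurableSpace M] [BorelSpace M]

lemma aemeasurable_extChartAt_symm (x₀ : M) :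
    AEMeasurable (extChartAt (𝓡 n) x₀).symm
      (volume.restrict (extChartAt (𝓡 n) x₀).target) :=
  (continuousOn_extChartAt_symm x₀).aemeasurable (isOpen_extChartAt_target x₀).measurableSet

lemma measurableSet_target_inter (x₀ : M) {B : Set M} (hB : MeasurableSet B) :
    MeasurableSet ((extChartAt (𝓡 n) x₀).target ∩ (extChartAt (𝓡 n) x₀).symm ⁻¹' B) := by
  have h := (continuousOn_iff_continuous_domRestrict.1
    (continuousOn_extChartAt_symm (I := 𝓡 n) x₀)).measurable hB
  have h2 := (isOpen_extChartAt_target (I := 𝓡 n) x₀).measurableSet.subtype_image h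
  convert h2 using 1
  ext y
  simp [and_comm]

lemma chartVolume_apply (x₀ : M) {B : Set M} (hB : MeasurableSet B) :
    chartVolume (n := n) x₀ B =
      ∫⁻ y in (extChartAt (𝓡 n) x₀).target ∩ (extChartAt (𝓡 n) x₀).symm ⁻¹' B,
        ENNReal.ofReal (chartDensity x₀ y) := by
  rw [chartVolume, Measure.map_apply_of_aemeasurable
    ((aemeasurable_extChartAt_symm x₀).mono_ac (withDensity_absolutelyContinuous _ _)) hB,
    withDensity_apply', Measure.restrict_restrict' (isOpen_extChartAt_target x₀).measurableSet,
    inter_comm]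

/-- The change of variables formula for the transition map, together with `chartDensity_transition`.
-/
lemma chartVolume_eq_of_subset (o : ManifoldOrientation n M) {x₀ x₁ : M} {B : Set M}
    (hB : MeasurableSet B) (h0 : B ⊆ (extChartAt (𝓡 n) x₀).source)
    (h1 : B ⊆ (extChartAt (𝓡 n) x₁).source) :
    chartVolume (n := n) x₀ B = chartVolume (n := n) x₁ B := by
  rw [chartVolume_apply x₀ hB, chartVolume_apply x₁ hB]
  set S := (extChartAt (𝓡 n) x₀).target ∩ (extChartAt (𝓡 n) x₀).symm ⁻¹' B with hS
  have himg : (extChartAt (𝓡 n) x₁).target ∩ (extChartAt (𝓡 n) x₁).symm ⁻¹' B =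
      transition x₀ x₁ '' S := by
    ext z
    constructor
    · rintro ⟨hz, hzB⟩
      refine ⟨extChartAt (𝓡 n) x₀ ((extChartAt (𝓡 n) x₁).symm z),
        ⟨(extChartAt (𝓡 n) x₀).map_source (h0 hzB), ?_⟩, ?_⟩
      · rwa [mem_preimage, (extChartAt (𝓡 n) x₀).left_inv (h0 hzB)]
      · rw [transition, Function.comp_apply, (extChartAt (𝓡 n) x₀).left_inv (h0 hzB),
          (extChartAt (𝓡 n) x₁).right_inv hz]
    · rintro ⟨y, ⟨hy, hyB⟩, rfl⟩
      refine ⟨(extChartAt (𝓡 n) x₁).map_source (h1 hyB), ?_⟩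
      rw [mem_preimage, transition, Function.comp_apply, (extChartAt (𝓡 n) x₁).left_inv (h1 hyB)]
      exact hyB
  have hinj : InjOn (transition x₀ x₁) S := by
    rintro y ⟨hy, hyB⟩ z ⟨hz, hzB⟩ h
    have := (extChartAt (𝓡 n) x₁).injOn (h1 hyB) (h1 hzB) h
    exact (extChartAt (𝓡 n) x₀).symm.injOn hy hz this
  have hSm : MeasurableSet S := measurableSet_target_inter x₀ hB
  rw [himg, lintegral_image_eq_lintegral_abs_det_fderiv_mul volume hSm
    (fun y hy ↦ (differentiableAt_transition hy.1 (h1 hy.2)).hasFDerivAt.hasFDerivWithinAt) hinj]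
  refine setLIntegral_congr_fun hSm fun y hy ↦ ?_
  rw [chartDensity_transition o hy.1 (h1 hy.2), ENNReal.ofReal_mul (abs_nonneg _)]

lemma chartVolume_inter_source (x₀ : M) {B : Set M} (hB : MeasurableSet B) :
    chartVolume (n := n) x₀ (B ∩ (extChartAt (𝓡 n) x₀).source) = chartVolume (n := n) x₀ B := by
  rw [chartVolume_apply x₀ hB,
    chartVolume_apply x₀ (hB.inter (isOpen_extChartAt_source x₀).measurableSet)]
  congr 2
  ext y
  simp only [mem_inter_iff, mem_preimage, and_congr_right_iff, and_iff_left_iff_imp]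
  exact fun hy _ ↦ (extChartAt (𝓡 n) x₀).map_target hy

/-- Since chart volumes agree on overlaps, the chart volume at `x₀` plus the part of the supremum
outside that chart dominates every chart volume, hence the supremum itself. -/
lemma riemannianVolume_restrict_source (o : ManifoldOrientation n M) (x₀ : M) :
    (riemannianVolume n M).restrict (extChartAt (𝓡 n) x₀).source = chartVolume (n := n) x₀ := by
  have hs := (isOpen_extChartAt_source (I := 𝓡 n) x₀).measurableSet
  have hle : riemannianVolume n M ≤ chartVolume (n := n) x₀ +
      (riemannianVolume n M).restrict (extChartAt (𝓡 n) x₀).sourceᶜ := by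
    refine iSup_le fun x ↦ Measure.le_iff.2 fun B hB ↦ ?_
    rw [← measure_inter_add_sdiff B hs, Measure.add_apply, Measure.restrict_apply hB,
      ← sdiff_eq]
    refine add_le_add ?_ (Measure.le_iff'.1 (le_iSup (chartVolume (n := n)) x) _)
    have hs' := (isOpen_extChartAt_source (I := 𝓡 n) x).measurableSet
    rw [← chartVolume_inter_source x (hB.inter hs),
      chartVolume_eq_of_subset o ((hB.inter hs).inter hs') (x₁ := x₀) inter_subset_right
        (inter_subset_left.trans inter_subset_right)]
    exact measure_mono (inter_subset_left.trans inter_subset_left)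
  refine Measure.ext fun B hB ↦ le_antisymm ?_ ?_
  · rw [Measure.restrict_apply hB]
    refine (Measure.le_iff'.1 hle _).trans ?_
    rw [Measure.add_apply, Measure.restrict_apply (hB.inter hs)]
    simp only [inter_assoc, inter_compl_self, inter_empty, measure_empty, add_zero]
    exact measure_mono inter_subset_left
  · rw [Measure.restrict_apply hB, ← chartVolume_inter_source x₀ hB]
    exact Measure.le_iff'.1 (le_iSup (chartVolume (n := n)) x₀) _

/-- The density is continuous, hence bounded on a small coordinate ball; so the volume is locally
finite, and compactness concludes. -/
lemma isFiniteMeasure_riemannianVolume [CompactSpace M] (o : ManifoldOrientation n M) :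
    IsFiniteMeasure (riemannianVolume n M) := by
  have : IsLocallyFiniteMeasure (riemannianVolume n M) := by
    refine ⟨fun x₀ ↦ ?_⟩
    have hc := (continuousOn_chartDensity x₀).continuousAt (x := extChartAt (𝓡 n) x₀ x₀)
      ((isOpen_extChartAt_target x₀).mem_nhds (mem_extChartAt_target x₀))
    obtain ⟨r, hr, hball⟩ := Metric.mem_nhds_iff.1 (Filter.inter_mem
      (hc.eventually (gt_mem_nhds (lt_add_one _)))
      ((isOpen_extChartAt_target x₀).mem_nhds (mem_extChartAt_target x₀)))
    set U := (extChartAt (𝓡 n) x₀).source ∩ extChartAt (𝓡 n) x₀ ⁻¹'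
      Metric.ball (extChartAt (𝓡 n) x₀ x₀) r with hU
    have hUo : IsOpen U := (continuousOn_extChartAt x₀).isOpen_inter_preimage
      (isOpen_extChartAt_source x₀) Metric.isOpen_ball
    refine ⟨U, hUo.mem_nhds ⟨mem_extChartAt_source x₀, Metric.mem_ball_self hr⟩, ?_⟩
    rw [← Measure.restrict_eq_self _ (inter_subset_left (s := (extChartAt (𝓡 n) x₀).source)),
      riemannianVolume_restrict_source o, chartVolume_apply x₀ hUo.measurableSet]
    refine (lintegral_mono_set (t := Metric.ball (extChartAt (𝓡 n) x₀ x₀) r) ?_).trans_lt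
      (setLIntegral_lt_top_of_le_nnreal measure_ball_lt_top.ne
        ⟨(chartDensity x₀ (extChartAt (𝓡 n) x₀ x₀) + 1).toNNReal, fun y hy ↦
          ENNReal.ofReal_le_ofReal (hball hy).1.le⟩)
    rintro y ⟨hy, -, hyB⟩
    rwa [mem_preimage, (extChartAt (𝓡 n) x₀).right_inv hy] at hyB
  infer_instance

/-- The positive density gives positive mass to nonempty open sets. This upgrades almost everywhere
equality of continuous functions to equality at every point in the case `YM(A') = YM(A)`. -/
lemma isOpenPosMeasure_riemannianVolume (o : ManifoldOrientation n M) :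
    (riemannianVolume n M).IsOpenPosMeasure := by
  refine ⟨fun U hU ⟨x₀, hx₀⟩ h ↦ ?_⟩
  have h1 : chartVolume (n := n) x₀ U = 0 :=
    le_antisymm ((Measure.le_iff'.1 (le_iSup (chartVolume (n := n)) x₀) _).trans h.le) bot_le
  have hS := measurableSet_target_inter (n := n) x₀ hU.measurableSet
  rw [chartVolume_apply x₀ hU.measurableSet, setLIntegral_eq_zero_iff' hS
    (((continuousOn_chartDensity x₀).mono inter_subset_left).aemeasurable hS).ennreal_ofReal] at h1
  have hSo : IsOpen ((extChartAt (𝓡 n) x₀).target ∩ (extChartAt (𝓡 n) x₀).symm ⁻¹' U) :=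
    (continuousOn_extChartAt_symm x₀).isOpen_inter_preimage (isOpen_extChartAt_target x₀) hU
  have h2 := hSo.measure_pos volume ⟨extChartAt (𝓡 n) x₀ x₀, mem_extChartAt_target x₀, by
    simpa [mem_preimage] using hx₀⟩
  refine h2.ne' (measure_mono_null (fun y hy ↦ ?_) (ae_iff.1 h1))
  rw [mem_ofPred_eq, Classical.not_imp]
  exact ⟨hy, by simpa using chartDensity_pos o hy.1⟩

lemma integral_chartVolume (x₀ : M) {f : M → ℝ} (hf : Continuous f) :
    ∫ x, f x ∂(chartVolume (n := n) x₀) = ∫ y in (extChartAt (𝓡 n) x₀).target,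
      chartDensity x₀ y * f ((extChartAt (𝓡 n) x₀).symm y) := by
  have hm : AEMeasurable (fun y ↦ ENNReal.ofReal (chartDensity x₀ y))
      (volume.restrict (extChartAt (𝓡 n) x₀).target) :=
    ((continuousOn_chartDensity x₀).aemeasurable
      (isOpen_extChartAt_target x₀).measurableSet).ennreal_ofReal
  rw [chartVolume, integral_map ((aemeasurable_extChartAt_symm x₀).mono_ac
    (withDensity_absolutelyContinuous _ _)) hf.aestronglyMeasurable,
    integral_withDensity_eq_integral_toReal_smul₀ hm (by simp)]
  refine integral_congr_ae (.of_forall fun y ↦ ?_)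
  simp [ENNReal.toReal_ofReal (Real.sqrt_nonneg _), chartDensity]

/-- Integration in a chart of a function supported there. -/
lemma integral_riemannianVolume_eq (o : ManifoldOrientation n M) (x₀ : M) {f : M → ℝ}
    (hf : Continuous f) (h0 : ∀ x ∉ (extChartAt (𝓡 n) x₀).source, f x = 0) :
    ∫ x, f x ∂(riemannianVolume n M) = ∫ y in (extChartAt (𝓡 n) x₀).target,
      chartDensity x₀ y * f ((extChartAt (𝓡 n) x₀).symm y) := by
  rw [← integral_chartVolume x₀ hf, ← riemannianVolume_restrict_source o,
    setIntegral_eq_integral_of_forall_compl_eq_zero h0]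

end Volume

end Density

end CoordinateFrame

lemma two_le_infty : (2 : ℕ∞ω) ≤ ∞ :=
  WithTop.coe_le_coe (b := (2 : ℕ∞)) (a := ⊤) |>.2 le_top

/-! ### Coordinate vector fields. -/

section CoordinateField

variable {n : ℕ} {M : Type*} [TopologicalSpace M] [ChartedSpace (EuclideanSpace ℝ (Fin n)) M]
  [IsManifold (𝓡 n) ∞ M]

/-- The coordinate vector field with constant components `v` in the chart at `x₀`. -/
def coordField (x₀ : M) (v : EuclideanSpace ℝ (Fin n)) (x : M) : TangentSpace (𝓡 n) x :=
  (trivializationAt (EuclideanSpace ℝ (Fin n)) (TangentSpace (𝓡 n)) x₀).symmL ℝ x v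

lemma coordField_symm {x₀ : M} {y : EuclideanSpace ℝ (Fin n)}
    (hy : y ∈ (extChartAt (𝓡 n) x₀).target) (v : EuclideanSpace ℝ (Fin n)) :
    coordField x₀ v ((extChartAt (𝓡 n) x₀).symm y) = coordTangent x₀ y v := by
  rw [coordTangent_eq_symmL hy]
  rfl

lemma contMDiffAt_coordField {x₀ x : M} (hx : x ∈ (extChartAt (𝓡 n) x₀).source)
    (v : EuclideanSpace ℝ (Fin n)) :
    ContMDiffAt (𝓡 n) ((𝓡 n).prod (𝓡 n)) ∞
      (fun y ↦ TotalSpace.mk' (EuclideanSpace ℝ (Fin n)) (E := TangentSpace (𝓡 n)) y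
        (coordField x₀ v y)) x := by
  have hb : x ∈ (trivializationAt (EuclideanSpace ℝ (Fin n)) (TangentSpace (𝓡 n)) x₀).baseSet := by
    simpa using hx
  rw [Trivialization.contMDiffAt_section_iff (trivializationAt (EuclideanSpace ℝ (Fin n))
    (TangentSpace (𝓡 n)) x₀) hb]
  refine (contMDiffAt_const (c := v)).congr_of_eventuallyEq ?_
  filter_upwards [(trivializationAt (EuclideanSpace ℝ (Fin n))
    (TangentSpace (𝓡 n)) x₀).open_baseSet.mem_nhds hb] with y hy
  rw [← Trivialization.continuousLinearMapAt_apply_of_mem (R := ℝ) _ hy]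
  exact Trivialization.continuousLinearMapAt_symmL _ hy v

lemma mdifferentiableAt_coordField {x₀ x : M} (hx : x ∈ (extChartAt (𝓡 n) x₀).source)
    (v : EuclideanSpace ℝ (Fin n)) :
    MDifferentiableAt (𝓡 n) ((𝓡 n).prod (𝓡 n))
      (fun y ↦ TotalSpace.mk' (EuclideanSpace ℝ (Fin n)) (E := TangentSpace (𝓡 n)) y
        (coordField x₀ v y)) x :=
  (contMDiffAt_coordField hx v).mdifferentiableAt (by simp)

/-- The constant vector field on the model space. -/
def constField (v y : EuclideanSpace ℝ (Fin n)) : TangentSpace (𝓡 n) y := v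

lemma mdifferentiableAt_constField {v : EuclideanSpace ℝ (Fin n)} (y : EuclideanSpace ℝ (Fin n)) :
    MDifferentiableAt (𝓡 n) (𝓡 n).tangent
      (fun z ↦ (constField v z : TangentBundle (𝓡 n) (EuclideanSpace ℝ (Fin n)))) y :=
  (contMDiffAt_vectorSpace_iff_contDiffAt.2 (contDiffAt_const (c := v) (n := 1))).mdifferentiableAt
    (by simp)

lemma coordField_eq_mpullback {x₀ x : M} (hx : x ∈ (extChartAt (𝓡 n) x₀).source)
    (v : EuclideanSpace ℝ (Fin n)) :
    coordField x₀ v x = VectorField.mpullback (𝓡 n) (𝓡 n) (extChartAt (𝓡 n) x₀) (constField v) x := by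
  have hb : x ∈ (trivializationAt (EuclideanSpace ℝ (Fin n)) (TangentSpace (𝓡 n)) x₀).baseSet := by
    simpa using hx
  have h1 : (mfderiv (𝓡 n) (𝓡 n) (extChartAt (𝓡 n) x₀) x) =
      ((trivializationAt (EuclideanSpace ℝ (Fin n)) (TangentSpace (𝓡 n)) x₀).continuousLinearEquivAt
        ℝ x hb : TangentSpace (𝓡 n) x →L[ℝ] EuclideanSpace ℝ (Fin n)) := by
    rw [← TangentBundle.continuousLinearMapAt_trivializationAt (by simpa using hx)]
    exact (Trivialization.coe_continuousLinearEquivAt_eq' _ hb).symm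
  have h2 := congr($((congrArg ContinuousLinearMap.inverse h1).trans
    (ContinuousLinearMap.inverse_equiv _)) v)
  refine Eq.trans ?_ h2.symm
  rw [coordField, ← Trivialization.symm_continuousLinearEquivAt_eq _ hb]
  rfl

/-- Coordinate fields are the pull-backs of constant fields by the chart, and the bracket commutes
with pull-back. -/
lemma mlieBracket_coordField {x₀ x : M} (hx : x ∈ (extChartAt (𝓡 n) x₀).source)
    (v w : EuclideanSpace ℝ (Fin n)) :
    VectorField.mlieBracket (𝓡 n) (coordField x₀ v) (coordField x₀ w) x = 0 := by
  have h (v : EuclideanSpace ℝ (Fin n)) : coordField x₀ v =ᶠ[𝓝 x]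
      VectorField.mpullback (𝓡 n) (𝓡 n) (extChartAt (𝓡 n) x₀) (constField v) := by
    filter_upwards [(isOpen_extChartAt_source x₀).mem_nhds hx] with y hy
    exact coordField_eq_mpullback hy v
  have h2 : minSmoothness ℝ 2 = 2 := minSmoothness_of_isRCLikeNormedField
  have : IsManifold (𝓡 n) (minSmoothness ℝ 2) M := by
    rw [h2]
    exact IsManifold.of_le (n := ∞) (two_le_infty)
  rw [(h v).mlieBracket_vectorField_eq (h w), ← VectorField.mpullback_mlieBracket (n := ∞)
    (V := constField v) (W := constField w)]
  · have h3 : VectorField.mlieBracket (𝓡 n) (constField v) (constField w) = 0 := by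
      rw [← VectorField.mlieBracketWithin_univ, VectorField.mlieBracketWithin_eq_lieBracketWithin]
      ext1 y
      have h4 : VectorField.lieBracketWithin ℝ (fun _ : EuclideanSpace ℝ (Fin n) ↦ v) (fun _ ↦ w)
          univ y = 0 := by simp [VectorField.lieBracketWithin_eq]
      exact h4
    rw [h3, VectorField.mpullback_apply]
    exact map_zero _
  · exact mdifferentiableAt_constField _
  · exact mdifferentiableAt_constField _
  · exact contMDiffAt_extChartAt' (by simpa using hx)
  · rw [h2]
    exact two_le_infty

lemma mvfderiv_coordTangent {W : Type*} [NormedAddCommGroup W] [NormedSpace ℝ W] {g : M → W}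
    {x₀ : M} {y : EuclideanSpace ℝ (Fin n)} (hy : y ∈ (extChartAt (𝓡 n) x₀).target)
    (hg : MDifferentiableAt (𝓡 n) 𝓘(ℝ, W) g ((extChartAt (𝓡 n) x₀).symm y))
    (v : EuclideanSpace ℝ (Fin n)) :
    mvfderiv (𝓡 n) g ((extChartAt (𝓡 n) x₀).symm y) (coordTangent x₀ y v) =
      fderiv ℝ (g ∘ (extChartAt (𝓡 n) x₀).symm) y v := by
  have h := mfderiv_comp y hg (mdifferentiableAt_symm hy)
  rw [mfderiv_eq_fderiv] at h
  exact (congr($h v)).symm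

end CoordinateField

/-! ### Sections read in a chart and a trivialization. -/

section LocalForm

variable {n : ℕ} {M : Type*} [TopologicalSpace M] [ChartedSpace (EuclideanSpace ℝ (Fin n)) M]
  [IsManifold (𝓡 n) ∞ M]
  {F : Type*} [NormedAddCommGroup F] [NormedSpace ℂ F] [FiniteDimensional ℂ F]
  {E : M → Type*} [TopologicalSpace (TotalSpace F E)]
  [∀ x, NormedAddCommGroup (E x)] [∀ x, InnerProductSpace ℂ (E x)]
  [FiberBundle F E] [VectorBundle ℂ F E] [VectorBundle ℝ F E]
  [ContMDiffVectorBundle ∞ F E (𝓡 n)]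

variable (F E) in
/-- The domain, in the chart at `x₀`, of the trivialization of `E` at `x₀`. -/
def frameDomain (x₀ : M) : Set (EuclideanSpace ℝ (Fin n)) :=
  (extChartAt (𝓡 n) x₀).target ∩
    (extChartAt (𝓡 n) x₀).symm ⁻¹' (trivializationAt F E x₀).baseSet

variable (F E) in
lemma isOpen_frameDomain (x₀ : M) : IsOpen (frameDomain (n := n) F E x₀) :=
  (continuousOn_extChartAt_symm x₀).isOpen_inter_preimage (isOpen_extChartAt_target x₀)
    (trivializationAt F E x₀).open_baseSet

variable (F E) in
lemma mem_frameDomain (x₀ : M) : extChartAt (𝓡 n) x₀ x₀ ∈ frameDomain (n := n) F E x₀ :=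
  ⟨mem_extChartAt_target x₀, by
    simpa using FiberBundle.mem_baseSet_trivializationAt' (F := F) (E := E) x₀⟩

variable (F E) in
/-- The coordinates of vectors of `E` in the frame at `x₀`. -/
def frameMap (x₀ x : M) : E x →L[ℝ] F :=
  (trivializationAt F E x₀).continuousLinearMapAt ℝ x

/-- A section of `E` read in the chart and the frame at `x₀`. -/
def readSection (x₀ : M) (σ : ∀ x, E x) (y : EuclideanSpace ℝ (Fin n)) : F :=
  frameMap F E x₀ ((extChartAt (𝓡 n) x₀).symm y) (σ ((extChartAt (𝓡 n) x₀).symm y))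

lemma frameMap_eq_on {x₀ : M} (σ : ∀ x, E x) {x : M} (hx : x ∈ (trivializationAt F E x₀).baseSet) :
    (fun z ↦ frameMap F E x₀ z (σ z)) =ᶠ[𝓝 x] fun z ↦ (trivializationAt F E x₀ ⟨z, σ z⟩).2 := by
  filter_upwards [(trivializationAt F E x₀).open_baseSet.mem_nhds hx] with z hz
  exact Trivialization.continuousLinearMapAt_apply_of_mem (R := ℝ) _ hz _

lemma contMDiffAt_frameMap {x₀ : M} {σ : ∀ x, E x} {x : M}
    (hx : x ∈ (trivializationAt F E x₀).baseSet) {m : ℕ∞}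
    (hσ : ContMDiffAt (𝓡 n) ((𝓡 n).prod 𝓘(ℝ, F)) m (fun z ↦ TotalSpace.mk' F z (σ z)) x) :
    ContMDiffAt (𝓡 n) 𝓘(ℝ, F) m (fun z ↦ frameMap F E x₀ z (σ z)) x := by
  have : ContMDiffVectorBundle m F E (𝓡 n) :=
    ContMDiffVectorBundle.of_le (n := ∞) (by exact_mod_cast le_top)
  exact ((Trivialization.contMDiffAt_section_iff _ hx).1 hσ).congr_of_eventuallyEq
    (frameMap_eq_on σ hx)

lemma mdifferentiableAt_frameMap {x₀ : M} {σ : ∀ x, E x} {x : M}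
    (hx : x ∈ (trivializationAt F E x₀).baseSet)
    (hσ : MDifferentiableAt (𝓡 n) ((𝓡 n).prod 𝓘(ℝ, F)) (fun z ↦ TotalSpace.mk' F z (σ z)) x) :
    MDifferentiableAt (𝓡 n) 𝓘(ℝ, F) (fun z ↦ frameMap F E x₀ z (σ z)) x := by
  have : ContMDiffVectorBundle 1 F E (𝓡 n) :=
    ContMDiffVectorBundle.of_le (n := ∞) (by simp)
  exact ((Trivialization.mdifferentiableAt_section_iff _ _ _ hx).1 hσ).congr_of_eventuallyEq
    (frameMap_eq_on σ hx)

lemma contDiffAt_readSection {x₀ : M} {σ : ∀ x, E x} {y : EuclideanSpace ℝ (Fin n)}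
    (hy : y ∈ frameDomain F E x₀) {m : ℕ∞}
    (hσ : ContMDiffAt (𝓡 n) ((𝓡 n).prod 𝓘(ℝ, F)) m (fun z ↦ TotalSpace.mk' F z (σ z))
      ((extChartAt (𝓡 n) x₀).symm y)) :
    ContDiffAt ℝ m (readSection (F := F) x₀ σ) y := by
  rw [← contMDiffAt_iff_contDiffAt]
  refine ContMDiffAt.comp y (contMDiffAt_frameMap hy.2 hσ) ?_
  exact ((contMDiffOn_extChartAt_symm (n := m) x₀).contMDiffAt
    ((isOpen_extChartAt_target x₀).mem_nhds hy.1))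

end LocalForm

/-! ### The connection form: `D = d + A` locally. -/

section ConnectionForm

/-- The cancellation of the `df` terms between two Leibniz rules, isolated from the bundle types. -/
lemma smul_aux {G F : Type*} [AddCommGroup G] [Module ℝ G] [TopologicalSpace G] [AddCommGroup F]
    [Module ℝ F] [TopologicalSpace F] (L : G →L[ℝ] F) (a : ℝ) {c c' : ℝ} (h : c = c') (d s : G)
    (p : F) : L (a • d + c • s) - (a • p + c' • L s) = a • (L d - p) := by
  rw [map_add, map_smul, map_smul, h]
  module

lemma add_aux {G F : Type*} [AddCommGroup G] [Module ℝ G] [TopologicalSpace G] [AddCommGroup F]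
    [Module ℝ F] [TopologicalSpace F] (L : G →L[ℝ] F) (d d' : G) (p p' : F) :
    L (d + d') - (p + p') = L d - p + (L d' - p') := by
  rw [map_add]
  abel

variable {n : ℕ} {M : Type*} [TopologicalSpace M] [T2Space M]
  [ChartedSpace (EuclideanSpace ℝ (Fin n)) M] [IsManifold (𝓡 n) ∞ M]
  {F : Type*} [NormedAddCommGroup F] [NormedSpace ℂ F] [FiniteDimensional ℂ F]
  {E : M → Type*} [TopologicalSpace (TotalSpace F E)]
  [∀ x, NormedAddCommGroup (E x)] [∀ x, InnerProductSpace ℂ (E x)]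
  [FiberBundle F E] [VectorBundle ℂ F E] [VectorBundle ℝ F E]
  [ContMDiffVectorBundle ∞ F E (𝓡 n)] [IsContMDiffRiemannianBundle (𝓡 n) ∞ F E]

namespace HermitianConnection

variable (D : HermitianConnection n F E)

/-- The covariant derivative of a section which is smooth near a point is smooth there. -/
lemma contMDiffAt_cov {x : M} {σ : ∀ x, E x} {u : Set M} (hu : IsOpen u) (hxu : x ∈ u)
    (hσu : ContMDiffOn (𝓡 n) ((𝓡 n).prod 𝓘(ℝ, F)) ∞ (fun y ↦ TotalSpace.mk' F y (σ y)) u) :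
    ContMDiffAt (𝓡 n) ((𝓡 n).prod 𝓘(ℝ, EuclideanSpace ℝ (Fin n) →L[ℝ] F)) ∞
      (fun y ↦ TotalSpace.mk' (EuclideanSpace ℝ (Fin n) →L[ℝ] F)
        (E := fun y ↦ TangentSpace (𝓡 n) y →L[ℝ] E y) y (D.toFun σ y)) x := by
  -- Smoothness of `D` is applied to a globally smooth section, so `σ` is cut off by a bump function
  -- equal to `1` near `x`; locality of `D` removes the cut-off.
  obtain ⟨f, hf, -⟩ := (SmoothBumpFunction.nhds_basis_support (I := 𝓡 n)
    (hu.mem_nhds hxu)).mem_iff.1 (hu.mem_nhds hxu)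
  have hglob := ContMDiffOn.smul_section_of_tsupport (n := ∞) (ψ := f)
    f.contMDiff.contMDiffOn hu hf hσu
  have hD := D.smooth.contMDiff.contMDiff (σ := (f : M → ℝ) • σ)
    (by simpa using hglob.contMDiffOn)
  have hDx := hD.contMDiffAt (x := x) Filter.univ_mem
  refine hDx.congr_of_eventuallyEq ?_
  have h1 : ∀ᶠ y in 𝓝 x, f =ᶠ[𝓝 y] 1 := eventually_eventually_nhds.2 f.eventuallyEq_one
  filter_upwards [hu.mem_nhds hxu, h1] with y hy hfy
  congr 1
  refine D.isCovariantDerivativeOnUniv.congr_of_eventuallyEq (s := univ)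
    ((hσu.contMDiffAt (hu.mem_nhds hy)).mdifferentiableAt (by simp))
    (hglob.contMDiffAt.mdifferentiableAt (by simp)) Filter.univ_mem ?_
  filter_upwards [hfy] with z hz
  simp [hz]

variable (x₀ : M)

/-- In the frame, `Dσ` and `dσ` satisfy the Leibniz rule with the same term `df ⊗ σ`, so their
difference depends only on the value of `σ` at the point. -/
lemma tensorialAt_connForm {y : EuclideanSpace ℝ (Fin n)} (hy : y ∈ frameDomain F E x₀) :
    TensorialAt (𝓡 n) F (fun σ : ∀ x, E x ↦
      (frameMap F E x₀ ((extChartAt (𝓡 n) x₀).symm y)).comp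
        ((D.toFun σ ((extChartAt (𝓡 n) x₀).symm y)).comp (coordTangent x₀ y)) -
      fderiv ℝ (readSection (F := F) x₀ σ) y) ((extChartAt (𝓡 n) x₀).symm y) where
  smul {f σ} hf hσ := by
    have h1 : readSection (F := F) x₀ (f • σ) =
        fun z ↦ (f ∘ (extChartAt (𝓡 n) x₀).symm) z • readSection x₀ σ z := by
      ext1 z
      exact map_smul (frameMap F E x₀ _) _ _
    have hf' : DifferentiableAt ℝ (f ∘ (extChartAt (𝓡 n) x₀).symm) y :=
      (hf.comp y (mdifferentiableAt_symm hy.1)).differentiableAt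
    have hσ' : DifferentiableAt ℝ (readSection (F := F) x₀ σ) y :=
      ((mdifferentiableAt_frameMap hy.2 hσ).comp y (mdifferentiableAt_symm hy.1)).differentiableAt
    rw [h1, fderiv_fun_smul hf' hσ',
      D.isCovariantDerivativeOnUniv.leibniz hσ hf]
    ext v
    have h2 := mvfderiv_coordTangent hy.1 hf v
    exact smul_aux (frameMap F E x₀ _) _ h2 _ _ _
  add {σ σ'} hσ hσ' := by
    have h1 : readSection (n := n) (F := F) x₀ (σ + σ') =
        fun z ↦ readSection (n := n) x₀ σ z + readSection x₀ σ' z := by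
      ext1 z
      exact map_add (frameMap F E x₀ _) _ _
    have hd {σ : ∀ x, E x} (hσ : MDifferentiableAt (𝓡 n) ((𝓡 n).prod 𝓘(ℝ, F))
        (fun z ↦ TotalSpace.mk' F z (σ z)) ((extChartAt (𝓡 n) x₀).symm y)) :
        DifferentiableAt ℝ (readSection (F := F) x₀ σ) y :=
      ((mdifferentiableAt_frameMap hy.2 hσ).comp y (mdifferentiableAt_symm hy.1)).differentiableAt
    rw [h1, fderiv_fun_add (hd hσ) (hd hσ'), D.isCovariantDerivativeOnUniv.add hσ hσ']
    ext v
    exact add_aux (frameMap F E x₀ _) _ _ _ _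

open Classical in
/-- The connection form of `D` in the chart and the frame at `x₀`. -/
def connForm (v y : EuclideanSpace ℝ (Fin n)) : F →L[ℝ] F :=
  if hy : y ∈ frameDomain F E x₀ then
    (ContinuousLinearMap.apply ℝ F v).comp ((TensorialAt.mkHom _ _
      (D.tensorialAt_connForm x₀ hy)).comp ((trivializationAt F E x₀).symmL ℝ _))
  else 0

lemma frameMap_cov {y : EuclideanSpace ℝ (Fin n)} (hy : y ∈ frameDomain F E x₀) {σ : ∀ x, E x}
    (hσ : MDifferentiableAt (𝓡 n) ((𝓡 n).prod 𝓘(ℝ, F)) (fun z ↦ TotalSpace.mk' F z (σ z))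
      ((extChartAt (𝓡 n) x₀).symm y)) (v : EuclideanSpace ℝ (Fin n)) :
    frameMap F E x₀ _ (D.toFun σ ((extChartAt (𝓡 n) x₀).symm y) (coordTangent x₀ y v)) =
      fderiv ℝ (readSection (F := F) x₀ σ) y v +
        D.connForm x₀ v y (readSection (F := F) x₀ σ y) := by
  have h := TensorialAt.mkHom_apply (D.tensorialAt_connForm x₀ hy) hσ
  have h1 : D.connForm x₀ v y (readSection (F := F) x₀ σ y) = (frameMap F E x₀ _
      (D.toFun σ ((extChartAt (𝓡 n) x₀).symm y) (coordTangent x₀ y v)) -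
      fderiv ℝ (readSection (F := F) x₀ σ) y v) := by
    rw [connForm, dif_pos hy]
    have h2 := Trivialization.symmL_continuousLinearMapAt (R := ℝ) (trivializationAt F E x₀) hy.2
      (σ ((extChartAt (𝓡 n) x₀).symm y))
    have h3 := congr(TensorialAt.mkHom _ _ (D.tensorialAt_connForm x₀ hy) $h2 v)
    refine h3.trans ?_
    rw [h]
    rfl
  rw [h1, add_sub_cancel]

/-- The section of `E` with constant coordinates `w` in the frame at `x₀`. -/
def constSection (x₀ : M) (w : F) (x : M) : E x := (trivializationAt F E x₀).symmL ℝ x w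

lemma frameMap_constSection {x : M} (hx : x ∈ (trivializationAt F E x₀).baseSet) (w : F) :
    frameMap F E x₀ x (constSection x₀ w x) = w :=
  Trivialization.continuousLinearMapAt_symmL _ hx w

lemma contMDiffOn_constSection (w : F) :
    ContMDiffOn (𝓡 n) ((𝓡 n).prod 𝓘(ℝ, F)) ∞
      (fun y ↦ TotalSpace.mk' F (E := E) y (constSection x₀ w y))
      (trivializationAt F E x₀).baseSet := by
  rw [Trivialization.contMDiffOn_section_baseSet_iff]
  refine (contMDiffOn_const (c := w)).congr fun x hx ↦ ?_
  exact ((frameMap_eq_on (constSection x₀ w) hx).self_of_nhds).symm.trans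
    (frameMap_constSection x₀ hx w)

/-- On a section with constant coordinates `w` the term `dσ` vanishes, so `A(v) w` is the covariant
derivative of that section read in the frame, and this is smooth. -/
lemma contDiffOn_connForm (v : EuclideanSpace ℝ (Fin n)) :
    ContDiffOn ℝ ∞ (D.connForm x₀ v) (frameDomain F E x₀) := by
  rw [contDiffOn_clm_apply]
  intro w y hy
  have hB := (trivializationAt F E x₀).open_baseSet
  have h1 := D.contMDiffAt_cov hB hy.2 (contMDiffOn_constSection (n := n) (E := E) x₀ w)
  have h2 := h1.clm_bundle_apply (contMDiffAt_coordField ((extChartAt (𝓡 n) x₀).map_target hy.1) v)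
  refine ((contDiffAt_readSection (m := ⊤) hy h2).congr_of_eventuallyEq ?_).contDiffWithinAt
  filter_upwards [(isOpen_frameDomain F E x₀).mem_nhds hy] with z hz
  have h3 := D.frameMap_cov x₀ hz (((contMDiffOn_constSection (n := n) (E := E) x₀ w).contMDiffAt
    (hB.mem_nhds hz.2)).mdifferentiableAt (by simp)) v
  have h4 : readSection (F := F) (E := E) x₀ (constSection x₀ w) =ᶠ[𝓝 z] fun _ ↦ w := by
    filter_upwards [(isOpen_frameDomain F E x₀).mem_nhds hz] with t ht
    exact frameMap_constSection x₀ ht.2 w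
  rw [h4.fderiv_eq, h4.self_of_nhds] at h3
  rw [readSection, coordField_symm hz.1, h3]
  simp

end HermitianConnection

end ConnectionForm

/-! ### The curvature in a frame: `F = dA + A ∧ A`. -/

section CurvatureForm

variable {n : ℕ} {M : Type*} [TopologicalSpace M] [T2Space M]
  [ChartedSpace (EuclideanSpace ℝ (Fin n)) M] [IsManifold (𝓡 n) ∞ M]
  {F : Type*} [NormedAddCommGroup F] [NormedSpace ℂ F] [FiniteDimensional ℂ F]
  {E : M → Type*} [TopologicalSpace (TotalSpace F E)]
  [∀ x, NormedAddCommGroup (E x)] [∀ x, InnerProductSpace ℂ (E x)]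
  [FiberBundle F E] [VectorBundle ℂ F E] [VectorBundle ℝ F E]
  [ContMDiffVectorBundle ∞ F E (𝓡 n)] [IsContMDiffRiemannianBundle (𝓡 n) ∞ F E]

namespace HermitianConnection

variable (D : HermitianConnection n F E)

lemma curvature_eq_curvatureOp {x : M} {X Y : ∀ x : M, TangentSpace (𝓡 n) x}
    (hX : MDifferentiableAt (𝓡 n) ((𝓡 n).prod (𝓡 n))
      (fun y ↦ TotalSpace.mk' (EuclideanSpace ℝ (Fin n)) y (X y)) x)
    (hY : MDifferentiableAt (𝓡 n) ((𝓡 n).prod (𝓡 n))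
      (fun y ↦ TotalSpace.mk' (EuclideanSpace ℝ (Fin n)) y (Y y)) x) (w : E x) :
    D.curvature x ![X x, Y x] w = D.curvatureOp X Y (FiberBundle.extend F w) x :=
  TensorialAt.mkHom₂_apply (fun _ hY ↦ D.curvatureOp_tensorial₁ w hY)
    (fun _ hX ↦ D.curvatureOp_tensorial₂ w hX) hX hY

/-- The curvature of `D` in the chart and the frame at `x₀`. -/
def curvForm (x₀ : M) (v w y : EuclideanSpace ℝ (Fin n)) : F →L[ℝ] F :=
  curvComp (fun v ↦ D.connForm x₀ v y) (fun v w ↦ pd id v (D.connForm x₀ w) y) v w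

variable (x₀ : M)


lemma mem_nhds_preimage_symm {x₀ : M} {u : Set M} (hu : IsOpen u) {y : EuclideanSpace ℝ (Fin n)}
    (hy : y ∈ frameDomain F E x₀) (hyu : (extChartAt (𝓡 n) x₀).symm y ∈ u) :
    ∀ᶠ z in 𝓝 y, z ∈ frameDomain F E x₀ ∧ (extChartAt (𝓡 n) x₀).symm z ∈ u := by
  have h1 := ((continuousOn_extChartAt_symm x₀).continuousAt
    ((isOpen_extChartAt_target x₀).mem_nhds hy.1)).eventually (hu.mem_nhds hyu)
  exact Filter.Eventually.and ((isOpen_frameDomain F E x₀).mem_nhds hy) h1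

variable {x₀} {y : EuclideanSpace ℝ (Fin n)} {σ : ∀ x, E x} {u : Set M}

lemma readSection_cov (hy : y ∈ frameDomain F E x₀) (hu : IsOpen u)
    (hyu : (extChartAt (𝓡 n) x₀).symm y ∈ u)
    (hσ : ContMDiffOn (𝓡 n) ((𝓡 n).prod 𝓘(ℝ, F)) ∞ (fun z ↦ TotalSpace.mk' F z (σ z)) u)
    (w : EuclideanSpace ℝ (Fin n)) :
    readSection (F := F) x₀ (fun z ↦ D.toFun σ z (coordField x₀ w z)) =ᶠ[𝓝 y]
      fun z ↦ pd id w (readSection (F := F) x₀ σ) z +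
        D.connForm x₀ w z (readSection (F := F) x₀ σ z) := by
  filter_upwards [mem_nhds_preimage_symm hu hy hyu] with z hz
  have h := D.frameMap_cov x₀ hz.1 ((hσ.contMDiffAt (hu.mem_nhds hz.2)).mdifferentiableAt
    (by simp)) w
  rw [readSection, coordField_symm hz.1.1, h]
  rfl

/-- The product rule for `(∂_v + A_v)(∂_w + A_w) s`. -/
lemma frameMap_cov_cov (hy : y ∈ frameDomain F E x₀) (hu : IsOpen u)
    (hyu : (extChartAt (𝓡 n) x₀).symm y ∈ u)
    (hσ : ContMDiffOn (𝓡 n) ((𝓡 n).prod 𝓘(ℝ, F)) ∞ (fun z ↦ TotalSpace.mk' F z (σ z)) u)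
    (v w : EuclideanSpace ℝ (Fin n)) :
    frameMap F E x₀ _ (D.toFun (fun z ↦ D.toFun σ z (coordField x₀ w z))
        ((extChartAt (𝓡 n) x₀).symm y) (coordTangent x₀ y v)) =
      pd id v (pd id w (readSection (F := F) x₀ σ)) y +
        (pd id v (D.connForm x₀ w) y (readSection (F := F) x₀ σ y) +
          D.connForm x₀ w y (pd id v (readSection (F := F) x₀ σ) y)) +
        (D.connForm x₀ v y (pd id w (readSection (F := F) x₀ σ) y) +
          (D.connForm x₀ v y * D.connForm x₀ w y) (readSection (F := F) x₀ σ y)) := by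
  have h1 : ContDiffAt ℝ 2 (readSection (F := F) x₀ σ) y :=
    contDiffAt_readSection (m := 2) hy ((hσ.contMDiffAt (hu.mem_nhds hyu)).of_le two_le_infty)
  have h2 : DifferentiableAt ℝ (D.connForm x₀ w) y :=
    ((D.contDiffOn_connForm x₀ w).contDiffAt
      ((isOpen_frameDomain F E x₀).mem_nhds hy)).differentiableAt (by simp)
  have h3 := h1.differentiableAt (by simp)
  have hc := (D.contMDiffAt_cov hu hyu hσ).clm_bundle_apply
    (contMDiffAt_coordField ((extChartAt (𝓡 n) x₀).map_target hy.1) w)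
  have h4 := D.readSection_cov hy hu hyu hσ w
  rw [D.frameMap_cov x₀ hy (hc.mdifferentiableAt (by simp)), h4.fderiv_eq, h4.self_of_nhds,
    fderiv_fun_add (differentiableAt_pd h1 w) (h2.clm_apply h3), fderiv_clm_apply h2 h3]
  simp [pd]
  abel

/-- Coordinate fields have zero bracket. In the commutator of `frameMap_cov_cov` the second
derivatives of `s` cancel by symmetry, and the terms with one derivative of `s` cancel in pairs. -/
lemma frameMap_curvature (hy : y ∈ frameDomain F E x₀)
    (v w : EuclideanSpace ℝ (Fin n)) (s : E ((extChartAt (𝓡 n) x₀).symm y)) :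
    frameMap F E x₀ _ (D.curvature _ ![coordTangent x₀ y v, coordTangent x₀ y w] s) =
      D.curvForm x₀ v w y (frameMap F E x₀ _ s) := by
  obtain ⟨t, ht, hσ⟩ := FiberBundle.exists_contMDiffOn_extend (k := ∞) (𝓡 n) F s
  obtain ⟨u, hut, hu, hyu⟩ := mem_nhds_iff.1 ht
  replace hσ := hσ.mono hut
  have hx := (extChartAt (𝓡 n) x₀).map_target hy.1
  have h := D.curvature_eq_curvatureOp (mdifferentiableAt_coordField hx v)
    (mdifferentiableAt_coordField hx w) s
  rw [coordField_symm hy.1, coordField_symm hy.1] at h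
  rw [h, curvatureOp, mlieBracket_coordField hx, map_zero, sub_zero, map_sub, coordField_symm hy.1,
    coordField_symm hy.1, D.frameMap_cov_cov hy hu hyu hσ, D.frameMap_cov_cov hy hu hyu hσ]
  have h0 : readSection (F := F) x₀ (FiberBundle.extend F s) y = frameMap F E x₀ _ s := by
    rw [readSection, FiberBundle.extend_apply_self]
  have h1 : ContDiffAt ℝ 2 (readSection (F := F) x₀ (FiberBundle.extend F s)) y :=
    contDiffAt_readSection (m := 2) hy ((hσ.contMDiffAt (hu.mem_nhds hyu)).of_le two_le_infty)
  rw [h0, pd_pd_comm h1 v w, curvForm, curvComp]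
  simp
  abel

end HermitianConnection

end CurvatureForm

/-! ### Skewness of the curvature, and the difference of two connections. -/

section Skew

variable {n : ℕ} {M : Type*} [TopologicalSpace M] [T2Space M]
  [ChartedSpace (EuclideanSpace ℝ (Fin n)) M] [IsManifold (𝓡 n) ∞ M]
  {F : Type*} [NormedAddCommGroup F] [NormedSpace ℂ F] [FiniteDimensional ℂ F]
  {E : M → Type*} [TopologicalSpace (TotalSpace F E)]
  [∀ x, NormedAddCommGroup (E x)] [∀ x, InnerProductSpace ℂ (E x)]
  [FiberBundle F E] [VectorBundle ℂ F E] [VectorBundle ℝ F E]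
  [ContMDiffVectorBundle ∞ F E (𝓡 n)] [IsContMDiffRiemannianBundle (𝓡 n) ∞ F E]

namespace HermitianConnection

variable (D D' : HermitianConnection n F E)

lemma mvfderiv_inner {x : M} {σ τ : ∀ x, E x}
    (hσ : MDifferentiableAt (𝓡 n) ((𝓡 n).prod 𝓘(ℝ, F)) (fun z ↦ TotalSpace.mk' F z (σ z)) x)
    (hτ : MDifferentiableAt (𝓡 n) ((𝓡 n).prod 𝓘(ℝ, F)) (fun z ↦ TotalSpace.mk' F z (τ z)) x)
    (X : ∀ x : M, TangentSpace (𝓡 n) x) :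
    mvfderiv (𝓡 n) (fun z ↦ (inner ℝ (σ z) (τ z) : ℝ)) x (X x) =
      inner ℝ (D.toFun σ x (X x)) (τ x) + inner ℝ (σ x) (D.toFun τ x (X x)) :=
  D.metric.mvfderiv_inner_eq X hσ hτ

/-- Differentiating `⟨σ, τ⟩` twice along coordinate fields gives two mixed terms, which together are
symmetric in `v` and `w`. Symmetry of second derivatives then leaves `⟨F σ, τ⟩ + ⟨σ, F τ⟩ = 0`. -/
lemma curvature_coordTangent_skew {x₀ : M} {y : EuclideanSpace ℝ (Fin n)}
    (hy : y ∈ (extChartAt (𝓡 n) x₀).target) (v w : EuclideanSpace ℝ (Fin n))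
    (s t : E ((extChartAt (𝓡 n) x₀).symm y)) :
    (inner ℝ (D.curvature _ ![coordTangent x₀ y v, coordTangent x₀ y w] s) t : ℝ) =
      -inner ℝ s (D.curvature _ ![coordTangent x₀ y v, coordTangent x₀ y w] t) := by
  obtain ⟨t₁, ht₁, hσ⟩ := FiberBundle.exists_contMDiffOn_extend (k := ∞) (𝓡 n) F s
  obtain ⟨t₂, ht₂, hτ⟩ := FiberBundle.exists_contMDiffOn_extend (k := ∞) (𝓡 n) F t
  obtain ⟨u, hut, hu, hyu⟩ := mem_nhds_iff.1 (Filter.inter_mem ht₁ ht₂)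
  replace hσ := hσ.mono (hut.trans inter_subset_left)
  replace hτ := hτ.mono (hut.trans inter_subset_right)
  have hx := (extChartAt (𝓡 n) x₀).map_target hy
  set σ := FiberBundle.extend F s
  set τ := FiberBundle.extend F t
  have dσ {z} (hz : z ∈ u) := (hσ.contMDiffAt (hu.mem_nhds hz)).mdifferentiableAt (by simp)
  have dτ {z} (hz : z ∈ u) := (hτ.contMDiffAt (hu.mem_nhds hz)).mdifferentiableAt (by simp)
  let h (z : M) : ℝ := inner ℝ (σ z) (τ z)
  have hh : ContMDiffOn (𝓡 n) 𝓘(ℝ, ℝ) ∞ h u := hσ.inner_bundle hτ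
  have hhψ : ContDiffAt ℝ 2 (h ∘ (extChartAt (𝓡 n) x₀).symm) y := by
    rw [← contMDiffAt_iff_contDiffAt]
    exact ((hh.contMDiffAt (hu.mem_nhds hyu)).of_le two_le_infty).comp y
      ((contMDiffOn_extChartAt_symm (n := 2) x₀).contMDiffAt
        ((isOpen_extChartAt_target x₀).mem_nhds hy))
  let G (w : EuclideanSpace ℝ (Fin n)) (z : M) : ℝ :=
    inner ℝ (D.toFun σ z (coordField x₀ w z)) (τ z) +
      inner ℝ (σ z) (D.toFun τ z (coordField x₀ w z))
  have cσ (w) := ((D.contMDiffAt_cov hu hyu hσ).clm_bundle_apply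
    (contMDiffAt_coordField hx w)).mdifferentiableAt (by simp)
  have cτ (w) := ((D.contMDiffAt_cov hu hyu hτ).clm_bundle_apply
    (contMDiffAt_coordField hx w)).mdifferentiableAt (by simp)
  have hG1 (w) : MDifferentiableAt (𝓡 n) 𝓘(ℝ, ℝ)
    (fun z ↦ (inner ℝ (D.toFun σ z (coordField x₀ w z)) (τ z) : ℝ)) _ := (cσ w).inner_bundle (dτ hyu)
  have hG2 (w) : MDifferentiableAt (𝓡 n) 𝓘(ℝ, ℝ)
    (fun z ↦ (inner ℝ (σ z) (D.toFun τ z (coordField x₀ w z)) : ℝ)) _ := (dσ hyu).inner_bundle (cτ w)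
  have hGψ (w) : G w ∘ (extChartAt (𝓡 n) x₀).symm =ᶠ[𝓝 y]
      pd id w (h ∘ (extChartAt (𝓡 n) x₀).symm) := by
    have h1 := ((continuousOn_extChartAt_symm x₀).continuousAt
      ((isOpen_extChartAt_target x₀).mem_nhds hy)).eventually (hu.mem_nhds hyu)
    filter_upwards [h1, (isOpen_extChartAt_target x₀).mem_nhds hy] with z hz hzt
    have h2 := D.mvfderiv_inner (dσ hz) (dτ hz) (coordField x₀ w)
    refine h2.symm.trans ?_
    rw [coordField_symm hzt]
    exact mvfderiv_coordTangent hzt ((hh.contMDiffAt (hu.mem_nhds hz)).mdifferentiableAt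
      (by simp)) w
  -- The four terms of the second derivative, obtained by applying metric compatibility again to
  -- each summand of `G w`.
  have key (v w) : pd id v (pd id w (h ∘ (extChartAt (𝓡 n) x₀).symm)) y =
      inner ℝ (D.toFun (fun z ↦ D.toFun σ z (coordField x₀ w z)) _ (coordField x₀ v _)) t +
      inner ℝ (D.toFun σ _ (coordField x₀ w ((extChartAt (𝓡 n) x₀).symm y)))
        (D.toFun τ _ (coordField x₀ v _)) +
      (inner ℝ (D.toFun σ _ (coordField x₀ v ((extChartAt (𝓡 n) x₀).symm y)))
        (D.toFun τ _ (coordField x₀ w _)) +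
      inner ℝ s (D.toFun (fun z ↦ D.toFun τ z (coordField x₀ w z)) _ (coordField x₀ v _))) := by
    have h1 := D.mvfderiv_inner (cσ w) (dτ hyu) (coordField x₀ v)
    have h2 := D.mvfderiv_inner (dσ hyu) (cτ w) (coordField x₀ v)
    have h3 := mvfderiv_coordTangent (g := G w) hy ((hG1 w).add (hG2 w)) v
    rw [(hGψ w).fderiv_eq] at h3
    refine h3.symm.trans ?_
    have h4 := congr($(mvfderiv_add (hG1 w) (hG2 w)) (coordTangent x₀ y v))
    refine h4.trans ?_
    rw [coordField_symm hy v] at h1 h2 ⊢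
    refine (congrArg₂ (· + ·) h1 h2).trans ?_
    simp only [σ, τ, FiberBundle.extend_apply_self]
  have hcomm := pd_pd_comm (e := id) hhψ v w
  rw [key, key] at hcomm
  have e1 := D.curvature_eq_curvatureOp (mdifferentiableAt_coordField hx v)
    (mdifferentiableAt_coordField hx w) s
  have e2 := D.curvature_eq_curvatureOp (mdifferentiableAt_coordField hx v)
    (mdifferentiableAt_coordField hx w) t
  rw [coordField_symm hy, coordField_symm hy] at e1 e2
  rw [e1, e2, curvatureOp, curvatureOp, mlieBracket_coordField hx, map_zero, map_zero, sub_zero,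
    sub_zero, inner_sub_left, inner_sub_right]
  linarith

lemma exists_coordTangent_eq {x₀ : M} {y : EuclideanSpace ℝ (Fin n)}
    (hy : y ∈ (extChartAt (𝓡 n) x₀).target)
    (u : TangentSpace (𝓡 n) ((extChartAt (𝓡 n) x₀).symm y)) : ∃ v, u = coordTangent x₀ y v := by
  refine ⟨(trivializationAt (EuclideanSpace ℝ (Fin n))
    (TangentSpace (𝓡 n)) x₀).continuousLinearMapAt ℝ _ u, ?_⟩
  rw [coordTangent_eq_symmL hy, Trivialization.symmL_continuousLinearMapAt _ (symm_mem_baseSet hy)]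

/-- The curvature of a Hermitian connection is skew-Hermitian. -/
lemma curvature_skew (x : M) (v : Fin 2 → TangentSpace (𝓡 n) x) (s t : E x) :
    (inner ℝ (D.curvature x v s) t : ℝ) = -inner ℝ s (D.curvature x v t) := by
  obtain ⟨x₀, y, hy, rfl⟩ : ∃ x₀, ∃ y ∈ (extChartAt (𝓡 n) x₀).target,
      (extChartAt (𝓡 n) x₀).symm y = x := ⟨x, _, mem_extChartAt_target x, extChartAt_to_inv x⟩
  obtain ⟨a, ha⟩ := exists_coordTangent_eq hy (v 0)
  obtain ⟨b, hb⟩ := exists_coordTangent_eq hy (v 1)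
  have hv : v = ![coordTangent x₀ y a, coordTangent x₀ y b] := by
    rw [← ha, ← hb]
    ext i
    fin_cases i <;> rfl
  rw [hv]
  exact D.curvature_coordTangent_skew hy a b s t

/-- The difference of two connections, as a one-form with values in the endomorphisms of `E`. -/
def diffForm (x : M) : TangentSpace (𝓡 n) x →ₗ[ℝ] Module.End ℝ (E x) :=
  (D'.toCovariantDerivative.difference D.toCovariantDerivative x).toLinearMap₁₂.flip

lemma frameMap_diffForm {x₀ : M} {y : EuclideanSpace ℝ (Fin n)} (hy : y ∈ frameDomain F E x₀)
    (v : EuclideanSpace ℝ (Fin n)) (s : E ((extChartAt (𝓡 n) x₀).symm y)) :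
    frameMap F E x₀ _ (diffForm D D' _ (coordTangent x₀ y v) s) =
      (D'.connForm x₀ v y - D.connForm x₀ v y) (frameMap F E x₀ _ s) := by
  have hσ := FiberBundle.mdifferentiableAt_extend (𝓡 n) F s
  have h := IsCovariantDerivativeOn.difference_apply D'.isCovariantDerivativeOnUniv
    D.isCovariantDerivativeOnUniv (mem_univ _) hσ
  rw [FiberBundle.extend_apply_self] at h
  have h2 : diffForm D D' _ (coordTangent x₀ y v) s =
      D'.toFun (FiberBundle.extend F s) _ (coordTangent x₀ y v) -
        D.toFun (FiberBundle.extend F s) _ (coordTangent x₀ y v) :=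
    congr($h (coordTangent x₀ y v))
  rw [h2, map_sub, D.frameMap_cov x₀ hy hσ, D'.frameMap_cov x₀ hy hσ, readSection,
    FiberBundle.extend_apply_self]
  simp

/-- The curvature as a bilinear map with values in the real endomorphisms. -/
def curvEnd (x : M) :
    TangentSpace (𝓡 n) x →ₗ[ℝ] TangentSpace (𝓡 n) x →ₗ[ℝ] Module.End ℝ (E x) :=
  (twoFormBilin (D.curvature x)).compr₂ (LinearMap.restrictScalarsₗ ℝ ℂ (E x) (E x) ℝ)

lemma frameMap_curvEnd {x₀ : M} {y : EuclideanSpace ℝ (Fin n)} (hy : y ∈ frameDomain F E x₀)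
    (v w : EuclideanSpace ℝ (Fin n)) (s : E ((extChartAt (𝓡 n) x₀).symm y)) :
    frameMap F E x₀ _ (curvEnd D _ (coordTangent x₀ y v) (coordTangent x₀ y w) s) =
      D.curvForm x₀ v w y (frameMap F E x₀ _ s) :=
  D.frameMap_curvature hy v w s

end HermitianConnection

end Skew

/-! ### Transfer of traces from the fibres to the model fibre. -/

section Trace

variable {F : Type*} [NormedAddCommGroup F] [NormedSpace ℝ F] [FiniteDimensional ℝ F]

variable (F) in
/-- The functional `-tr / 2` on the endomorphisms. -/
def halfTrace : (F →L[ℝ] F) →L[ℝ] ℝ :=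
  LinearMap.toContinuousLinearMap
    ((-(1 / 2 : ℝ)) • (LinearMap.trace ℝ F ∘ₗ ContinuousLinearMap.coeLM ℝ))

lemma halfTrace_apply (P : F →L[ℝ] F) :
    halfTrace F P = -(1 / 2) * LinearMap.trace ℝ F (P : F →ₗ[ℝ] F) := rfl

lemma halfTrace_mul_comm (P Q : F →L[ℝ] F) : halfTrace F (P * Q) = halfTrace F (Q * P) := by
  rw [halfTrace_apply, halfTrace_apply]
  congr 1
  exact LinearMap.trace_mul_comm ℝ (P : Module.End ℝ F) (Q : Module.End ℝ F)

/-- The trace is invariant under conjugation. This moves fibrewise traces to the fixed space `F`,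
where they can be differentiated. -/
lemma trace_eq_of_intertwine {G : Type*} [AddCommGroup G] [Module ℝ G] (L : G ≃ₗ[ℝ] F)
    (A : Module.End ℝ G) (P : F →L[ℝ] F) (h : ∀ s, L (A s) = P (L s)) :
    -(1 / 2) * LinearMap.trace ℝ G A = halfTrace F P := by
  rw [halfTrace_apply, ← LinearMap.trace_conj' A L]
  congr 2
  ext w
  simp [LinearEquiv.conj_apply, h]

end Trace

/-! ### The global transgression tensor and its local expression. -/

section TransgressionForm

variable {V G : Type*} [AddCommGroup V] [Module ℝ V] [AddCommGroup G] [Module ℝ G]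

/-- The product of a one-form with the transgression three-tensor of a one-form `a` and a two-form
`K` with values in the endomorphisms. -/
def transgressionForm (ℓ : V →ₗ[ℝ] ℝ) (a : V →ₗ[ℝ] Module.End ℝ G)
    (K : V →ₗ[ℝ] V →ₗ[ℝ] Module.End ℝ G) : MultilinearMap ℝ (fun _ : Fin 4 ↦ V) ℝ :=
  MultilinearMap.mk' (fun v ↦ ℓ (v 0) *
      ((1 / 2) * (-(1 / 2) * LinearMap.trace ℝ G (a (v 1) * K (v 2) (v 3))) -
        (1 / 3) * (-(1 / 2) * LinearMap.trace ℝ G (a (v 1) * a (v 2) * a (v 3)))))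
    (fun v i u w ↦ by
      fin_cases i <;> simp [mul_add, add_mul] <;> ring)
    (fun v i c u ↦ by
      fin_cases i <;> simp <;> ring)

end TransgressionForm

section LocalExpressions

variable {n : ℕ} {M : Type*} [TopologicalSpace M] [T2Space M]
  [ChartedSpace (EuclideanSpace ℝ (Fin n)) M] [IsManifold (𝓡 n) ∞ M]
  {F : Type*} [NormedAddCommGroup F] [NormedSpace ℂ F] [FiniteDimensional ℂ F]
  {E : M → Type*} [TopologicalSpace (TotalSpace F E)]
  [∀ x, NormedAddCommGroup (E x)] [∀ x, InnerProductSpace ℂ (E x)]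
  [FiberBundle F E] [VectorBundle ℂ F E] [VectorBundle ℝ F E]
  [ContMDiffVectorBundle ∞ F E (𝓡 n)] [IsContMDiffRiemannianBundle (𝓡 n) ∞ F E]

/-- The frame at `x₀` as a linear equivalence. -/
def frameEquiv {x₀ x : M} (hx : x ∈ (trivializationAt F E x₀).baseSet) : E x ≃ₗ[ℝ] F :=
  ((trivializationAt F E x₀).continuousLinearEquivAt ℝ x hx).toLinearEquiv

lemma frameEquiv_apply {x₀ x : M} (hx : x ∈ (trivializationAt F E x₀).baseSet) (s : E x) :
    frameEquiv hx s = frameMap F E x₀ x s :=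
  congr($(Trivialization.coe_continuousLinearEquivAt_eq (R := ℝ) (trivializationAt F E x₀) hx) s)

namespace HermitianConnection

variable (D D' : HermitianConnection n F E) {x₀ : M} {y : EuclideanSpace ℝ (Fin n)}

lemma contDiffOn_curvForm (x₀ : M) (v w : EuclideanSpace ℝ (Fin n)) :
    ContDiffOn ℝ ∞ (D.curvForm x₀ v w) (frameDomain F E x₀) := by
  have h (v w) : ContDiffOn ℝ ∞ (pd id v (D.connForm x₀ w)) (frameDomain F E x₀) :=
    ((D.contDiffOn_connForm x₀ w).fderiv_of_isOpen (isOpen_frameDomain F E x₀)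
      (by simp)).clm_apply contDiffOn_const
  exact ((h v w).sub (h w v)).add
    (((D.contDiffOn_connForm x₀ v).mul (D.contDiffOn_connForm x₀ w)).sub
      ((D.contDiffOn_connForm x₀ w).mul (D.contDiffOn_connForm x₀ v)))

lemma tracePairing_curvature (hy : y ∈ frameDomain F E x₀) (a b c d : EuclideanSpace ℝ (Fin n)) :
    tracePairing (E ((extChartAt (𝓡 n) x₀).symm y))
      (D.curvature _ ![coordTangent x₀ y a, coordTangent x₀ y b])
      (D.curvature _ ![coordTangent x₀ y c, coordTangent x₀ y d]) =
    halfTrace F (D.curvForm x₀ a b y * D.curvForm x₀ c d y) := by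
  have : FiniteDimensional ℂ (E ((extChartAt (𝓡 n) x₀).symm y)) :=
    ((trivializationAt F E x₀).continuousLinearEquivAt ℂ _ hy.2).toLinearEquiv.symm.finiteDimensional
  rw [tracePairing_eq]
  refine trace_eq_of_intertwine (frameEquiv hy.2) _ _ fun s ↦ ?_
  rw [frameEquiv_apply, frameEquiv_apply]
  refine (D.frameMap_curvature hy a b _).trans ?_
  exact congrArg _ (D.frameMap_curvature hy c d s)

/-- The sum of the curvatures of two connections. -/
def curvEndSum (x : M) :
    TangentSpace (𝓡 n) x →ₗ[ℝ] TangentSpace (𝓡 n) x →ₗ[ℝ] Module.End ℝ (E x) :=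
  curvEnd D x + curvEnd D' x

lemma trace_diffForm_mul_curvEnd (hy : y ∈ frameDomain F E x₀)
    (a b c : EuclideanSpace ℝ (Fin n)) :
    -(1 / 2) * LinearMap.trace ℝ (E ((extChartAt (𝓡 n) x₀).symm y))
      (diffForm D D' _ (coordTangent x₀ y a) *
        curvEndSum D D' _ (coordTangent x₀ y b) (coordTangent x₀ y c)) =
    halfTrace F ((D'.connForm x₀ a y - D.connForm x₀ a y) *
      (D.curvForm x₀ b c y + D'.curvForm x₀ b c y)) := by
  refine trace_eq_of_intertwine (frameEquiv hy.2) _ _ fun s ↦ ?_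
  rw [frameEquiv_apply, frameEquiv_apply]
  refine (frameMap_diffForm D D' hy a _).trans (congrArg _ ?_)
  refine (map_add (frameMap F E x₀ _) _ _).trans ?_
  exact congrArg₂ (· + ·) (frameMap_curvEnd D hy b c s) (frameMap_curvEnd D' hy b c s)

lemma trace_diffForm_cube (hy : y ∈ frameDomain F E x₀) (a b c : EuclideanSpace ℝ (Fin n)) :
    -(1 / 2) * LinearMap.trace ℝ (E ((extChartAt (𝓡 n) x₀).symm y))
      (diffForm D D' _ (coordTangent x₀ y a) * diffForm D D' _ (coordTangent x₀ y b) *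
        diffForm D D' _ (coordTangent x₀ y c)) =
    halfTrace F ((D'.connForm x₀ a y - D.connForm x₀ a y) *
      (D'.connForm x₀ b y - D.connForm x₀ b y) * (D'.connForm x₀ c y - D.connForm x₀ c y)) := by
  refine trace_eq_of_intertwine (frameEquiv hy.2) _ _ fun s ↦ ?_
  rw [frameEquiv_apply, frameEquiv_apply]
  refine (frameMap_diffForm D D' hy a _).trans (congrArg _ ?_)
  refine (frameMap_diffForm D D' hy b _).trans (congrArg _ ?_)
  exact frameMap_diffForm D D' hy c _

/-- The transgression tensor in the chart and the frame at `x₀`. -/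
def transgressionComp (x₀ : M) (a b c y : EuclideanSpace ℝ (Fin n)) : ℝ :=
  transgression (halfTrace F) (fun v ↦ D'.connForm x₀ v y - D.connForm x₀ v y)
    (fun v w ↦ D.curvForm x₀ v w y) (fun v w ↦ D'.curvForm x₀ v w y) a b c

lemma transgressionForm_coordTangent (hy : y ∈ frameDomain F E x₀)
    (ℓ : TangentSpace (𝓡 n) ((extChartAt (𝓡 n) x₀).symm y) →ₗ[ℝ] ℝ)
    (a b c d : EuclideanSpace ℝ (Fin n)) :
    transgressionForm ℓ (diffForm D D' _) (curvEndSum D D' _)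
      ![coordTangent x₀ y a, coordTangent x₀ y b, coordTangent x₀ y c, coordTangent x₀ y d] =
    ℓ (coordTangent x₀ y a) * transgressionComp D D' x₀ b c d y := by
  rw [transgressionComp, transgression, ← trace_diffForm_mul_curvEnd D D' hy,
    ← trace_diffForm_cube D D' hy]
  rfl

lemma contDiffOn_transgressionComp (x₀ : M) (a b c : EuclideanSpace ℝ (Fin n)) :
    ContDiffOn ℝ ∞ (transgressionComp D D' x₀ a b c) (frameDomain F E x₀) := by
  have h (v) := (D'.contDiffOn_connForm x₀ v).sub (D.contDiffOn_connForm x₀ v)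
  have hτ {P : EuclideanSpace ℝ (Fin n) → F →L[ℝ] F} (hP : ContDiffOn ℝ ∞ P (frameDomain F E x₀)) :
      ContDiffOn ℝ ∞ (fun y ↦ halfTrace F (P y)) (frameDomain F E x₀) :=
    (halfTrace F).contDiff.comp_contDiffOn hP
  exact (contDiffOn_const.mul (hτ ((h a).mul
      ((D.contDiffOn_curvForm x₀ b c).add (D'.contDiffOn_curvForm x₀ b c))))).sub
    (contDiffOn_const.mul (hτ (((h a).mul (h b)).mul (h c))))

end HermitianConnection

end LocalExpressions

/-! ### The local sign of the orientation in a chart. -/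

section Sign

/-- In a positively oriented orthonormal basis the volume form is the determinant, whose sign
detects the orientation of `b`. -/
lemma volumeForm_basis_eq {V : Type*} [NormedAddCommGroup V] [InnerProductSpace ℝ V] {n : ℕ}
    [Nonempty (Fin n)] [hn : Fact (Module.finrank ℝ V = n)] [Module.Finite ℝ V]
    (o : Orientation ℝ V (Fin n)) (b : Module.Basis (Fin n) ℝ V) [Decidable (b.orientation = o)] :
    o.volumeForm b = (if b.orientation = o then 1 else -1) * |o.volumeForm b| := by
  let e₀ : OrthonormalBasis (Fin n) ℝ V := (stdOrthonormalBasis ℝ V).reindex (finCongr hn.out)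
  let e := e₀.adjustToOrientation o
  have he : e.toBasis.orientation = o := e₀.orientation_adjustToOrientation o
  rw [o.volumeForm_robust e he]
  have h := e.toBasis.orientation_eq_iff_det_pos b
  rw [he, eq_comm] at h
  split_ifs with hb
  · rw [one_mul, abs_of_pos (h.1 hb)]
  · rw [abs_of_nonpos (not_lt.1 (mt h.2 hb))]
    ring

variable {n : ℕ} [Nonempty (Fin n)] {M : Type*} [TopologicalSpace M]
  [ChartedSpace (EuclideanSpace ℝ (Fin n)) M] [IsManifold (𝓡 n) ∞ M]
  [RiemannianBundle (fun x : M ↦ TangentSpace (𝓡 n) x)]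

/-- The set of points of the chart at `x₀` where the orientation of the coordinate frame agrees, up
to the sign `s`, with the orientation of the manifold. -/
def signDomain (o : ManifoldOrientation n M) (x₀ : M) (s : ℝ) : Set (EuclideanSpace ℝ (Fin n)) :=
  interior {y | ∃ hy : y ∈ (extChartAt (𝓡 n) x₀).target,
    o.volumeForm ((extChartAt (𝓡 n) x₀).symm y) (coordBasis hy) = s * chartDensity x₀ y}

lemma chartDensity_eq_abs_basis (o : ManifoldOrientation n M) {x₀ : M}
    {y : EuclideanSpace ℝ (Fin n)} (hy : y ∈ (extChartAt (𝓡 n) x₀).target) :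
    chartDensity x₀ y = |o.volumeForm ((extChartAt (𝓡 n) x₀).symm y) (coordBasis hy)| := by
  rw [chartDensity_eq_abs o]
  congr 2
  ext1 i
  exact (coordBasis_apply hy i).symm

/-- The coordinate frame is the image of the standard basis under the trivialization. Comparing its
orientation with that of `M` thus amounts to comparing the standard one with `o₀`, which does not
vary near `x₀`. -/
lemma exists_mem_signDomain (o : ManifoldOrientation n M) (x₀ : M) :
    ∃ s : ℝ, s * s = 1 ∧ extChartAt (𝓡 n) x₀ x₀ ∈ signDomain o x₀ s := by
  classical
  obtain ⟨o₀, ho⟩ := o.locallyConstant x₀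
  refine ⟨if (EuclideanSpace.basisFun (Fin n) ℝ).toBasis.orientation = o₀ then 1 else -1,
    by split_ifs <;> norm_num, mem_interior_iff_mem_nhds.2 ?_⟩
  have hcont := (continuousOn_extChartAt_symm x₀).continuousAt
    ((isOpen_extChartAt_target (I := 𝓡 n) x₀).mem_nhds (mem_extChartAt_target x₀))
  rw [ContinuousAt, extChartAt_to_inv] at hcont
  filter_upwards [hcont.eventually ho,
    (isOpen_extChartAt_target (I := 𝓡 n) x₀).mem_nhds (mem_extChartAt_target x₀)] with y hy hyt
  refine ⟨hyt, ?_⟩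
  have h1 := hy (symm_mem_baseSet hyt)
  rw [chartDensity_eq_abs_basis o hyt]
  refine (volumeForm_basis_eq (o.at' _) (coordBasis hyt)).trans ?_
  congr 2
  rw [eq_iff_iff, ← h1, coordBasis, Module.Basis.orientation_map]
  have h2 := Orientation.map_symm (Fin n) ((trivializationAt (EuclideanSpace ℝ (Fin n))
    (TangentSpace (𝓡 n)) x₀).linearEquivAt ℝ _ (symm_mem_baseSet hyt))
  exact ((congrArg (· = o.at' _) (congr($h2 _))).symm.to_iff).trans (Equiv.symm_apply_eq _)

end Sign

/-! ### Local formulas for the energy, calibration and transgression densities. -/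

section Densities

variable {k : ℕ} {M : Type*} [TopologicalSpace M] [T2Space M]
  [ChartedSpace (EuclideanSpace ℝ (Fin (k + 4))) M] [IsManifold (𝓡 (k + 4)) ∞ M]
  [RiemannianBundle (fun x : M ↦ TangentSpace (𝓡 (k + 4)) x)]
  {F : Type*} [NormedAddCommGroup F] [NormedSpace ℂ F] [FiniteDimensional ℂ F]
  {E : M → Type*} [TopologicalSpace (TotalSpace F E)]
  [∀ x, NormedAddCommGroup (E x)] [∀ x, InnerProductSpace ℂ (E x)]
  [FiberBundle F E] [VectorBundle ℂ F E] [VectorBundle ℝ F E]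
  [ContMDiffVectorBundle ∞ F E (𝓡 (k + 4))] [IsContMDiffRiemannianBundle (𝓡 (k + 4)) ∞ F E]

/-- The components of a form of degree `k` in the chart at `x₀`. -/
def DForm.comp (Φ : DForm (k + 4) M k) (x₀ : M) (y : EuclideanSpace ℝ (Fin (k + 4)))
    (t : Fin k → Fin (k + 4)) : ℝ :=
  Φ.inChart x₀ y fun j ↦ EuclideanSpace.single (t j) (1 : ℝ)

namespace HermitianConnection

variable (D D' : HermitianConnection (k + 4) F E) (o : ManifoldOrientation (k + 4) M)
  (Φ : DForm (k + 4) M k) {x₀ : M} {y : EuclideanSpace ℝ (Fin (k + 4))}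

/-- The function `q_Φ(F_A)`. -/
def calibDensity (x : M) : ℝ :=
  qForm (tracePairing (E x)) (o.volumeForm x) (Φ x).toAlternatingMap (D.curvature x)

/-- The quotient of `ℓ ∧ T ∧ Φ` by the volume form, where `T` is the transgression form, up to a
constant factor. -/
def transDensity (x : M) (ℓ : TangentSpace (𝓡 (k + 4)) x →ₗ[ℝ] ℝ) : ℝ :=
  topQuotient (MultilinearMap.alternatization (mulTensorFour
    (transgressionForm ℓ (diffForm D D' x) (curvEndSum D D' x))
    (Φ x).toAlternatingMap.toMultilinearMap)) (o.volumeForm x)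

/-- The components of the curvature in the chart and the frame at `x₀`. -/
def curvIdx (x₀ : M) (y : EuclideanSpace ℝ (Fin (k + 4))) (i j : Fin (k + 4)) : F →L[ℝ] F :=
  D.curvForm x₀ (EuclideanSpace.single i 1) (EuclideanSpace.single j 1) y

/-- The components of the transgression tensor in the chart and the frame at `x₀`. -/
def transIdx (x₀ : M) (a b c : Fin (k + 4)) (y : EuclideanSpace ℝ (Fin (k + 4))) : ℝ :=
  transgressionComp D D' x₀ (EuclideanSpace.single a 1) (EuclideanSpace.single b 1)
    (EuclideanSpace.single c 1) y

lemma comp_eq (hy : y ∈ (extChartAt (𝓡 (k + 4)) x₀).target) (t : Fin k → Fin (k + 4)) :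
    Φ.comp x₀ y t = (Φ ((extChartAt (𝓡 (k + 4)) x₀).symm y)) fun j ↦ coordBasis hy (t j) := by
  simp only [coordBasis_apply]
  rfl

lemma calibDensity_symm (hy : y ∈ frameDomain F E x₀) :
    D.calibDensity o Φ ((extChartAt (𝓡 (k + 4)) x₀).symm y) = (4 * (k.factorial : ℝ))⁻¹ *
      (altSum id (fun a b c d ↦ halfTrace F (D.curvIdx x₀ y a b * D.curvIdx x₀ y c d))
        (Φ.comp x₀ y) / o.volumeForm ((extChartAt (𝓡 (k + 4)) x₀).symm y) (coordBasis hy.1)) := by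
  rw [calibDensity, qForm_eq_altSum _ _ _ _ (coordBasis hy.1)]
  congr 2
  refine Finset.sum_congr rfl fun σ _ ↦ congrArg _ (congrArg₂ _ ?_ ?_)
  · simp only [coordBasis_apply]
    exact D.tracePairing_curvature hy _ _ _ _
  · exact (comp_eq Φ hy.1 _).symm

lemma transDensity_symm (hy : y ∈ frameDomain F E x₀)
    (ℓ : TangentSpace (𝓡 (k + 4)) ((extChartAt (𝓡 (k + 4)) x₀).symm y) →ₗ[ℝ] ℝ) :
    transDensity D D' o Φ _ ℓ =
      altSum id (fun i a b c ↦ ℓ (coordTangent x₀ y (EuclideanSpace.single i 1)) *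
        transIdx D D' x₀ a b c y)
        (Φ.comp x₀ y) / o.volumeForm ((extChartAt (𝓡 (k + 4)) x₀).symm y) (coordBasis hy.1) := by
  rw [transDensity, altSum_congr_basis _ _ _ (coordBasis hy.1)]
  congr 1
  refine Finset.sum_congr rfl fun σ _ ↦ congrArg _ (congrArg₂ _ ?_ ?_)
  · simp only [coordBasis_apply]
    exact transgressionForm_coordTangent D D' hy ℓ _ _ _ _
  · exact (comp_eq Φ hy.1 _).symm

lemma curvatureNormSq_symm (hy : y ∈ frameDomain F E x₀) :
    D.curvatureNormSq ((extChartAt (𝓡 (k + 4)) x₀).symm y) = (1 / 2) * ∑ i, ∑ j, ∑ p, ∑ q,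
      (Matrix.of fun i j ↦ inner ℝ (coordTangent x₀ y (EuclideanSpace.single i 1))
        (coordTangent x₀ y (EuclideanSpace.single j 1)))⁻¹ i j *
      ((Matrix.of fun i j ↦ inner ℝ (coordTangent x₀ y (EuclideanSpace.single i 1))
        (coordTangent x₀ y (EuclideanSpace.single j 1)))⁻¹ p q *
        halfTrace F (D.curvIdx x₀ y i p * D.curvIdx x₀ y j q)) := by
  rw [curvatureNormSq, normSqForm_eq_sum_basis _ _ (coordBasis hy.1)]
  simp only [coordBasis_apply]
  refine congrArg _ (Finset.sum_congr rfl fun i _ ↦ Finset.sum_congr rfl fun j _ ↦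
    Finset.sum_congr rfl fun p _ ↦ Finset.sum_congr rfl fun q _ ↦ ?_)
  rw [D.tracePairing_curvature hy]
  rfl

end HermitianConnection

end Densities

/-! ### Continuity of the densities. -/

section Continuity

lemma continuousOn_altSum {X ι : Type*} [TopologicalSpace X] {k : ℕ} (v : Fin (k + 4) → ι)
    {g : X → ι → ι → ι → ι → ℝ} {f : X → (Fin k → ι) → ℝ} {S : Set X}
    (hg : ∀ a b c d, ContinuousOn (fun y ↦ g y a b c d) S)
    (hf : ∀ t, ContinuousOn (fun y ↦ f y t) S) :
    ContinuousOn (fun y ↦ altSum v (g y) (f y)) S :=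
  continuousOn_finsetSum _ fun _ _ ↦ continuousOn_const.mul ((hg _ _ _ _).mul (hf _))

lemma ContinuousWithinAt.matrix_inv {X ι : Type*} [TopologicalSpace X] [Fintype ι] [DecidableEq ι]
    {G : X → Matrix ι ι ℝ} {S : Set X} {y : X} (hG : ContinuousWithinAt G S y)
    (h : (G y).det ≠ 0) : ContinuousWithinAt (fun y ↦ (G y)⁻¹) S y := by
  have hinv : ContinuousAt Ring.inverse (G y).det := by
    rw [Ring.inverse_eq_inv']
    exact continuousAt_inv₀ h
  exact (continuousAt_matrix_inv _ hinv).comp_continuousWithinAt hG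

/-- A function on a manifold is continuous if it is so in the chart at each point. -/
lemma continuous_of_chart {n : ℕ} {M X : Type*} [TopologicalSpace M]
    [ChartedSpace (EuclideanSpace ℝ (Fin n)) M] [TopologicalSpace X] {f : M → X}
    (h : ∀ x₀ : M, ContinuousAt (fun y ↦ f ((extChartAt (𝓡 n) x₀).symm y))
      (extChartAt (𝓡 n) x₀ x₀)) : Continuous f := by
  refine continuous_iff_continuousAt.2 fun x₀ ↦ ?_
  refine ((h x₀).comp (continuousAt_extChartAt x₀)).congr ?_
  filter_upwards [extChartAt_source_mem_nhds (I := 𝓡 n) x₀] with x hx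
  exact congrArg f ((extChartAt (𝓡 n) x₀).left_inv hx)

variable {k : ℕ} {M : Type*} [TopologicalSpace M] [T2Space M]
  [ChartedSpace (EuclideanSpace ℝ (Fin (k + 4))) M] [IsManifold (𝓡 (k + 4)) ∞ M]
  [RiemannianBundle (fun x : M ↦ TangentSpace (𝓡 (k + 4)) x)]
  [IsContMDiffRiemannianBundle (𝓡 (k + 4)) ∞ (EuclideanSpace ℝ (Fin (k + 4)))
      (fun x : M ↦ TangentSpace (𝓡 (k + 4)) x)]
  {F : Type*} [NormedAddCommGroup F] [NormedSpace ℂ F] [FiniteDimensional ℂ F]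
  {E : M → Type*} [TopologicalSpace (TotalSpace F E)]
  [∀ x, NormedAddCommGroup (E x)] [∀ x, InnerProductSpace ℂ (E x)]
  [FiberBundle F E] [VectorBundle ℂ F E] [VectorBundle ℝ F E]
  [ContMDiffVectorBundle ∞ F E (𝓡 (k + 4))] [IsContMDiffRiemannianBundle (𝓡 (k + 4)) ∞ F E]

variable (F E) in
/-- A domain in the chart at `x₀` where `E` is trivialized and the orientation of the coordinate
frame is, up to the sign `s`, that of the manifold. -/
def localDomain (o : ManifoldOrientation (k + 4) M) (x₀ : M) (s : ℝ) :
    Set (EuclideanSpace ℝ (Fin (k + 4))) :=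
  frameDomain F E x₀ ∩ signDomain o x₀ s

lemma isOpen_localDomain (o : ManifoldOrientation (k + 4) M) (x₀ : M) (s : ℝ) :
    IsOpen (localDomain F E o x₀ s) :=
  (isOpen_frameDomain F E x₀).inter isOpen_interior

variable {o : ManifoldOrientation (k + 4) M} {x₀ : M} {s : ℝ}
  {y : EuclideanSpace ℝ (Fin (k + 4))}

lemma volumeForm_coordBasis (hy : y ∈ localDomain F E o x₀ s) :
    o.volumeForm ((extChartAt (𝓡 (k + 4)) x₀).symm y) (coordBasis hy.1.1) =
      s * chartDensity x₀ y :=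
  (interior_subset hy.2).choose_spec

lemma continuousOn_comp {Φ : DForm (k + 4) M k} (hΦ : Φ.IsSmooth) (x₀ : M)
    (t : Fin k → Fin (k + 4)) :
    ContinuousOn (fun y ↦ Φ.comp x₀ y t) (extChartAt (𝓡 (k + 4)) x₀).target :=
  ((ContinuousAlternatingMap.apply ℝ _ ℝ
    (fun j ↦ EuclideanSpace.single (t j) (1 : ℝ))).contDiff.comp_contDiffOn (hΦ x₀)).continuousOn

lemma continuousOn_gram_inv (o : ManifoldOrientation (k + 4) M) (x₀ : M) (i j : Fin (k + 4)) :
    ContinuousOn (fun y ↦ (Matrix.of fun i j : Fin (k + 4) ↦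
      inner ℝ (coordTangent x₀ y (EuclideanSpace.single i 1))
        (coordTangent x₀ y (EuclideanSpace.single j 1)))⁻¹ i j)
      (extChartAt (𝓡 (k + 4)) x₀).target := by
  intro y hy
  have hG : ContinuousWithinAt (fun y ↦ (Matrix.of fun i j : Fin (k + 4) ↦
      (inner ℝ (coordTangent x₀ y (EuclideanSpace.single i 1))
        (coordTangent x₀ y (EuclideanSpace.single j 1)) : ℝ)))
      (extChartAt (𝓡 (k + 4)) x₀).target y := by
    refine continuousWithinAt_pi.2 fun i ↦ continuousWithinAt_pi.2 fun j ↦ ?_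
    exact (contDiffOn_gram x₀ _ _).continuousOn y hy
  have hdet := Real.sqrt_pos.1 (chartDensity_pos o hy)
  have h := ContinuousWithinAt.matrix_inv hG hdet.ne'
  exact continuousWithinAt_pi.1 (continuousWithinAt_pi.1 h i) j

namespace HermitianConnection

variable (D D' : HermitianConnection (k + 4) F E) {Φ : DForm (k + 4) M k}

/-- On the coordinate frame the volume form is `s` times the density, and `1 / s = s`. The weight in
the chart integral thus cancels the division by the volume form. -/
lemma calibDensity_symm_eq (hs : s * s = 1) (hy : y ∈ localDomain F E o x₀ s) :
    chartDensity x₀ y * D.calibDensity o Φ ((extChartAt (𝓡 (k + 4)) x₀).symm y) =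
      s * (4 * (k.factorial : ℝ))⁻¹ *
      altSum id (fun a b c d ↦ halfTrace F (D.curvIdx x₀ y a b * D.curvIdx x₀ y c d))
        (Φ.comp x₀ y) := by
  have h0 := (chartDensity_pos o hy.1.1).ne'
  have hs0 : s ≠ 0 := by rintro rfl; simp at hs
  rw [D.calibDensity_symm o Φ hy.1, volumeForm_coordBasis hy]
  field_simp
  linear_combination -(altSum id (fun a b c d ↦ halfTrace F
    (D.curvIdx x₀ y a b * D.curvIdx x₀ y c d)) (Φ.comp x₀ y)) * hs

lemma transDensity_symm_eq (hs : s * s = 1) (hy : y ∈ localDomain F E o x₀ s)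
    (ℓ : TangentSpace (𝓡 (k + 4)) ((extChartAt (𝓡 (k + 4)) x₀).symm y) →ₗ[ℝ] ℝ) :
    chartDensity x₀ y * transDensity D D' o Φ _ ℓ =
      s * altSum id (fun i a b c ↦ ℓ (coordTangent x₀ y (EuclideanSpace.single i 1)) *
        transIdx D D' x₀ a b c y) (Φ.comp x₀ y) := by
  have h0 := (chartDensity_pos o hy.1.1).ne'
  have hs0 : s ≠ 0 := by rintro rfl; simp at hs
  rw [transDensity_symm D D' o Φ hy.1, volumeForm_coordBasis hy]
  field_simp
  linear_combination -(altSum id (fun i a b c ↦ ℓ (coordTangent x₀ y (EuclideanSpace.single i 1)) *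
        transIdx D D' x₀ a b c y) (Φ.comp x₀ y)) * hs

lemma continuousOn_halfTrace_curvIdx (x₀ : M) (a b c d : Fin (k + 4)) :
    ContinuousOn (fun y ↦ halfTrace F (D.curvIdx x₀ y a b * D.curvIdx x₀ y c d))
      (frameDomain F E x₀) :=
  (halfTrace F).continuous.comp_continuousOn
    ((D.contDiffOn_curvForm x₀ _ _).continuousOn.mul (D.contDiffOn_curvForm x₀ _ _).continuousOn)

/-- The density is continuous and positive, so it can be divided out near the centre of each chart.
-/
lemma continuous_of_mul_chartDensity {f : M → ℝ} (o : ManifoldOrientation (k + 4) M)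
    (h : ∀ x₀ s, s * s = 1 → ContinuousOn (fun y ↦ chartDensity x₀ y *
      f ((extChartAt (𝓡 (k + 4)) x₀).symm y)) (localDomain F E o x₀ s)) : Continuous f := by
  refine continuous_of_chart (n := k + 4) fun x₀ ↦ ?_
  obtain ⟨s, hs, hx⟩ := exists_mem_signDomain o x₀
  have hΩ : localDomain F E o x₀ s ∈ 𝓝 (extChartAt (𝓡 (k + 4)) x₀ x₀) :=
    (isOpen_localDomain o x₀ s).mem_nhds ⟨mem_frameDomain F E x₀, hx⟩
  have hd : ContinuousAt (chartDensity x₀) (extChartAt (𝓡 (k + 4)) x₀ x₀) :=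
    (continuousOn_chartDensity x₀).continuousAt
      ((isOpen_extChartAt_target x₀).mem_nhds (mem_extChartAt_target x₀))
  refine (((hd.inv₀ (chartDensity_pos o (mem_extChartAt_target x₀)).ne').mul
    ((h x₀ s hs).continuousAt hΩ))).congr ?_
  filter_upwards [hΩ] with y hy
  exact inv_mul_cancel_left₀ (chartDensity_pos o hy.1.1).ne' _

lemma continuous_calibDensity (hΦ : Φ.IsSmooth) : Continuous (D.calibDensity o Φ) := by
  refine continuous_of_mul_chartDensity (F := F) (E := E) o fun x₀ s hs ↦ ?_
  refine ContinuousOn.congr ?_ fun y hy ↦ D.calibDensity_symm_eq hs hy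
  refine continuousOn_const.mul (continuousOn_altSum _ (fun a b c d ↦ ?_) fun t ↦ ?_)
  · exact (D.continuousOn_halfTrace_curvIdx x₀ a b c d).mono inter_subset_left
  · exact (continuousOn_comp hΦ x₀ t).mono fun y hy ↦ hy.1.1

lemma continuous_curvatureNormSq (o : ManifoldOrientation (k + 4) M) :
    Continuous D.curvatureNormSq := by
  refine continuous_of_chart (n := k + 4) fun x₀ ↦ ContinuousOn.continuousAt (s := frameDomain F E x₀) ?_
    ((isOpen_frameDomain F E x₀).mem_nhds (mem_frameDomain F E x₀))
  refine ContinuousOn.congr ?_ fun y hy ↦ D.curvatureNormSq_symm hy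
  have hG (i j) := (continuousOn_gram_inv o x₀ i j).mono
    (inter_subset_left : frameDomain F E x₀ ⊆ _)
  exact continuousOn_const.mul (continuousOn_finsetSum _ fun i _ ↦ continuousOn_finsetSum _
    fun j _ ↦ continuousOn_finsetSum _ fun p _ ↦ continuousOn_finsetSum _ fun q _ ↦
    (hG i j).mul ((hG p q).mul (D.continuousOn_halfTrace_curvIdx x₀ i p j q)))

lemma transDensity_mvfderiv_symm_eq (hs : s * s = 1) (hy : y ∈ localDomain F E o x₀ s)
    {ρ : M → ℝ} (hρ : ContMDiff (𝓡 (k + 4)) 𝓘(ℝ, ℝ) ∞ ρ) :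
    chartDensity x₀ y * transDensity D D' o Φ ((extChartAt (𝓡 (k + 4)) x₀).symm y)
        (mvfderiv (𝓡 (k + 4)) ρ ((extChartAt (𝓡 (k + 4)) x₀).symm y)).toLinearMap =
      s * altSum id (fun i a b c ↦
        pd (fun i ↦ EuclideanSpace.single i 1) i (ρ ∘ (extChartAt (𝓡 (k + 4)) x₀).symm) y *
          transIdx D D' x₀ a b c y) (Φ.comp x₀ y) := by
  rw [transDensity_symm_eq D D' hs hy]
  have h (i : Fin (k + 4)) := mvfderiv_coordTangent hy.1.1
    (hρ.mdifferentiableAt (by simp)) (EuclideanSpace.single i (1 : ℝ))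
  refine congrArg _ (Finset.sum_congr rfl fun σ _ ↦ congrArg _ (congrArg₂ _ ?_ rfl))
  exact congrArg₂ _ (h _) rfl

lemma continuous_transDensity (hΦ : Φ.IsSmooth) {ρ : M → ℝ}
    (hρ : ContMDiff (𝓡 (k + 4)) 𝓘(ℝ, ℝ) ∞ ρ) :
    Continuous fun x ↦ transDensity D D' o Φ x (mvfderiv (𝓡 (k + 4)) ρ x).toLinearMap := by
  refine continuous_of_mul_chartDensity (F := F) (E := E) o fun x₀ s hs ↦ ?_
  refine ContinuousOn.congr ?_ fun y hy ↦ transDensity_mvfderiv_symm_eq D D' hs hy hρ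
  refine continuousOn_const.mul (continuousOn_altSum _ (fun i a b c ↦ ?_) fun t ↦ ?_)
  · refine ContinuousOn.mul ?_ ((contDiffOn_transgressionComp D D' x₀ _ _ _).continuousOn.mono
      inter_subset_left)
    have h1 : ContDiffOn ℝ ∞ (ρ ∘ (extChartAt (𝓡 (k + 4)) x₀).symm)
        (extChartAt (𝓡 (k + 4)) x₀).target :=
      contMDiffOn_iff_contDiffOn.1 (hρ.comp_contMDiffOn (contMDiffOn_extChartAt_symm x₀))
    have h2 := ((h1.fderiv_of_isOpen (m := ∞) (isOpen_extChartAt_target x₀)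
      (by simp)).clm_apply (contDiffOn_const (c := EuclideanSpace.single i (1 : ℝ)))).continuousOn
    exact h2.mono fun y hy ↦ hy.1.1
  · exact (continuousOn_comp hΦ x₀ t).mono fun y hy ↦ hy.1.1

end HermitianConnection

end Continuity

/-! ### Integration by parts on the manifold for a cut-off in one chart. -/

section Localization

variable {k : ℕ} {M : Type*} [TopologicalSpace M] [T2Space M]
  [ChartedSpace (EuclideanSpace ℝ (Fin (k + 4))) M] [IsManifold (𝓡 (k + 4)) ∞ M]

/-- A function on a manifold read in the chart at `x₀`, extended by zero. -/
def chartExtend (x₀ : M) (ρ : M → ℝ) : EuclideanSpace ℝ (Fin (k + 4)) → ℝ :=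
  (extChartAt (𝓡 (k + 4)) x₀).target.indicator (ρ ∘ (extChartAt (𝓡 (k + 4)) x₀).symm)

variable {x₀ : M} {ρ : M → ℝ} {y : EuclideanSpace ℝ (Fin (k + 4))}

lemma chartExtend_eq (hy : y ∈ (extChartAt (𝓡 (k + 4)) x₀).target) :
    chartExtend x₀ ρ y = ρ ((extChartAt (𝓡 (k + 4)) x₀).symm y) :=
  indicator_of_mem hy _

lemma chartExtend_eventuallyEq (hy : y ∈ (extChartAt (𝓡 (k + 4)) x₀).target) :
    chartExtend x₀ ρ =ᶠ[𝓝 y] ρ ∘ (extChartAt (𝓡 (k + 4)) x₀).symm := by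
  filter_upwards [(isOpen_extChartAt_target x₀).mem_nhds hy] with z hz using chartExtend_eq hz

variable {Ω : Set (EuclideanSpace ℝ (Fin (k + 4)))}

/-- The image of the compact support is compact, hence closed. The extension by zero therefore
vanishes near the boundary of the chart domain and stays smooth. -/
lemma tsupport_chartExtend [CompactSpace M]
    (hsupp : tsupport ρ ⊆ (extChartAt (𝓡 (k + 4)) x₀).source) :
    tsupport (chartExtend x₀ ρ) ⊆ extChartAt (𝓡 (k + 4)) x₀ '' tsupport ρ := by
  have hK : IsCompact (extChartAt (𝓡 (k + 4)) x₀ '' tsupport ρ) :=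
    (isClosed_tsupport ρ).isCompact.image_of_continuousOn
      ((continuousOn_extChartAt x₀).mono hsupp)
  refine closure_minimal (fun y hy ↦ ?_) hK.isClosed
  have hyt : y ∈ (extChartAt (𝓡 (k + 4)) x₀).target := by
    by_contra h
    exact hy (indicator_of_notMem h _)
  refine ⟨(extChartAt (𝓡 (k + 4)) x₀).symm y, subset_tsupport ρ ?_,
    (extChartAt (𝓡 (k + 4)) x₀).right_inv hyt⟩
  rwa [Function.mem_support, chartExtend_eq hyt] at hy

lemma hasCompactSupport_chartExtend [CompactSpace M]
    (hsupp : tsupport ρ ⊆ (extChartAt (𝓡 (k + 4)) x₀).source) :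
    HasCompactSupport (chartExtend (k := k) x₀ ρ) :=
  ((isClosed_tsupport ρ).isCompact.image_of_continuousOn
      ((continuousOn_extChartAt x₀).mono hsupp)).of_isClosed_subset (isClosed_tsupport _)
    (tsupport_chartExtend hsupp)

lemma contDiff_chartExtend [CompactSpace M] (hρ : ContMDiff (𝓡 (k + 4)) 𝓘(ℝ, ℝ) ∞ ρ)
    (hsupp : tsupport ρ ⊆ (extChartAt (𝓡 (k + 4)) x₀).source) :
    ContDiff ℝ ∞ (chartExtend (k := k) x₀ ρ) := by
  refine contDiff_iff_contDiffAt.2 fun y ↦ ?_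
  by_cases hy : y ∈ tsupport (chartExtend x₀ ρ)
  swap
  · exact contDiffAt_const.congr_of_eventuallyEq (notMem_tsupport_iff_eventuallyEq.1 hy)
  obtain ⟨x, hx, rfl⟩ := tsupport_chartExtend hsupp hy
  have hyt := (extChartAt (𝓡 (k + 4)) x₀).map_source (hsupp hx)
  have h1 : ContDiffOn ℝ ∞ (ρ ∘ (extChartAt (𝓡 (k + 4)) x₀).symm)
      (extChartAt (𝓡 (k + 4)) x₀).target :=
    contMDiffOn_iff_contDiffOn.1 (hρ.comp_contMDiffOn (contMDiffOn_extChartAt_symm x₀))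
  exact (h1.contDiffAt ((isOpen_extChartAt_target x₀).mem_nhds hyt)).congr_of_eventuallyEq
    (chartExtend_eventuallyEq hyt)

lemma mvfderiv_eq_zero_of_notMem_tsupport {x : M} (hx : x ∉ tsupport ρ) :
    mvfderiv (𝓡 (k + 4)) ρ x = 0 := by
  have h : ρ =ᶠ[𝓝 x] fun _ ↦ 0 := notMem_tsupport_iff_eventuallyEq.1 hx
  ext v
  rw [mvfderiv, h.mfderiv_eq, mfderiv_const]
  exact (NormedSpace.fromTangentSpace (𝕜 := ℝ) (ρ x)).map_zero

variable [CompactSpace M] [MeasurableSpace M] [BorelSpace M]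
  [RiemannianBundle (fun x : M ↦ TangentSpace (𝓡 (k + 4)) x)]
  [IsContMDiffRiemannianBundle (𝓡 (k + 4)) ∞ (EuclideanSpace ℝ (Fin (k + 4)))
      (fun x : M ↦ TangentSpace (𝓡 (k + 4)) x)]
  {F : Type*} [NormedAddCommGroup F] [NormedSpace ℂ F] [FiniteDimensional ℂ F]
  {E : M → Type*} [TopologicalSpace (TotalSpace F E)]
  [∀ x, NormedAddCommGroup (E x)] [∀ x, InnerProductSpace ℂ (E x)]
  [FiberBundle F E] [VectorBundle ℂ F E] [VectorBundle ℝ F E]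
  [ContMDiffVectorBundle ∞ F E (𝓡 (k + 4))] [IsContMDiffRiemannianBundle (𝓡 (k + 4)) ∞ F E]

namespace HermitianConnection

variable (D D' : HermitianConnection (k + 4) F E) {o : ManifoldOrientation (k + 4) M}
  {Φ : DForm (k + 4) M k} {s : ℝ}

/-- Additivity in the covector lets the contributions `dρ_j ∧ T ∧ Φ` of a partition of unity be
added pointwise. -/
lemma transDensity_sum (o : ManifoldOrientation (k + 4) M) (Φ : DForm (k + 4) M k) {κ : Type*}
    [Fintype κ] (x : M) (ℓ : κ → TangentSpace (𝓡 (k + 4)) x →ₗ[ℝ] ℝ) :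
    transDensity D D' o Φ x (∑ j, ℓ j) = ∑ j, transDensity D D' o Φ x (ℓ j) := by
  simp only [transDensity, topQuotient, alternatization_mulTensorFour]
  rw [← Finset.sum_div]
  congr 1
  have h := altSum_sum (Module.finBasisOfFinrankEq ℝ (TangentSpace (𝓡 (k + 4)) x) Fact.out)
    (fun j a b c d ↦ transgressionForm (ℓ j) (diffForm D D' x) (curvEndSum D D' x) ![a, b, c, d])
    (Φ x).toAlternatingMap.toMultilinearMap 1
  simp only [one_mul] at h
  refine Eq.trans (Finset.sum_congr rfl fun σ _ ↦ congrArg _ (congrArg₂ _ ?_ rfl)) h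
  exact (congrArg (· * _) (LinearMap.sum_apply _ _ _)).trans (Finset.sum_mul _ _ _)

lemma transDensity_zero (o : ManifoldOrientation (k + 4) M) (Φ : DForm (k + 4) M k) (x : M) :
    transDensity D D' o Φ x 0 = 0 := by
  -- The zero covector is the empty sum.
  simpa using transDensity_sum D D' o Φ (κ := Empty) x Empty.elim

lemma altSum_pd_transIdx (x₀ : M) (hy : y ∈ frameDomain F E x₀) (f : (Fin k → Fin (k + 4)) → ℝ) :
    altSum id (fun i a b c ↦ pd (fun i ↦ EuclideanSpace.single i (1 : ℝ)) i
      (transIdx D D' x₀ a b c) y) f = (1 / 4) *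
      (altSum id (fun a b c d ↦ halfTrace F (D'.curvIdx x₀ y a b * D'.curvIdx x₀ y c d)) f -
        altSum id (fun a b c d ↦ halfTrace F (D.curvIdx x₀ y a b * D.curvIdx x₀ y c d)) f) := by
  have hA (D : HermitianConnection (k + 4) F E) (i : Fin (k + 4)) :
      ContDiffAt ℝ 2 (D.connForm x₀ (EuclideanSpace.single i 1)) y :=
    ((D.contDiffOn_connForm x₀ _).contDiffAt ((isOpen_frameDomain F E x₀).mem_nhds hy)).of_le
      two_le_infty
  exact altSum_pd_transgression (e := fun i ↦ EuclideanSpace.single i (1 : ℝ)) id f (halfTrace F)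
    halfTrace_mul_comm _ _ (hA D) (hA D')

/-- The Chern–Weil forms of two connections differ, locally, by the differential of the
transgression form. -/
lemma integral_mul_calibDensity_sub (hΦ : Φ.IsSmooth) (hd : Φ.IsClosed) (hs : s * s = 1)
    (hρ : ContMDiff (𝓡 (k + 4)) 𝓘(ℝ, ℝ) ∞ ρ)
    (hsupp : tsupport ρ ⊆ (extChartAt (𝓡 (k + 4)) x₀).source)
    (hsupp' : tsupport ρ ⊆ extChartAt (𝓡 (k + 4)) x₀ ⁻¹' localDomain F E o x₀ s) :
    ∫ x, ρ x * (D'.calibDensity o Φ x - D.calibDensity o Φ x) ∂(riemannianVolume (k + 4) M) =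
      -(k.factorial : ℝ)⁻¹ * ∫ x, transDensity D D' o Φ x (mvfderiv (𝓡 (k + 4)) ρ x).toLinearMap
        ∂(riemannianVolume (k + 4) M) := by
  set e : Fin (k + 4) → EuclideanSpace ℝ (Fin (k + 4)) := fun i ↦ EuclideanSpace.single i 1 with he
  set T := (extChartAt (𝓡 (k + 4)) x₀).target with hT
  have hT0 {y} (hy : y ∉ T) : chartExtend x₀ ρ y = 0 := indicator_of_notMem hy _
  have hsuppΩ : tsupport (chartExtend x₀ ρ) ⊆ localDomain F E o x₀ s :=
    (tsupport_chartExtend hsupp).trans (image_subset_iff.2 hsupp')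
  have hoff {y} (hyT : y ∈ T) (hy : y ∉ localDomain F E o x₀ s) :
      (extChartAt (𝓡 (k + 4)) x₀).symm y ∉ tsupport ρ := fun h ↦ hy <| by
    have := hsupp' h
    rwa [mem_preimage, (extChartAt (𝓡 (k + 4)) x₀).right_inv hyT] at this
  -- The factor `1/4` of the transgression formula is that of `(4 k!)⁻¹` in `q_Φ`, so only `1 / k!`
  -- survives. Outside the local domain both sides vanish with `ρ`.
  have h1 : ∫ x, ρ x * (D'.calibDensity o Φ x - D.calibDensity o Φ x)
      ∂(riemannianVolume (k + 4) M) = ∫ y, s * (k.factorial : ℝ)⁻¹ * (chartExtend x₀ ρ y *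
        altSum id (fun i a b c ↦ pd e i (transIdx D D' x₀ a b c) y) (Φ.comp x₀ y)) := by
    have hc : Continuous fun x ↦ ρ x * (D'.calibDensity o Φ x - D.calibDensity o Φ x) :=
      hρ.continuous.mul ((D'.continuous_calibDensity hΦ).sub (D.continuous_calibDensity hΦ))
    refine (integral_riemannianVolume_eq o x₀ hc fun x hx ↦ ?_).trans (Eq.trans ?_
      (setIntegral_eq_integral_of_forall_compl_eq_zero (s := T) fun y hy ↦ ?_))
    · rw [image_eq_zero_of_notMem_tsupport fun h ↦ hx (hsupp h), zero_mul]
    swap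
    · rw [hT0 hy, zero_mul, mul_zero]
    refine setIntegral_congr_fun (isOpen_extChartAt_target x₀).measurableSet fun y hy ↦ ?_
    rw [chartExtend_eq hy]
    by_cases hyΩ : y ∈ localDomain F E o x₀ s
    · rw [altSum_pd_transIdx D D' x₀ hyΩ.1]
      have ha := D.calibDensity_symm_eq (Φ := Φ) hs hyΩ
      have hb := D'.calibDensity_symm_eq (Φ := Φ) hs hyΩ
      rw [mul_inv] at ha hb
      linear_combination ρ ((extChartAt (𝓡 (k + 4)) x₀).symm y) * (hb - ha)
    · rw [image_eq_zero_of_notMem_tsupport (hoff hy hyΩ)]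
      ring
  have h2 : ∫ x, transDensity D D' o Φ x (mvfderiv (𝓡 (k + 4)) ρ x).toLinearMap
      ∂(riemannianVolume (k + 4) M) = ∫ y, s * altSum id (fun i a b c ↦
        pd e i (chartExtend x₀ ρ) y * transIdx D D' x₀ a b c y) (Φ.comp x₀ y) := by
    have hz {y} (hy : y ∉ tsupport (chartExtend x₀ ρ)) : altSum id (fun i a b c ↦
        pd e i (chartExtend x₀ ρ) y * transIdx D D' x₀ a b c y) (Φ.comp x₀ y) = 0 :=
      Finset.sum_eq_zero fun σ _ ↦ by
        simp only [pd_eq_zero_of_notMem_tsupport hy, zero_mul, mul_zero]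
    refine (integral_riemannianVolume_eq o x₀ (continuous_transDensity D D' hΦ hρ)
      fun x hx ↦ ?_).trans (Eq.trans ?_
      (setIntegral_eq_integral_of_forall_compl_eq_zero (s := T) fun y hy ↦ ?_))
    · rw [mvfderiv_eq_zero_of_notMem_tsupport fun h ↦ hx (hsupp h)]
      exact transDensity_zero D D' o Φ x
    swap
    · rw [hz fun h ↦ hy (hsuppΩ h).1.1, mul_zero]
    refine setIntegral_congr_fun (isOpen_extChartAt_target x₀).measurableSet fun y hy ↦ ?_
    by_cases hyΩ : y ∈ localDomain F E o x₀ s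
    · refine (transDensity_mvfderiv_symm_eq D D' hs hyΩ hρ).trans (congrArg _ ?_)
      refine Finset.sum_congr rfl fun σ _ ↦ congrArg _ (congrArg₂ _ (congrArg₂ _ ?_ rfl) rfl)
      exact congr($((chartExtend_eventuallyEq hy).fderiv_eq.symm) _)
    · rw [hz fun h ↦ hyΩ (hsuppΩ h), mvfderiv_eq_zero_of_notMem_tsupport (hoff hy hyΩ), mul_zero]
      exact (congrArg _ (transDensity_zero D D' o Φ _)).trans (mul_zero _)
  -- The only use of `dΦ = 0`: no term arises from differentiating `Φ`.
  have h3 : ∫ y, chartExtend x₀ ρ y *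
        altSum id (fun i a b c ↦ pd e i (transIdx D D' x₀ a b c) y) (Φ.comp x₀ y) =
      -∫ y, altSum id (fun i a b c ↦
        pd e i (chartExtend x₀ ρ) y * transIdx D D' x₀ a b c y) (Φ.comp x₀ y) :=
    integral_altSum_pd volume id e (isOpen_localDomain o x₀ s)
    ((contDiff_chartExtend hρ hsupp).of_le (by simp)) (hasCompactSupport_chartExtend hsupp) hsuppΩ
    (T := transIdx D D' x₀)
    (fun a b c ↦ ((contDiffOn_transgressionComp D D' x₀ _ _ _).mono inter_subset_left).of_le
      (by simp))
    (((hΦ x₀).mono fun y hy ↦ hy.1.1).of_le (by simp)) fun y hy ↦ hd x₀ y hy.1.1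
  rw [h1, h2, integral_const_mul, integral_const_mul]
  linear_combination s * (k.factorial : ℝ)⁻¹ * h3

end HermitianConnection

end Localization

/-! ### Globalization by a partition of unity and the calibration argument. -/

section Global

lemma mvfderiv_finset_sum {n : ℕ} {M κ : Type*} [TopologicalSpace M]
    [ChartedSpace (EuclideanSpace ℝ (Fin n)) M] {ρ : κ → M → ℝ} {x : M}
    (hρ : ∀ j, MDifferentiableAt (𝓡 n) 𝓘(ℝ, ℝ) (ρ j) x) (t : Finset κ) :
    MDifferentiableAt (𝓡 n) 𝓘(ℝ, ℝ) (∑ j ∈ t, ρ j) x ∧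
      mvfderiv (𝓡 n) (∑ j ∈ t, ρ j) x = ∑ j ∈ t, mvfderiv (𝓡 n) (ρ j) x := by
  classical
  induction t using Finset.induction_on with
  | empty => exact ⟨mdifferentiableAt_const, mvfderiv_zero⟩
  | insert a t ha ih =>
    rw [Finset.sum_insert ha, Finset.sum_insert ha, ← ih.2]
    exact ⟨(hρ a).add ih.1, mvfderiv_add (hρ a) ih.1⟩

variable {k : ℕ} {M : Type*} [TopologicalSpace M] [T2Space M] [CompactSpace M]
  [ChartedSpace (EuclideanSpace ℝ (Fin (k + 4))) M] [IsManifold (𝓡 (k + 4)) ∞ M]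
  [MeasurableSpace M] [BorelSpace M]
  [RiemannianBundle (fun x : M ↦ TangentSpace (𝓡 (k + 4)) x)]
  [IsContMDiffRiemannianBundle (𝓡 (k + 4)) ∞ (EuclideanSpace ℝ (Fin (k + 4)))
      (fun x : M ↦ TangentSpace (𝓡 (k + 4)) x)]
  {F : Type*} [NormedAddCommGroup F] [NormedSpace ℂ F] [FiniteDimensional ℂ F]
  {E : M → Type*} [TopologicalSpace (TotalSpace F E)]
  [∀ x, NormedAddCommGroup (E x)] [∀ x, InnerProductSpace ℂ (E x)]
  [FiberBundle F E] [VectorBundle ℂ F E] [VectorBundle ℝ F E]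
  [ContMDiffVectorBundle ∞ F E (𝓡 (k + 4))] [IsContMDiffRiemannianBundle (𝓡 (k + 4)) ∞ F E]

lemma integrable_riemannianVolume (o : ManifoldOrientation (k + 4) M) {f : M → ℝ}
    (hf : Continuous f) : Integrable f (riemannianVolume (k + 4) M) := by
  have := isFiniteMeasure_riemannianVolume o
  exact hf.integrable_of_hasCompactSupport (HasCompactSupport.of_compactSpace f)

namespace HermitianConnection

variable (D D' : HermitianConnection (k + 4) F E) {o : ManifoldOrientation (k + 4) M}
  {Φ : DForm (k + 4) M k}

/-- The integral of `q_Φ(F_A)` does not depend on the connection. -/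
lemma integral_calibDensity_eq (hΦ : Φ.IsSmooth) (hd : Φ.IsClosed) :
    ∫ x, D'.calibDensity o Φ x ∂(riemannianVolume (k + 4) M) =
      ∫ x, D.calibDensity o Φ x ∂(riemannianVolume (k + 4) M) := by
  choose s hs hx using exists_mem_signDomain (n := k + 4) o
  let N (x₀ : M) : Set M := (extChartAt (𝓡 (k + 4)) x₀).source ∩
    extChartAt (𝓡 (k + 4)) x₀ ⁻¹' localDomain F E o x₀ (s x₀)
  have hN (x₀) : IsOpen (N x₀) := (continuousOn_extChartAt x₀).isOpen_inter_preimage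
    (isOpen_extChartAt_source x₀) (isOpen_localDomain o x₀ (s x₀))
  obtain ⟨t, -, ht⟩ := isCompact_univ.elim_nhds_subcover N fun x₀ _ ↦
    (hN x₀).mem_nhds ⟨mem_extChartAt_source x₀, mem_frameDomain F E x₀, hx x₀⟩
  obtain ⟨ρ, hρN⟩ := SmoothPartitionOfUnity.exists_isSubordinate (𝓡 (k + 4)) isClosed_univ
    (fun j : t ↦ N j) (fun j ↦ hN j) fun x hx ↦ by simpa using ht hx
  have hρ1 (x : M) : ∑ j, ρ j x = 1 := by
    rw [← finsum_eq_sum_of_fintype]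
    exact ρ.sum_eq_one (mem_univ x)
  have hρd (j) : ContMDiff (𝓡 (k + 4)) 𝓘(ℝ, ℝ) ∞ (ρ j) := (ρ j).contMDiff
  -- The derivative of `∑ ρ_j = 1`.
  have hdρ (x : M) : ∑ j, (mvfderiv (𝓡 (k + 4)) (ρ j) x).toLinearMap = 0 := by
    have h := (mvfderiv_finset_sum (fun j ↦ (hρd j).mdifferentiableAt (by simp) (x := x))
      Finset.univ).2
    have h1 : ∑ j, (ρ j : M → ℝ) = fun _ ↦ 1 := by
      ext x
      rw [Finset.sum_apply]
      exact hρ1 x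
    rw [h1, mvfderiv_const] at h
    ext v
    have h2 := congr($h v)
    rw [sum_apply] at h2
    exact (LinearMap.sum_apply _ _ _).trans h2.symm
  have hc : Continuous fun x ↦ D'.calibDensity o Φ x - D.calibDensity o Φ x :=
    (D'.continuous_calibDensity hΦ).sub (D.continuous_calibDensity hΦ)
  -- Each cut-off piece contributes `-(1 / k!) ∫ dρ_j ∧ T ∧ Φ` with the same global `T`, so the
  -- pieces sum to the contribution of the zero covector.
  have h0 : ∫ x, (D'.calibDensity o Φ x - D.calibDensity o Φ x)
      ∂(riemannianVolume (k + 4) M) = 0 := calc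
    _ = ∫ x, ∑ j, ρ j x * (D'.calibDensity o Φ x - D.calibDensity o Φ x)
        ∂(riemannianVolume (k + 4) M) := by simp only [← Finset.sum_mul, hρ1, one_mul]
    _ = ∑ j, -(k.factorial : ℝ)⁻¹ * ∫ x, transDensity D D' o Φ x
        (mvfderiv (𝓡 (k + 4)) (ρ j) x).toLinearMap ∂(riemannianVolume (k + 4) M) := by
      refine (integral_finsetSum _ fun j _ ↦
        integrable_riemannianVolume o ((hρd j).continuous.mul hc)).trans ?_
      exact Finset.sum_congr rfl fun j _ ↦ integral_mul_calibDensity_sub D D' hΦ hd (hs j) (hρd j)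
        ((hρN j).trans inter_subset_left) ((hρN j).trans inter_subset_right)
    _ = 0 := by
      rw [← Finset.mul_sum, ← integral_finsetSum _ fun j _ ↦
        integrable_riemannianVolume o (continuous_transDensity D D' hΦ (hρd j))]
      simp only [← transDensity_sum, hdρ, transDensity_zero, integral_zero, mul_zero]
  rw [integral_sub (integrable_riemannianVolume o (D'.continuous_calibDensity hΦ))
    (integrable_riemannianVolume o (D.continuous_calibDensity hΦ)), sub_eq_zero] at h0
  exact h0

lemma calibDensity_le_curvatureNormSq (hΦ : IsYangMillsCalibratingForm o Φ) (x : M) :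
    D.calibDensity o Φ x ≤ D.curvatureNormSq x := by
  have : FiniteDimensional ℂ (E x) :=
    ((trivializationAt F E x).continuousLinearEquivAt ℂ x
      (FiberBundle.mem_baseSet_trivializationAt' x)).toLinearEquiv.symm.finiteDimensional
  exact qForm_le_normSqForm_of_skew _ _ (hΦ.le_normSq x) _ fun v s t ↦ D.curvature_skew x v s t

theorem yangMills_le_of_isCalibrated (hΦ : IsYangMillsCalibratingForm o Φ)
    (hD : D.IsCalibrated o Φ) :
    D.yangMills ≤ D'.yangMills ∧ (D'.yangMills = D.yangMills → D'.IsCalibrated o Φ) := by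
  have hq' := D'.continuous_calibDensity (o := o) hΦ.smooth
  have hF' := D'.continuous_curvatureNormSq o
  have h1 : D.yangMills = ∫ x, D'.calibDensity o Φ x ∂(riemannianVolume (k + 4) M) := by
    rw [integral_calibDensity_eq D D' hΦ.smooth hΦ.closed]
    exact integral_congr_ae (.of_forall fun x ↦ (hD x).symm)
  have hle := D'.calibDensity_le_curvatureNormSq hΦ
  refine ⟨h1 ▸ integral_mono (integrable_riemannianVolume o hq')
    (integrable_riemannianVolume o hF') hle, fun h x ↦ ?_⟩
  have := isOpenPosMeasure_riemannianVolume o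
  have h2 : ∫ x, (D'.curvatureNormSq x - D'.calibDensity o Φ x)
      ∂(riemannianVolume (k + 4) M) = 0 := by
    rw [integral_sub (integrable_riemannianVolume o hF') (integrable_riemannianVolume o hq'),
      ← h1, ← h]
    exact sub_self _
  rw [integral_eq_zero_iff_of_nonneg (fun x ↦ sub_nonneg.2 (hle x))
    (integrable_riemannianVolume o (hF'.sub hq'))] at h2
  -- Two continuous functions equal almost everywhere agree everywhere, since nonempty open sets
  -- have positive volume.
  have h3 := ((hF'.sub hq').ae_eq_iff_eq _ continuous_zero).1 h2
  exact (sub_eq_zero.1 (congrFun h3 x)).symm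

end HermitianConnection

end Global

end YMCalib

end

theorem mainTheorem7 {k : ℕ} {M : Type*} [TopologicalSpace M] [T2Space M] [CompactSpace M]
    [ChartedSpace (EuclideanSpace ℝ (Fin (k + 4))) M] [IsManifold (𝓡 (k + 4)) ∞ M]
    [MeasurableSpace M] [BorelSpace M]
    [RiemannianBundle (fun x : M ↦ TangentSpace (𝓡 (k + 4)) x)]
    [IsContMDiffRiemannianBundle (𝓡 (k + 4)) ∞ (EuclideanSpace ℝ (Fin (k + 4)))
      (fun x : M ↦ TangentSpace (𝓡 (k + 4)) x)]
    (o : YMCalib.ManifoldOrientation (k + 4) M)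
    {F : Type*} [NormedAddCommGroup F] [NormedSpace ℂ F] [FiniteDimensional ℂ F]
    {E : M → Type*} [TopologicalSpace (TotalSpace F E)]
    [∀ x, NormedAddCommGroup (E x)] [∀ x, InnerProductSpace ℂ (E x)]
    [FiberBundle F E] [VectorBundle ℂ F E] [VectorBundle ℝ F E]
    [ContMDiffVectorBundle ∞ F E (𝓡 (k + 4))] [IsContMDiffRiemannianBundle (𝓡 (k + 4)) ∞ F E]
    (Φ : YMCalib.DForm (k + 4) M k) (hΦ : YMCalib.IsYangMillsCalibratingForm o Φ)
    (D : YMCalib.HermitianConnection (k + 4) F E) (hD : D.IsCalibrated o Φ)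
    (D' : YMCalib.HermitianConnection (k + 4) F E) :
    D.yangMills ≤ D'.yangMills ∧ (D'.yangMills = D.yangMills → D'.IsCalibrated o Φ) :=
  YMCalib.HermitianConnection.yangMills_le_of_isCalibrated D D' hΦ hD
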